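/- **Setting.** Let \(L\) be a smooth Jordan arc oriented from \(-1\) to \(1\) (smooth: \(C^1\) with non-vanishing derivative). For such an arc \(\gamma\) let \(w_\gamma(z)=\sqrt{z^2-1}\) be the branch holomorphic in \(\mathbb C\setminus\gamma\) with \(w_\gamma(z)=z+O(1)\) at infinity, let \(w_{\gamma+}\) be its trace on the left-hand side of \(\gamma\), and let \(\varphi_\gamma(z)=z-w_\gamma(z)\), \(\varphi_\gamma(\infty)=0\). Let \(\{E_i\}\) be an interpolation scheme: \(E_i\) is a multiset of \(i\) points of \(\overline{\mathbb C}\setminus L\). Put \(B_i(\zeta)=\prod_{e\in E_i}\frac{\zeta-\varphi_L(e)}{1-\zeta\varphi_L(e)}\) and \(J(\zeta)=(\zeta+1/\zeta)/2\). *Symmetric contour.* Let \(\Gamma=\bigcup_{l=-k}^{k}\Gamma_l\), where the \(\Gamma_l\) are pairwise disjoint smooth Jordan curves in \(\mathbb C\setminus\{0\}\), \(\Gamma_0\ni\pm1\), \(\Gamma_l\) lies in the interior of \(\Gamma_0\) for \(l>0\), and \(\Gamma_{-l}=\{\tau:1/\tau\in\Gamma_l\}\) for \(0\le l\le k\). Assume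 that (i) \(|B_i|\le M\) on \(\Gamma\) for all \(i\), with some constant \(M>0\); (ii) in each connected component of the complement of \(\Gamma\), locally uniformly, either \(|B_i|\to0\) or \(|B_i|\to\infty\); (iii) for all large \(i\), \(B_i\) has no poles in the components where \(|B_j|\to0\) as \(j\to\infty\), and no zeros in those where \(|B_j|\to\infty\). Let \(\Delta_l=J(\Gamma_l)\), \(\Delta=\bigcup_{l=0}^{k}\Delta_l\) and \(D_\Delta=\overline{\mathbb C}\setminus\Delta\). Here \(\Delta_0\) is an arc, oriented from \(-1\) to \(1\), and each \(\Delta_l\), \(l>0\), is a Jordan curve, assumed to have \(\Delta_0\) in its exterior. Let \(D_\Delta^0\) and \(D_\Delta^\infty\) be the parts of \(D_\Delta\) where \(|b_i|\to0\) and \(|b_i|\to\infty\), with \(b_i(z)=B_i(\varphi_{\Delta_0}(z))\). Orient each \(\Delta_l\), \(l>0\), so that \(D_\Delta^0\) lies to its left. *Density.* Let \(U_b\) and \(U_u\) be the sets of \(z\notin L\cup\Delta_0\) where \(w_L(z)=-w_{\Delta_0}(z)\) and where \(w_L(z)=w_{\Delta_0}(z)\), respectively, with \(\infty\in U_u\).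 Let \(\rho\) be analytic in a domain of \(\overline{\mathbb C}\) containing \(L\), \(\Delta_0\), the closed interior of each \(\Delta_l\), \(l>0\), and \(\overline{U}_b\) if \(\infty\in D_\Delta^0\), resp. \(\overline{U}_u\) if \(\infty\in D_\Delta^\infty\); let \(\rho\) be non-vanishing on \(\Delta_0\) and on the closed interiors of the \(\Delta_l\), \(l>0\). Put \(w=\varsigma w_{\Delta_0+}\) on \(\Delta_0\), where \(\varsigma=1\) if \(\infty\in D_\Delta^0\) and \(\varsigma=-1\) if \(\infty\in D_\Delta^\infty\), and \(w=w_{\Delta_0}\) on \(\Delta_l\), \(l>0\). Define \[\widehat\rho_L(z)=\frac1{2\pi i}\int_L\frac{\rho(s)}{s-z}\frac{ds}{w_{L+}(s)},\qquad \widehat\rho_\Delta(z)=\frac1{2\pi i}\int_\Delta\frac{\rho(s)}{s-z}\frac{ds}{w(s)}.\] *Padé approximants.* For integers \(m,n\ge0\) let \(v_{m,n}(z)=\prod_{e\in E_{m+n},\,e\ne\infty}(z-e)\), and let \(p_{m,n},q_{m,n}\) be the polynomials with \(\deg p_{m,n}\le m\), \(\deg q_{m,n}\le n\), \(q_{m,n}\)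 monic of minimal degree, such that \((q_{m,n}\widehat\rho_L-p_{m,n})/v_{m,n}\) is analytic in \(\overline{\mathbb C}\setminus L\) and is \(O(z^{-\min\{m,n\}-1})\) at infinity. **Proposition.** For all \(m,n\) with \(m+n\) large enough, the function of the second kind \[R_{m,n}(z)=\frac{q_{m,n}(z)\widehat\rho_\Delta(z)-p_{m,n}(z)}{v_{m,n}(z)}\] (defined by continuity at the zeros of \(v_{m,n}\)) is analytic in \(D_\Delta\setminus\{\infty\}\) and tends to \(0\) at infinity, and for every \(z\in D_\Delta\setminus\{\infty\}\) the following integral converges and \[R_{m,n}(z)=\frac1{2\pi i}\int_\Delta\frac{q_{m,n}(s)}{v_{m,n}(s)}\frac{\rho(s)}{w(s)}\frac{ds}{s-z}.\] -/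

import Mathlib

open Set Filter Topology Polynomial

noncomputable section

namespace MultipointPade

/-! ### Curves

An arc is a map `γ : ℝ → ℂ` of which only the restriction to `[0, 1]` matters; a closed curve is a
`1`-periodic map.  Smooth means continuously differentiable with nowhere vanishing derivative. -/

/-- The trace of an arc parametrized by `[0, 1]`. -/
def arcSet (γ : ℝ → ℂ) : Set ℂ := γ '' Icc 0 1

/-- A smooth Jordan arc joining `-1` to `1`, oriented from `-1` to `1`.  (A continuously
differentiable map on `[0, 1]` always extends to a continuously differentiable map on `ℝ`.) -/
structure IsSmoothArc (γ : ℝ → ℂ) : Prop where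
  contDiff : ContDiff ℝ 1 γ
  injOn : InjOn γ (Icc 0 1)
  deriv_ne : ∀ t ∈ Icc (0 : ℝ) 1, deriv γ t ≠ 0
  start : γ 0 = -1
  finish : γ 1 = 1

/-- A smooth Jordan curve, parametrized with period `1`. -/
structure IsSmoothJordanCurve (γ : ℝ → ℂ) : Prop where
  contDiff : ContDiff ℝ 1 γ
  periodic : Function.Periodic γ 1
  injOn : InjOn γ (Ico 0 1)
  deriv_ne : ∀ t, deriv γ t ≠ 0

/-- The interior of a Jordan curve `C`: the points that lie in a bounded component of the
complement of `C`. -/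
def curveInterior (C : Set ℂ) : Set ℂ :=
  {z | z ∉ C ∧ Bornology.IsBounded (connectedComponentIn Cᶜ z)}

/-- The contour integral of `h` along the part of `γ` parametrized by `[0, 1]`; the integrand is
allowed to depend on the parameter, since boundary values from one side of the curve occur. -/
def pathIntegral (γ : ℝ → ℂ) (h : ℝ → ℂ) : ℂ := ∫ t in (0 : ℝ)..1, h t * deriv γ t

/-- The trace of `f` at `γ t` from the left-hand side of the oriented curve `γ`. -/
def leftTrace (f : ℂ → ℂ) (γ : ℝ → ℂ) (t : ℝ) : ℂ :=
  limUnder (𝓝[>] (0 : ℝ)) fun ε : ℝ => f (γ t + ε * (Complex.I * deriv γ t))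

/-! ### The square root, the conformal map, the Joukovski map -/

/-- For an arc `γ` from `-1` to `1`, the branch of `√(z² - 1)` that is holomorphic off `γ` and is
`z + O(1)` at infinity.  It is given by the formula `(z + 1) exp (½ ∫_γ ds / (s - z))`, where the
integral is the branch of `log ((z - 1) / (z + 1))` off `γ` that vanishes at infinity; see
`wBranch_sq`, `wBranch_differentiableOn` and `wBranch_isBigO`. -/
def wBranch (γ : ℝ → ℂ) (z : ℂ) : ℂ :=
  (z + 1) * Complex.exp (pathIntegral γ (fun t => (γ t - z)⁻¹) / 2)

/-- `φ_γ(z) = z - w_γ(z)`, extended by its value `0` at infinity. -/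
def phi (γ : ℝ → ℂ) (e : OnePoint ℂ) : ℂ := e.elim 0 fun z => z - wBranch γ z

/-- The Joukovski map. -/
def joukovski (ζ : ℂ) : ℂ := (ζ + ζ⁻¹) / 2

theorem continuousOn_inv_sub {γ : ℝ → ℂ} (hγ : ContDiff ℝ 1 γ) {z : ℂ} (hz : z ∉ arcSet γ) :
    ContinuousOn (fun t => (γ t - z)⁻¹ * deriv γ t) (Icc 0 1) := by
  refine ContinuousOn.mul (ContinuousOn.inv₀ ?_ ?_) (hγ.continuous_deriv le_rfl).continuousOn
  · exact (hγ.continuous.sub continuous_const).continuousOn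
  · intro t ht h
    exact hz ⟨t, ht, sub_eq_zero.mp h⟩

theorem isCompact_arcSet {γ : ℝ → ℂ} (hγ : ContDiff ℝ 1 γ) : IsCompact (arcSet γ) :=
  isCompact_Icc.image hγ.continuous

theorem wBranch_sq {γ : ℝ → ℂ} (hγ : ContDiff ℝ 1 γ) (h0 : γ 0 = -1) (h1 : γ 1 = 1) {z : ℂ}
    (hz : z ∉ arcSet γ) : wBranch γ z ^ 2 = z ^ 2 - 1 := by
  have hc := continuousOn_inv_sub hγ hz
  have hd : ∀ t ∈ Icc (0 : ℝ) 1, HasDerivWithinAt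
      (fun u => ∫ x in (0 : ℝ)..u, (γ x - z)⁻¹ * deriv γ x) ((γ t - z)⁻¹ * deriv γ t)
      (Icc 0 1) t := by
    intro t ht
    have : Fact (t ∈ Icc (0 : ℝ) 1) := ⟨ht⟩
    apply intervalIntegral.integral_hasDerivWithinAt_right
    · apply ContinuousOn.intervalIntegrable
      rw [uIcc_of_le ht.1]
      exact hc.mono (Icc_subset_Icc_right ht.2)
    · exact hc.stronglyMeasurableAtFilter_nhdsWithin measurableSet_Icc t
    · exact hc t ht
  have hγd : ∀ t, HasDerivAt γ (deriv γ t) t := fun t =>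
    ((hγ.differentiable one_ne_zero) t).hasDerivAt
  have hF : ∀ t ∈ Icc (0 : ℝ) 1, HasDerivWithinAt
      (fun u => (γ u - z) * Complex.exp (-∫ x in (0 : ℝ)..u, (γ x - z)⁻¹ * deriv γ x)) 0
      (Icc 0 1) t := by
    intro t ht
    have hne : γ t - z ≠ 0 := fun h => hz ⟨t, ht, sub_eq_zero.mp h⟩
    have := ((hγd t).sub_const z).hasDerivWithinAt (s := Icc 0 1) |>.mul (hd t ht).neg.cexp
    refine this.congr_deriv ?_
    have h1 : (γ t - z) * (γ t - z)⁻¹ = 1 := mul_inv_cancel₀ hne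
    set e := Complex.exp (-∫ x in (0 : ℝ)..t, (γ x - z)⁻¹ * deriv γ x)
    linear_combination (-(e * deriv γ t)) * h1
  have hconst := constant_of_has_deriv_right_zero
    (fun t ht => (hF t ht).continuousWithinAt)
    (fun t ht => ((hF t ⟨ht.1, ht.2.le⟩).mono_of_mem_nhdsWithin
      (Icc_mem_nhdsGE_of_mem ht))) 1 (by simp)
  simp only [h0, h1, intervalIntegral.integral_same, neg_zero, Complex.exp_zero, mul_one]
    at hconst
  set I := ∫ x in (0 : ℝ)..1, (γ x - z)⁻¹ * deriv γ x with hI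
  have e1 : (1 - z) = (-1 - z) * Complex.exp I := by
    rw [← hconst, mul_assoc, ← Complex.exp_add]; simp
  have e2 : wBranch γ z ^ 2 = (z + 1) ^ 2 * Complex.exp I := by
    unfold wBranch pathIntegral
    rw [mul_pow, ← Complex.exp_nat_mul, ← hI]
    congr 2
    push_cast
    ring
  rw [e2]
  linear_combination (z + 1) * e1

theorem wBranch_differentiableOn {γ : ℝ → ℂ} (hγ : ContDiff ℝ 1 γ) :
    DifferentiableOn ℂ (wBranch γ) (arcSet γ)ᶜ := by
  intro z hz
  obtain ⟨δ, hδ, hball⟩ := Metric.isOpen_iff.mp (isCompact_arcSet hγ).isClosed.isOpen_compl z hz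
  obtain ⟨C, hC⟩ := isCompact_Icc.exists_bound_of_continuousOn (s := Icc (0 : ℝ) 1)
    (hγ.continuous_deriv le_rfl).continuousOn
  have hC0 : 0 ≤ C := (norm_nonneg _).trans (hC 0 (by simp))
  have hsub : Set.uIoc (0 : ℝ) 1 ⊆ Icc 0 1 := by
    rw [uIoc_of_le zero_le_one]; exact Ioc_subset_Icc_self
  have hfar : ∀ t ∈ Icc (0 : ℝ) 1, ∀ x ∈ Metric.ball z (δ / 2), δ / 2 ≤ ‖γ t - x‖ := by
    intro t ht x hx
    by_contra! h
    have hmem : γ t ∈ Metric.ball z δ := by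
      rw [Metric.mem_ball] at hx ⊢
      have := dist_triangle (γ t) x z
      rw [dist_eq_norm (γ t) x] at this
      linarith
    exact hball hmem ⟨t, ht, rfl⟩
  have hnot : ∀ x ∈ Metric.ball z (δ / 2), x ∉ arcSet γ := fun x hx =>
    hball (Metric.ball_subset_ball (by linarith) hx)
  have hmem : Metric.ball z (δ / 2) ∈ 𝓝 z := Metric.ball_mem_nhds z (by linarith)
  have key := intervalIntegral.hasDerivAt_integral_of_dominated_loc_of_deriv_le
    (μ := MeasureTheory.volume) (a := 0) (b := 1)
    (F := fun x t => (γ t - x)⁻¹ * deriv γ t)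
    (F' := fun x t => ((γ t - x)⁻¹) ^ 2 * deriv γ t)
    (bound := fun _ => ((δ / 2)⁻¹) ^ 2 * C) hmem
    (by
      filter_upwards [hmem] with x hx
      exact ((continuousOn_inv_sub hγ (hnot x hx)).mono hsub).aestronglyMeasurable
        measurableSet_uIoc)
    (by
      apply ContinuousOn.intervalIntegrable
      rw [uIcc_of_le zero_le_one]
      exact continuousOn_inv_sub hγ hz)
    (by
      refine ContinuousOn.aestronglyMeasurable ?_ measurableSet_uIoc
      refine ContinuousOn.mul (ContinuousOn.pow (ContinuousOn.inv₀ ?_ ?_) 2)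
        (hγ.continuous_deriv le_rfl).continuousOn
      · exact (hγ.continuous.sub continuous_const).continuousOn
      · intro t ht h
        exact hz ⟨t, hsub ht, sub_eq_zero.mp h⟩)
    (Filter.Eventually.of_forall fun t ht x hx => by
      rw [norm_mul, norm_pow, norm_inv]
      have h1 := hfar t (hsub ht) x hx
      have h2 := hC t (hsub ht)
      have : 0 < δ / 2 := by linarith
      gcongr)
    (by simp)
    (Filter.Eventually.of_forall fun t ht x hx => by
      have hne : γ t - x ≠ 0 := fun h => hnot x hx ⟨t, hsub ht, sub_eq_zero.mp h⟩
      have h := (((hasDerivAt_id x).const_sub (γ t)).fun_inv hne).mul_const (deriv γ t)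
      refine h.congr_deriv ?_
      rw [neg_neg, one_div, inv_pow]
      rfl)
  have hexp := ((hasDerivAt_id z).add_const 1).mul (key.2.div_const 2).cexp
  exact hexp.differentiableAt.differentiableWithinAt

theorem wBranch_isBigO {γ : ℝ → ℂ} (hγ : ContDiff ℝ 1 γ) :
    (fun z => wBranch γ z - z) =O[cocompact ℂ] (fun _ => (1 : ℝ)) := by
  obtain ⟨C, hC⟩ := isCompact_Icc.exists_bound_of_continuousOn (s := Icc (0 : ℝ) 1)
    (hγ.continuous_deriv le_rfl).continuousOn
  obtain ⟨A, hA⟩ := isCompact_Icc.exists_bound_of_continuousOn (s := Icc (0 : ℝ) 1)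
    hγ.continuous.continuousOn
  have hC0 : 0 ≤ C := (norm_nonneg _).trans (hC 0 (by simp))
  have hA0 : 0 ≤ A := (norm_nonneg _).trans (hA 0 (by simp))
  refine Asymptotics.IsBigO.of_bound (1 + 4 * C) ?_
  have hlarge : ∀ᶠ z : ℂ in cocompact ℂ, 1 + 2 * A + 2 * C ≤ ‖z‖ :=
    tendsto_norm_cocompact_atTop.eventually_ge_atTop _
  filter_upwards [hlarge] with z hz
  have hzpos : 0 < ‖z‖ := by linarith
  set h : ℂ := pathIntegral γ (fun t => (γ t - z)⁻¹) / 2 with hh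
  have hint : ‖h‖ ≤ C / ‖z‖ := by
    have : ‖∫ t in (0 : ℝ)..1, (γ t - z)⁻¹ * deriv γ t‖ ≤ (2 / ‖z‖ * C) * |1 - 0| := by
      apply intervalIntegral.norm_integral_le_of_norm_le_const
      intro t ht
      rw [uIoc_of_le zero_le_one] at ht
      have ht' := Ioc_subset_Icc_self ht
      have h1 := hA t ht'
      have h2 := hC t ht'
      have h3 : ‖z‖ / 2 ≤ ‖γ t - z‖ := by
        have := norm_sub_norm_le z (γ t)
        rw [norm_sub_rev] at this
        linarith
      rw [norm_mul, norm_inv]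
      have h4 : ‖γ t - z‖⁻¹ ≤ 2 / ‖z‖ := by
        rw [← inv_div]
        exact inv_anti₀ (by linarith) h3
      gcongr
    rw [hh, norm_div]
    simp only [sub_zero, abs_one, mul_one, Complex.norm_ofNat] at this ⊢
    unfold pathIntegral
    calc _ ≤ 2 / ‖z‖ * C / 2 := by gcongr
      _ = _ := by ring
  have hsmall : ‖h‖ ≤ 1 := hint.trans ((div_le_one hzpos).mpr (by linarith))
  have hexp : ‖Complex.exp h - 1‖ ≤ 2 * (C / ‖z‖) :=
    (Complex.norm_exp_sub_one_le hsmall).trans (by gcongr)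
  have hw : wBranch γ z - z = 1 + (z + 1) * (Complex.exp h - 1) := by
    unfold wBranch
    rw [← hh]
    ring
  have hz1 : ‖z + 1‖ ≤ 2 * ‖z‖ := by
    have := norm_add_le z 1
    rw [norm_one] at this
    linarith
  rw [hw, norm_one, mul_one]
  calc ‖1 + (z + 1) * (Complex.exp h - 1)‖
      ≤ 1 + ‖z + 1‖ * ‖Complex.exp h - 1‖ := by
        simpa using norm_add_le (1 : ℂ) ((z + 1) * (Complex.exp h - 1))
    _ ≤ 1 + (2 * ‖z‖) * (2 * (C / ‖z‖)) := by gcongr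
    _ = 1 + 4 * C := by field_simp; ring

/-! ### Interpolation schemes and multipoint Padé approximants -/

/-- An interpolation scheme off `L`: the `i`-th multiset has `i` elements, finite or infinite, and
none of them lies on `L`. -/
structure IsInterpolationScheme (L : ℝ → ℂ) (E : ℕ → Multiset (OnePoint ℂ)) : Prop where
  card_eq : ∀ i, Multiset.card (E i) = i
  notMem : ∀ i, ∀ z : ℂ, (z : OnePoint ℂ) ∈ E i → z ∉ arcSet L

/-- The function `(2πi)⁻¹ ∫_L ρ(s) / (s - z) ds / w_{L+}(s)`. -/
def rhoHat (L : ℝ → ℂ) (ρ : ℂ → ℂ) (z : ℂ) : ℂ :=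
  (2 * Real.pi * Complex.I)⁻¹ *
    pathIntegral L fun t => ρ (L t) / (L t - z) / leftTrace (wBranch L) L t

/-- The monic polynomial that vanishes at the finite elements of a multiset, with
multiplicities. -/
def nodePoly (S : Multiset (OnePoint ℂ)) : ℂ[X] :=
  (S.map fun e => e.elim 1 fun z => X - C z).prod

/-- `(p, q)` solves the linear interpolation problem of type `(m, n)` for `f` at the nodes `S`:
`(q f - p) / v` is analytic off `K` and `O(z ^ (-min m n - 1))` at infinity, where `v` is the
monic polynomial with the finite nodes as zeros. -/
structure IsInterpolationPair (K : Set ℂ) (f : ℂ → ℂ) (S : Multiset (OnePoint ℂ)) (m n : ℕ)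
    (p q : ℂ[X]) : Prop where
  degree_num : p.natDegree ≤ m
  degree_den : q.natDegree ≤ n
  den_ne : q ≠ 0
  remainder : ∃ R : ℂ → ℂ, DifferentiableOn ℂ R Kᶜ ∧
    (∀ z ∉ K, (nodePoly S).eval z * R z = q.eval z * f z - p.eval z) ∧
    R =O[cocompact ℂ] fun z => (z ^ (min m n + 1))⁻¹

/-- `p = p_{m,n}` and `q = q_{m,n}` form the solution with monic `q` of minimal degree. -/
structure IsMultipointPade (L : ℝ → ℂ) (ρ : ℂ → ℂ) (E : ℕ → Multiset (OnePoint ℂ)) (m n : ℕ)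
    (p q : ℂ[X]) : Prop where
  pair : IsInterpolationPair (arcSet L) (rhoHat L ρ) (E (m + n)) m n p q
  monic : q.Monic
  minimal : ∀ p' q' : ℂ[X],
    IsInterpolationPair (arcSet L) (rhoHat L ρ) (E (m + n)) m n p' q' → q.natDegree ≤ q'.natDegree

/-! ### The rational functions `B_i`

`B_i = blaschkeNum / blaschkeDen`; numerator and denominator have no common zeros when the nodes
lie off `L`, so poles are the zeros of the denominator and bounds on `|B_i|` can be written without
division. -/

/-- The numerator `∏_{e ∈ E_i} (ζ - φ_L(e))` of `B_i`. -/
def blaschkeNum (L : ℝ → ℂ) (E : ℕ → Multiset (OnePoint ℂ)) (i : ℕ) (ζ : ℂ) : ℂ :=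
  ((E i).map fun e => ζ - phi L e).prod

/-- The denominator `∏_{e ∈ E_i} (1 - ζ φ_L(e))` of `B_i`. -/
def blaschkeDen (L : ℝ → ℂ) (E : ℕ → Multiset (OnePoint ℂ)) (i : ℕ) (ζ : ℂ) : ℂ :=
  ((E i).map fun e => 1 - ζ * phi L e).prod

/-- `|B_i| → 0` uniformly on `K` as `i → ∞`. -/
def TendsZeroOn (L : ℝ → ℂ) (E : ℕ → Multiset (OnePoint ℂ)) (K : Set ℂ) : Prop :=
  ∀ ε : ℝ, 0 < ε → ∀ᶠ i in atTop, ∀ ζ ∈ K, ‖blaschkeNum L E i ζ‖ ≤ ε * ‖blaschkeDen L E i ζ‖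

/-- `|B_i| → ∞` uniformly on `K` as `i → ∞`. -/
def TendsInftyOn (L : ℝ → ℂ) (E : ℕ → Multiset (OnePoint ℂ)) (K : Set ℂ) : Prop :=
  ∀ ε : ℝ, 0 < ε → ∀ᶠ i in atTop, ∀ ζ ∈ K, ‖blaschkeDen L E i ζ‖ ≤ ε * ‖blaschkeNum L E i ζ‖

/-! ### The symmetric contour

The curves are `Γ_l = range (g l)` for `0 ≤ l ≤ k` and `Γ_{-l} = {τ : τ⁻¹ ∈ Γ_l}`. -/

/-- The curve `Γ_l` for an integer `l`. -/
def gammaSet (g : ℕ → ℝ → ℂ) (l : ℤ) : Set ℂ :=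
  if 0 ≤ l then range (g l.natAbs) else {τ | τ⁻¹ ∈ range (g l.natAbs)}

/-- `Γ`, the union of the curves `Γ_l` over `-k ≤ l ≤ k`. -/
def gammaUnion (k : ℕ) (g : ℕ → ℝ → ℂ) : Set ℂ := ⋃ l ∈ Icc (-(k : ℤ)) k, gammaSet g l

/-- The arc `Δ_0 = J(Γ_0)`, parametrized from `-1` to `1` by the half of `Γ_0` that `g 0`
describes on `[0, 1/2]` (the other half has the same image). -/
def delta0 (g : ℕ → ℝ → ℂ) (t : ℝ) : ℂ := joukovski (g 0 (t / 2))

/-- The closed curve `Δ_l = J(Γ_l)`, for `l > 0`. -/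
def deltaCurve (g : ℕ → ℝ → ℂ) (l : ℕ) (t : ℝ) : ℂ := joukovski (g l t)

/-- The contour `Δ = J(Γ)`. -/
def deltaSet (k : ℕ) (g : ℕ → ℝ → ℂ) : Set ℂ := joukovski '' gammaUnion k g

/-- `D_Δ^0`, as a subset of the Riemann sphere: the points off `Δ` where
`|b_i(z)| = |B_i(φ_{Δ_0}(z))| → 0`. -/
def domainZero (L : ℝ → ℂ) (E : ℕ → Multiset (OnePoint ℂ)) (k : ℕ) (g : ℕ → ℝ → ℂ) :
    Set (OnePoint ℂ) :=
  {z | (∀ s ∈ deltaSet k g, z ≠ (s : OnePoint ℂ)) ∧ TendsZeroOn L E {phi (delta0 g) z}}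

/-- The curves `g 0, …, g k` define a symmetric contour for the interpolation scheme `E`.

In `dichotomy` it suffices to look at the finite points of the complement of `Γ`, since
`B_i(1/ζ) = 1/B_i(ζ)` carries the statement from a neighbourhood of `0` to one of infinity. -/
structure IsSymmetricContour (L : ℝ → ℂ) (E : ℕ → Multiset (OnePoint ℂ)) (k : ℕ)
    (g : ℕ → ℝ → ℂ) : Prop where
  /-- The curves are smooth Jordan curves that do not pass through `0` (so that the curves
  `Γ_{-l}` are Jordan curves in the plane as well). -/
  smooth : ∀ l ≤ k, IsSmoothJordanCurve (g l)
  zero_notMem : ∀ l ≤ k, (0 : ℂ) ∉ range (g l)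
  /-- The curves `Γ_l`, `-k ≤ l ≤ k`, are pairwise disjoint. -/
  disjoint : (Icc (-(k : ℤ)) k).PairwiseDisjoint (gammaSet g)
  /-- `Γ_0` is invariant under `τ ↦ 1/τ` and contains `±1`. -/
  inv_mem : ∀ τ, τ⁻¹ ∈ range (g 0) ↔ τ ∈ range (g 0)
  neg_one : g 0 0 = -1
  one : g 0 (1 / 2) = 1
  /-- The curves `Γ_l`, `l > 0`, lie in the interior of `Γ_0`. -/
  inside : ∀ l, 1 ≤ l → l ≤ k → range (g l) ⊆ curveInterior (range (g 0))
  /-- `|B_i| ≤ M` on `Γ`. -/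
  bounded : ∃ M : ℝ, 0 < M ∧ ∀ i, ∀ τ ∈ gammaUnion k g,
    ‖blaschkeNum L E i τ‖ ≤ M * ‖blaschkeDen L E i τ‖
  /-- In each component of the complement of `Γ`, locally uniformly, `|B_i| → 0` or
  `|B_i| → ∞`. -/
  dichotomy : ∀ ζ ∉ gammaUnion k g,
    (∀ K ⊆ connectedComponentIn (gammaUnion k g)ᶜ ζ, IsCompact K → TendsZeroOn L E K) ∨
    (∀ K ⊆ connectedComponentIn (gammaUnion k g)ᶜ ζ, IsCompact K → TendsInftyOn L E K)
  /-- For all large `i`, the function `B_i` has no poles where `|B_j| → 0` and no zeros where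
  `|B_j| → ∞`. -/
  regular : ∀ᶠ i in atTop, ∀ ζ : ℂ,
    (TendsZeroOn L E {ζ} → blaschkeDen L E i ζ ≠ 0) ∧
    (TendsInftyOn L E {ζ} → blaschkeNum L E i ζ ≠ 0)
  /-- Each curve `Δ_l`, `l > 0`, has `Δ_0` in its exterior. -/
  exterior : ∀ l, 1 ≤ l → l ≤ k →
    Disjoint (arcSet (delta0 g)) (curveInterior (range (deltaCurve g l)))
  /-- Each curve `Δ_l`, `l > 0`, is oriented so that `D_Δ^0` lies to its left. -/
  oriented : ∀ l, 1 ≤ l → l ≤ k → ∀ t : ℝ, ∀ᶠ ε : ℝ in 𝓝[>] 0,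
    ((deltaCurve g l t + ε * (Complex.I * deriv (deltaCurve g l) t) : ℂ) : OnePoint ℂ)
      ∈ domainZero L E k g

/-- The finite part of `U_b`: the points off `L` and `Δ_0` where `w_L = -w_{Δ_0}`. -/
def regionMinus (L : ℝ → ℂ) (g : ℕ → ℝ → ℂ) : Set ℂ :=
  {z | z ∉ arcSet L ∧ z ∉ arcSet (delta0 g) ∧ wBranch L z = -wBranch (delta0 g) z}

/-- The finite part of `U_u`: the points off `L` and `Δ_0` where `w_L = w_{Δ_0}`. -/
def regionPlus (L : ℝ → ℂ) (g : ℕ → ℝ → ℂ) : Set ℂ :=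
  {z | z ∉ arcSet L ∧ z ∉ arcSet (delta0 g) ∧ wBranch L z = wBranch (delta0 g) z}

/-- The assumptions on the density: `ρ` is analytic in a domain that contains `L`, `Δ_0`, the
closed interiors of the curves `Δ_l`, `l > 0`, and the closure of `U_b` if `∞ ∈ D_Δ^0`, of `U_u`
otherwise, in which case the domain contains infinity; and `ρ` does not vanish on `Δ_0` nor on the
closed interiors of the `Δ_l`. -/
def IsAdmissibleDensity (L : ℝ → ℂ) (E : ℕ → Multiset (OnePoint ℂ)) (k : ℕ) (g : ℕ → ℝ → ℂ)
    (ρ : ℂ → ℂ) : Prop :=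
  (∃ G : Set ℂ, IsOpen G ∧ IsConnected G ∧ DifferentiableOn ℂ ρ G ∧
    arcSet L ⊆ G ∧ arcSet (delta0 g) ⊆ G ∧
    (∀ l, 1 ≤ l → l ≤ k → closure (curveInterior (range (deltaCurve g l))) ⊆ G) ∧
    (OnePoint.infty ∈ domainZero L E k g → closure (regionMinus L g) ⊆ G) ∧
    (OnePoint.infty ∉ domainZero L E k g →
      closure (regionPlus L g) ⊆ G ∧ G ∈ cocompact ℂ ∧ ∃ c, Tendsto ρ (cocompact ℂ) (𝓝 c))) ∧
  (∀ z ∈ arcSet (delta0 g), ρ z ≠ 0) ∧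
  (∀ l, 1 ≤ l → l ≤ k → ∀ z ∈ closure (curveInterior (range (deltaCurve g l))), ρ z ≠ 0)

/-! ### Integration over `Δ` against `ds / w(s)` -/

open Classical in
/-- `ς = 1` if `∞ ∈ D_Δ^0` and `ς = -1` otherwise. -/
def varsigma (L : ℝ → ℂ) (E : ℕ → Multiset (OnePoint ℂ)) (k : ℕ) (g : ℕ → ℝ → ℂ) : ℂ :=
  if OnePoint.infty ∈ domainZero L E k g then 1 else -1

/-- The integrand `h(s) / w(s)` on `Δ_0`, where `w = ς w_{Δ_0 +}`. -/
def integrandZero (L : ℝ → ℂ) (E : ℕ → Multiset (OnePoint ℂ)) (k : ℕ) (g : ℕ → ℝ → ℂ)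
    (h : ℂ → ℂ) (t : ℝ) : ℂ :=
  h (delta0 g t) / (varsigma L E k g * leftTrace (wBranch (delta0 g)) (delta0 g) t)

/-- The integrand `h(s) / w(s)` on `Δ_l`, `l > 0`, where `w = w_{Δ_0}`. -/
def integrandCurve (g : ℕ → ℝ → ℂ) (h : ℂ → ℂ) (l : ℕ) (t : ℝ) : ℂ :=
  h (deltaCurve g l t) / wBranch (delta0 g) (deltaCurve g l t)

/-- `∫_Δ h(s) ds / w(s)`. -/
def deltaIntegral (L : ℝ → ℂ) (E : ℕ → Multiset (OnePoint ℂ)) (k : ℕ) (g : ℕ → ℝ → ℂ)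
    (h : ℂ → ℂ) : ℂ :=
  pathIntegral (delta0 g) (integrandZero L E k g h) +
    ∑ l ∈ Finset.Icc 1 k, pathIntegral (deltaCurve g l) (integrandCurve g h l)

/-- The integral `∫_Δ h(s) ds / w(s)` converges. -/
def DeltaIntegrable (L : ℝ → ℂ) (E : ℕ → Multiset (OnePoint ℂ)) (k : ℕ) (g : ℕ → ℝ → ℂ)
    (h : ℂ → ℂ) : Prop :=
  IntervalIntegrable (fun t => integrandZero L E k g h t * deriv (delta0 g) t)
      MeasureTheory.volume 0 1 ∧
    ∀ l ∈ Finset.Icc 1 k, IntervalIntegrable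
      (fun t => integrandCurve g h l t * deriv (deltaCurve g l) t) MeasureTheory.volume 0 1

/-- `ρ̂_Δ(z) = (2πi)⁻¹ ∫_Δ ρ(s) / (s - z) ds / w(s)`. -/
def rhoHatDelta (L : ℝ → ℂ) (E : ℕ → Multiset (OnePoint ℂ)) (k : ℕ) (g : ℕ → ℝ → ℂ)
    (ρ : ℂ → ℂ) (z : ℂ) : ℂ :=
  (2 * Real.pi * Complex.I)⁻¹ * deltaIntegral L E k g fun s => ρ s / (s - z)

/-- The function of the second kind `(q ρ̂_Δ - p) / v`; at the zeros of `v` it is defined by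
continuity. -/
def secondKind (L : ℝ → ℂ) (E : ℕ → Multiset (OnePoint ℂ)) (k : ℕ) (g : ℕ → ℝ → ℂ)
    (ρ : ℂ → ℂ) (v p q : ℂ[X]) (z : ℂ) : ℂ :=
  open Classical in
  if v.eval z ≠ 0 then (q.eval z * rhoHatDelta L E k g ρ z - p.eval z) / v.eval z
  else limUnder (𝓝[≠] z) fun ζ =>
    (q.eval ζ * rhoHatDelta L E k g ρ ζ - p.eval ζ) / v.eval ζ

end MultipointPade

end

noncomputable section

namespace MultipointPade

/-! Let F be the Cauchy integral over Δ of (q/v)(ρ/w). A polynomial factor in a density passes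
through the Cauchy integral up to an additive polynomial, so v F = q ρ̂_Δ − p + P for some
polynomial P (`exists_polynomial_deltaCauchy`), and the claim is that P = 0. If R_L = (q ρ̂_L − p)/v
is the remainder of the interpolation problem, then P/v = F − R_L − (q/v)(ρ̂_Δ − ρ̂_L). Both F and
R_L are analytic near the nodes and vanish at infinity. Hence P/v is entire and vanishes at
infinity, so it is zero (`eq_zero_of_tendsto_div`), provided that ρ̂_Δ = ρ̂_L near every finite node
and that the last term tends to 0 at infinity. At infinity there are two cases. If ∞ ∈ D_Δ^0, the
two transforms coincide near ∞. Otherwise, for large indices, no node is infinite, so deg v = m + n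
≥ deg q, and both transforms vanish at ∞.

The equality of the transforms (`rhoHatDelta_eq_rhoHat`) rests on three facts. (a) A node e is a
zero of B_i at φ_L(e) and gives a pole at 1/φ_L(e). Now φ_{Δ_0}(e) is the former if w_L(e) =
w_{Δ_0}(e) and the latter if w_L(e) = −w_{Δ_0}(e). The conditions on zeros and poles therefore put e
in D_Δ^0 in the first case and outside it in the second (`eventually_node_mem_domainZero`). (b) By
Cauchy's formula the closed curves contribute ρ/w_{Δ_0} times the sum of their winding numbers. That
sum is the indicator of D_Δ^0 at z minus its value at ∞ (`sum_windingNumber`): the curves are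
oriented with D_Δ^0 on the left, the maximum principle forbids D_Δ^0 on both sides, and the arc Δ_0
does not separate the plane. (c) Replacing L by Δ_0 changes the Cauchy integral by 0 or by a
multiple of ρ/w_{Δ_0}, according to the relative sign of the two square roots
(`cauchyTransform_traceDensity_sub`). With the sign ς this term cancels the one in (b).

For (c) no boundary behaviour of Cauchy integrals with general densities is needed. By the
Cauchy-Pompeiu formula ρ is, on a closed set K containing both arcs and the relevant region, a
constant plus a superposition of fractions 1/(z − ζ) with ζ off K. Fubini and partial fractions then
reduce everything to ρ = 1, where the transform is πi/w (`cauchyTransform_traceDensity`). The same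
device proves Cauchy's formula for the closed curves. -/

/-! ### Cauchy integrals along arcs -/

/-- The Cauchy integral of the density `a` along the part of `γ` parametrized by `[x, y]`. -/
def cauchyTransform (γ a : ℝ → ℂ) (x y : ℝ) (z : ℂ) : ℂ := ∫ t in x..y, (γ t - z)⁻¹ * a t

section CauchyTransform

variable {γ a : ℝ → ℂ} {x y : ℝ} {z : ℂ}

theorem intervalIntegrable_comp_mul (hγ : Continuous γ) (hxy : x ≤ y)
    (ha : IntervalIntegrable a MeasureTheory.volume x y) {f : ℂ → ℂ}
    (hf : ContinuousOn f (γ '' Icc x y)) :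
    IntervalIntegrable (fun t => f (γ t) * a t) MeasureTheory.volume x y := by
  refine ha.continuousOn_mul ?_
  rw [uIcc_of_le hxy]
  exact hf.comp hγ.continuousOn (mapsTo_image _ _)

theorem continuousOn_inv_sub_const {S : Set ℂ} (hz : z ∉ S) :
    ContinuousOn (fun s : ℂ => (s - z)⁻¹) S :=
  (continuousOn_id.sub continuousOn_const).inv₀ fun s hs h =>
    hz ((show s = z from sub_eq_zero.mp h) ▸ hs)

theorem intervalIntegrable_cauchy (hγ : Continuous γ) (hxy : x ≤ y)
    (ha : IntervalIntegrable a MeasureTheory.volume x y) (hz : z ∉ γ '' Icc x y) :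
    IntervalIntegrable (fun t => (γ t - z)⁻¹ * a t) MeasureTheory.volume x y :=
  intervalIntegrable_comp_mul hγ hxy ha (f := fun s => (s - z)⁻¹) (continuousOn_inv_sub_const hz)

theorem isClosed_image_Icc (hγ : Continuous γ) : IsClosed (γ '' Icc x y) :=
  (isCompact_Icc.image hγ).isClosed

theorem hasDerivAt_cauchyTransform (hγ : Continuous γ) (hxy : x ≤ y)
    (ha : IntervalIntegrable a MeasureTheory.volume x y) (hz : z ∉ γ '' Icc x y) :
    HasDerivAt (cauchyTransform γ a x y) (∫ t in x..y, ((γ t - z)⁻¹) ^ 2 * a t) z := by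
  obtain ⟨δ, hδ, hball⟩ := Metric.isOpen_iff.mp (isClosed_image_Icc hγ).isOpen_compl z hz
  have hsub : Set.uIoc x y ⊆ Icc x y := by
    rw [uIoc_of_le hxy]; exact Ioc_subset_Icc_self
  have hfar : ∀ t ∈ Icc x y, ∀ u ∈ Metric.ball z (δ / 2), δ / 2 ≤ ‖γ t - u‖ := by
    intro t ht u hu
    by_contra! h
    refine hball (?_ : γ t ∈ Metric.ball z δ) ⟨t, ht, rfl⟩
    rw [Metric.mem_ball] at hu ⊢
    have := dist_triangle (γ t) u z
    rw [dist_eq_norm (γ t) u] at this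
    linarith
  have hnot : ∀ u ∈ Metric.ball z (δ / 2), u ∉ γ '' Icc x y := fun u hu =>
    hball (Metric.ball_subset_ball (by linarith) hu)
  have hmem : Metric.ball z (δ / 2) ∈ 𝓝 z := Metric.ball_mem_nhds z (by linarith)
  refine (intervalIntegral.hasDerivAt_integral_of_dominated_loc_of_deriv_le
    (μ := MeasureTheory.volume) (a := x) (b := y)
    (F := fun u t => (γ t - u)⁻¹ * a t)
    (F' := fun u t => ((γ t - u)⁻¹) ^ 2 * a t)
    (bound := fun t => ((δ / 2)⁻¹) ^ 2 * ‖a t‖) hmem ?_ ?_ ?_ ?_ ?_ ?_).2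
  · filter_upwards [hmem] with u hu
    exact (intervalIntegrable_cauchy hγ hxy ha (hnot u hu)).def'.aestronglyMeasurable
  · exact intervalIntegrable_cauchy hγ hxy ha hz
  · exact (intervalIntegrable_comp_mul hγ hxy ha (f := fun s => ((s - z)⁻¹) ^ 2)
      ((continuousOn_inv_sub_const hz).pow 2)).def'.aestronglyMeasurable
  · refine Filter.Eventually.of_forall fun t ht u hu => ?_
    rw [norm_mul, norm_pow, norm_inv]
    have h1 := hfar t (hsub ht) u hu
    have : 0 < δ / 2 := by linarith
    gcongr
  · exact ha.norm.const_mul _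
  · refine Filter.Eventually.of_forall fun t ht u hu => ?_
    have hne : γ t - u ≠ 0 := fun h => hnot u hu ⟨t, hsub ht, sub_eq_zero.mp h⟩
    have h := (((hasDerivAt_id u).const_sub (γ t)).fun_inv hne).mul_const (a t)
    refine h.congr_deriv ?_
    rw [neg_neg, one_div, inv_pow]
    rfl

theorem differentiableOn_cauchyTransform (hγ : Continuous γ) (hxy : x ≤ y)
    (ha : IntervalIntegrable a MeasureTheory.volume x y) :
    DifferentiableOn ℂ (cauchyTransform γ a x y) (γ '' Icc x y)ᶜ := fun _ hz =>
  (hasDerivAt_cauchyTransform hγ hxy ha hz).differentiableAt.differentiableWithinAt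

theorem tendsto_cauchyTransform_cocompact (hγ : Continuous γ) (hxy : x ≤ y)
    (ha : IntervalIntegrable a MeasureTheory.volume x y) :
    Tendsto (cauchyTransform γ a x y) (cocompact ℂ) (𝓝 0) := by
  obtain ⟨A, hA⟩ := isCompact_Icc.exists_bound_of_continuousOn (s := Icc x y) hγ.continuousOn
  have hlim : Tendsto (fun z : ℂ => (‖z‖ - A)⁻¹ * ∫ t in x..y, ‖a t‖) (cocompact ℂ) (𝓝 0) := by
    have h := (tendsto_atTop_add_const_right _ (-A)
      (tendsto_norm_cocompact_atTop (E := ℂ))).inv_tendsto_atTop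
    simpa [sub_eq_add_neg] using h.mul_const (∫ t in x..y, ‖a t‖)
  refine squeeze_zero_norm' ?_ hlim
  filter_upwards [tendsto_norm_cocompact_atTop.eventually_gt_atTop A] with z hz
  unfold cauchyTransform
  rw [← intervalIntegral.integral_const_mul]
  refine intervalIntegral.norm_integral_le_of_norm_le hxy ?_ (ha.norm.const_mul _)
  refine Filter.Eventually.of_forall fun t ht => ?_
  have h1 := hA t (Ioc_subset_Icc_self ht)
  have h2 := norm_sub_norm_le z (γ t)
  rw [norm_sub_rev] at h2
  rw [norm_mul, norm_inv]
  have : 0 < ‖z‖ - A := by linarith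
  gcongr
  linarith

theorem cauchyTransform_add_adjacent (hγ : Continuous γ) {u : ℝ} (hxu : x ≤ u) (huy : u ≤ y)
    (ha : IntervalIntegrable a MeasureTheory.volume x y) (hz : z ∉ γ '' Icc x y) :
    cauchyTransform γ a x u z + cauchyTransform γ a u y z = cauchyTransform γ a x y z := by
  have h := intervalIntegrable_cauchy hγ (hxu.trans huy) ha hz
  refine intervalIntegral.integral_add_adjacent_intervals (h.mono_set ?_) (h.mono_set ?_)
  · rw [uIcc_of_le hxu, uIcc_of_le (hxu.trans huy)]; exact Icc_subset_Icc_right huy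
  · rw [uIcc_of_le huy, uIcc_of_le (hxu.trans huy)]; exact Icc_subset_Icc_left hxu

end CauchyTransform

/-! ### The logarithm `∫ ds / (s - z)` along an arc -/

section LogIntegral

variable {γ : ℝ → ℂ} {x y : ℝ} {z : ℂ}

theorem hasDerivAt_of_contDiff (hγ : ContDiff ℝ 1 γ) (t : ℝ) : HasDerivAt γ (deriv γ t) t :=
  ((hγ.differentiable one_ne_zero) t).hasDerivAt

theorem intervalIntegrable_deriv (hγ : ContDiff ℝ 1 γ) :
    IntervalIntegrable (deriv γ) MeasureTheory.volume x y :=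
  (hγ.continuous_deriv le_rfl).intervalIntegrable _ _

theorem continuousOn_inv_sub_mul_deriv (hγ : ContDiff ℝ 1 γ) (hz : z ∉ γ '' Icc x y) :
    ContinuousOn (fun t => (γ t - z)⁻¹ * deriv γ t) (Icc x y) :=
  ((continuousOn_inv_sub_const hz).comp hγ.continuous.continuousOn (mapsTo_image _ _)).mul
    (hγ.continuous_deriv le_rfl).continuousOn

/-- The product (γ u − z) exp(−∫_x^u) has zero derivative along the arc. This needs no branch of the
logarithm. -/
theorem exp_cauchyTransform_deriv (hγ : ContDiff ℝ 1 γ) (hxy : x ≤ y) (hz : z ∉ γ '' Icc x y) :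
    Complex.exp (cauchyTransform γ (deriv γ) x y z) = (γ y - z) / (γ x - z) := by
  have hc := continuousOn_inv_sub_mul_deriv hγ hz
  have hd : ∀ t ∈ Icc x y, HasDerivWithinAt
      (fun u => ∫ t in x..u, (γ t - z)⁻¹ * deriv γ t) ((γ t - z)⁻¹ * deriv γ t) (Icc x y) t := by
    intro t ht
    have : Fact (t ∈ Icc x y) := ⟨ht⟩
    apply intervalIntegral.integral_hasDerivWithinAt_right
    · apply ContinuousOn.intervalIntegrable
      rw [uIcc_of_le ht.1]
      exact hc.mono (Icc_subset_Icc_right ht.2)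
    · exact hc.stronglyMeasurableAtFilter_nhdsWithin measurableSet_Icc t
    · exact hc t ht
  have hF : ∀ t ∈ Icc x y, HasDerivWithinAt
      (fun u => (γ u - z) * Complex.exp (-∫ t in x..u, (γ t - z)⁻¹ * deriv γ t)) 0
      (Icc x y) t := by
    intro t ht
    have hne : γ t - z ≠ 0 := fun h => hz ⟨t, ht, sub_eq_zero.mp h⟩
    have := ((hasDerivAt_of_contDiff hγ t).sub_const z).hasDerivWithinAt (s := Icc x y)
      |>.mul (hd t ht).neg.cexp
    refine this.congr_deriv ?_
    have h1 : (γ t - z) * (γ t - z)⁻¹ = 1 := mul_inv_cancel₀ hne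
    set e := Complex.exp (-∫ t in x..t, (γ t - z)⁻¹ * deriv γ t)
    linear_combination (-(e * deriv γ t)) * h1
  have hconst := constant_of_has_deriv_right_zero
    (fun t ht => (hF t ht).continuousWithinAt)
    (fun t ht => ((hF t ⟨ht.1, ht.2.le⟩).mono_of_mem_nhdsWithin
      (Icc_mem_nhdsGE_of_mem ht))) y (right_mem_Icc.2 hxy)
  simp only [intervalIntegral.integral_same, neg_zero, Complex.exp_zero, mul_one] at hconst
  have hx : γ x - z ≠ 0 := fun h => hz ⟨x, left_mem_Icc.2 hxy, sub_eq_zero.mp h⟩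
  rw [eq_div_iff hx, ← hconst, mul_left_comm, cauchyTransform, ← Complex.exp_add]
  simp

theorem cauchyTransform_deriv_eq_log (hγ : ContDiff ℝ 1 γ) (hxy : x ≤ y) {c : ℂ} (hc : c ≠ 0)
    (h : ∀ t ∈ Icc x y, (γ t - z) / c ∈ Complex.slitPlane) :
    cauchyTransform γ (deriv γ) x y z =
      Complex.log ((γ y - z) / c) - Complex.log ((γ x - z) / c) := by
  have hz : z ∉ γ '' Icc x y := by
    rintro ⟨t, ht, rfl⟩
    simpa using h t ht
  unfold cauchyTransform
  rw [intervalIntegral.integral_eq_sub_of_hasDerivAt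
    (f := fun t => Complex.log ((γ t - z) / c))]
  · intro t ht
    rw [uIcc_of_le hxy] at ht
    have hne : γ t - z ≠ 0 := fun h => hz ⟨t, ht, sub_eq_zero.mp h⟩
    have hd := (((hasDerivAt_of_contDiff hγ t).sub_const z).div_const c).clog_real (h t ht)
    refine hd.congr_deriv ?_
    field_simp
  · apply ContinuousOn.intervalIntegrable
    rw [uIcc_of_le hxy]
    exact continuousOn_inv_sub_mul_deriv hγ hz

/-- Differentiation in z makes the integrand an exact derivative in t, so only the endpoints
survive. -/
theorem hasDerivAt_cauchyTransform_deriv (hγ : ContDiff ℝ 1 γ) (hxy : x ≤ y)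
    (hz : z ∉ γ '' Icc x y) :
    HasDerivAt (cauchyTransform γ (deriv γ) x y) ((γ x - z)⁻¹ - (γ y - z)⁻¹) z := by
  refine (hasDerivAt_cauchyTransform hγ.continuous hxy (intervalIntegrable_deriv hγ)
    hz).congr_deriv ?_
  rw [intervalIntegral.integral_eq_sub_of_hasDerivAt (f := fun t => -(γ t - z)⁻¹)]
  · ring
  · intro t ht
    rw [uIcc_of_le hxy] at ht
    have hne : γ t - z ≠ 0 := fun h => hz ⟨t, ht, sub_eq_zero.mp h⟩
    refine (((hasDerivAt_of_contDiff hγ t).sub_const z).fun_inv hne).fun_neg.congr_deriv ?_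
    field_simp
  · exact intervalIntegrable_comp_mul hγ.continuous hxy (intervalIntegrable_deriv hγ)
      (f := fun s => ((s - z)⁻¹) ^ 2) ((continuousOn_inv_sub_const hz).pow 2)

end LogIntegral

/-! ### The two sides of a smooth curve -/

theorem log_I_mul_sub_log_neg_I_mul {ζ : ℂ} (h : 0 < ζ.re) :
    Complex.log (Complex.I * ζ) - Complex.log (-Complex.I * ζ) = Real.pi * Complex.I := by
  have hζ : ζ ≠ 0 := fun h0 => by simp [h0] at h
  have ha := (Complex.abs_arg_lt_pi_div_two_iff.mpr (Or.inl h))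
  rw [abs_lt] at ha
  rw [Complex.log_mul_eq_add_log_iff Complex.I_ne_zero hζ |>.mpr,
    Complex.log_mul_eq_add_log_iff (neg_ne_zero.mpr Complex.I_ne_zero) hζ |>.mpr,
    Complex.log_I, Complex.log_neg_I]
  · ring
  · rw [Complex.arg_neg_I]; constructor <;> linarith [Real.pi_pos]
  · rw [Complex.arg_I]; constructor <;> linarith [Real.pi_pos]

theorem log_I_mul_sub_log_neg_I_mul_of_neg {ζ : ℂ} (h : ζ.re < 0) :
    Complex.log (Complex.I * ζ) - Complex.log (-Complex.I * ζ) = -(Real.pi * Complex.I) := by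
  have := log_I_mul_sub_log_neg_I_mul (ζ := -ζ) (by simpa using h)
  simp only [mul_neg, neg_mul, neg_neg] at this ⊢
  linear_combination -this

/-- Near `γ t₀`, the complement of `S` consists of two connected sets, `P` to the left and `N` to
the right of the curve. -/
structure LocalSides (γ : ℝ → ℂ) (S : Set ℂ) (t₀ : ℝ) (P N : Set ℂ) : Prop where
  preconnected_left : IsPreconnected P
  preconnected_right : IsPreconnected N
  left_subset : P ⊆ Sᶜ
  right_subset : N ⊆ Sᶜ
  cover : ∀ᶠ z in 𝓝 (γ t₀), z ∈ S ∨ z ∈ P ∨ z ∈ N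
  left_mem : ∀ᶠ t in 𝓝 t₀, ∀ᶠ ε : ℝ in 𝓝[>] 0, γ t + ε * (Complex.I * deriv γ t) ∈ P
  right_mem : ∀ᶠ t in 𝓝 t₀, ∀ᶠ ε : ℝ in 𝓝[>] 0, γ t - ε * (Complex.I * deriv γ t) ∈ N

/-- Strict differentiability: in units of the tangent at t₀, chords are nearly horizontal and
tangents nearly 1. The constants 1/2 and 1/4 are small enough for the comparison of signs in
`exists_localSides`. -/
theorem exists_cone {γ : ℝ → ℂ} (hγ : ContDiff ℝ 1 γ) {t₀ : ℝ} (hd : deriv γ t₀ ≠ 0) :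
    ∃ δ > 0, (∀ t u, |t - t₀| ≤ δ → |u - t₀| ≤ δ →
      |((γ t - γ u) / deriv γ t₀).re - (t - u)| ≤ |t - u| / 2 ∧
      |((γ t - γ u) / deriv γ t₀).im| ≤ |t - u| / 2) ∧
      ∀ t, |t - t₀| ≤ δ → ‖deriv γ t / deriv γ t₀ - 1‖ ≤ 1 / 4 := by
  set d := deriv γ t₀ with hdd
  have hs : HasStrictDerivAt γ d t₀ := hγ.contDiffAt.hasStrictDerivAt one_ne_zero
  have h1 := (hasStrictFDerivAt_iff_isLittleO.mp hs.hasStrictFDerivAt).def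
    (show 0 < ‖d‖ / 2 by positivity)
  obtain ⟨δ₁, hδ₁, h1⟩ := Metric.eventually_nhds_iff.mp h1
  have h2 : ∀ᶠ t in 𝓝 t₀, ‖deriv γ t / d - 1‖ < 1 / 4 := by
    have hc : ContinuousAt (fun t => ‖deriv γ t / d - 1‖) t₀ :=
      (((hγ.continuous_deriv le_rfl).div_const d).sub continuous_const).norm.continuousAt
    refine hc.eventually (gt_mem_nhds ?_)
    simp [← hdd, div_self hd]
  obtain ⟨δ₂, hδ₂, h2⟩ := Metric.eventually_nhds_iff.mp h2
  refine ⟨min δ₁ δ₂ / 2, by positivity, fun t u ht hu => ?_, fun t ht => (h2 ?_).le⟩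
  · have hlt : min δ₁ δ₂ / 2 < δ₁ := by
      have := min_le_left δ₁ δ₂
      linarith [lt_min hδ₁ hδ₂]
    have h := @h1 (t, u) (by
      rw [Prod.dist_eq]
      exact max_lt (by simpa [Real.dist_eq] using ht.trans_lt hlt)
        (by simpa [Real.dist_eq] using hu.trans_lt hlt))
    simp only [ContinuousLinearMap.toSpanSingleton_apply,
      Real.norm_eq_abs, Complex.real_smul] at h
    have hb : ‖(γ t - γ u) / d - ((t - u : ℝ) : ℂ)‖ ≤ |t - u| / 2 := by
      have e : (γ t - γ u) / d - ((t - u : ℝ) : ℂ) = (γ t - γ u - ((t - u : ℝ) : ℂ) * d) / d := by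
        field_simp
      rw [e, norm_div, div_le_iff₀ (norm_pos_iff.mpr hd)]
      calc _ ≤ _ := h
        _ = _ := by ring
    have hre := (Complex.abs_re_le_norm _).trans hb
    have him := (Complex.abs_im_le_norm _).trans hb
    rw [Complex.sub_re, Complex.ofReal_re] at hre
    rw [Complex.sub_im, Complex.ofReal_im, sub_zero] at him
    exact ⟨hre, him⟩
  · rw [Real.dist_eq]
    have := min_le_right δ₁ δ₂
    linarith [lt_min hδ₁ hδ₂]

/-- The map (s, τ) ↦ γ s + τ i γ'(t₀) sends upper and lower half discs to the two sides. Shifting in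
the fixed direction i γ'(t₀), not along the moving normal, keeps the map strictly differentiable
although γ is only C¹. On each side the integral over the middle piece of the curve is a difference
of logarithms with the cut turned away from that piece. The two choices of cut differ by 2πi, which
is the jump. -/
theorem exists_localSides {γ : ℝ → ℂ} (hγ : ContDiff ℝ 1 γ) {x y t₀ : ℝ} (ht₀ : t₀ ∈ Ioo x y)
    (hd : deriv γ t₀ ≠ 0) (hinj : ∀ t ∈ Icc x y, γ t = γ t₀ → t = t₀) {Ω : Set ℂ}
    (hΩ : Ω ∈ 𝓝 (γ t₀)) :
    ∃ (P N : Set ℂ) (lam : ℂ → ℂ), LocalSides γ (γ '' Icc x y) t₀ P N ∧ P ⊆ Ω ∧ N ⊆ Ω ∧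
      (∀ᶠ z in 𝓝 (γ t₀), DifferentiableAt ℂ lam z) ∧
      (∀ z ∈ P, cauchyTransform γ (deriv γ) x y z = lam z) ∧
      ∀ z ∈ N, cauchyTransform γ (deriv γ) x y z = lam z - 2 * Real.pi * Complex.I := by
  obtain ⟨δ₀, hδ₀, hcone, hder⟩ := exists_cone hγ hd
  set d := deriv γ t₀ with hdd
  obtain ⟨δ, hδ, hδδ, hδx, hδy⟩ : ∃ δ > 0, δ ≤ δ₀ ∧ x ≤ t₀ - δ ∧ t₀ + δ ≤ y :=
    ⟨min δ₀ (min (t₀ - x) (y - t₀)), lt_min hδ₀ (lt_min (sub_pos.2 ht₀.1) (sub_pos.2 ht₀.2)),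
      min_le_left _ _, by linarith [(min_le_right δ₀ _).trans (min_le_left (t₀ - x) (y - t₀))],
      by linarith [(min_le_right δ₀ _).trans (min_le_right (t₀ - x) (y - t₀))]⟩
  have hId : Complex.I * d ≠ 0 := mul_ne_zero Complex.I_ne_zero hd
  -- the neighbourhood on which everything happens
  have e1 : ∀ᶠ z in 𝓝 (γ t₀), z ∉ γ '' Icc x (t₀ - δ) := by
    refine (isClosed_image_Icc hγ.continuous).isOpen_compl.mem_nhds ?_
    rintro ⟨t, ht, h⟩
    have := hinj t ⟨ht.1, by linarith [ht.2, ht₀.2]⟩ h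
    linarith [ht.2]
  have e2 : ∀ᶠ z in 𝓝 (γ t₀), z ∉ γ '' Icc (t₀ + δ) y := by
    refine (isClosed_image_Icc hγ.continuous).isOpen_compl.mem_nhds ?_
    rintro ⟨t, ht, h⟩
    have := hinj t ⟨by linarith [ht.1, ht₀.1], ht.2⟩ h
    linarith [ht.1]
  have hcont : ∀ c : ℂ, Continuous fun z : ℂ => ((c - z) / d).re := fun c =>
    Complex.continuous_re.comp ((continuous_const.sub continuous_id).div_const d)
  have e3 : ∀ᶠ z in 𝓝 (γ t₀), 0 < ((γ (t₀ + δ) - z) / d).re := by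
    refine (hcont _).continuousAt.eventually (lt_mem_nhds ?_)
    have h := (hcone (t₀ + δ) t₀ (by simpa [abs_of_pos hδ] using hδδ) (by simpa using hδ₀.le)).1
    simp only [add_sub_cancel_left, abs_of_pos hδ] at h
    linarith [(abs_le.mp h).1]
  have e4 : ∀ᶠ z in 𝓝 (γ t₀), ((γ (t₀ - δ) - z) / d).re < 0 := by
    refine (hcont _).continuousAt.eventually (gt_mem_nhds ?_)
    have h := (hcone (t₀ - δ) t₀ (by simpa [abs_of_pos hδ] using hδδ) (by simpa using hδ₀.le)).1
    simp only [sub_sub_cancel_left, abs_neg, abs_of_pos hδ] at h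
    linarith [(abs_le.mp h).2]
  have eall := (e1.and e2).and ((e3.and e4).and hΩ)
  set Φ : ℝ × ℝ → ℂ := fun p => γ p.1 + p.2 * (Complex.I * d) with hΦ
  have hΦ0 : Φ (t₀, 0) = γ t₀ := by simp [hΦ]
  have hΦc : Continuous Φ := by
    have := hγ.continuous
    fun_prop
  have eΦ : ∀ᶠ p in 𝓝 (t₀, (0 : ℝ)), _ := hΦc.continuousAt.eventually (hΦ0.symm ▸ eall)
  obtain ⟨η₀, hη₀, hη₀'⟩ := Metric.eventually_nhds_iff_ball.mp eΦ
  set η := min η₀ δ with hη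
  have hηpos : 0 < η := lt_min hη₀ hδ
  have hB : ∀ p ∈ Metric.ball (t₀, (0 : ℝ)) η, |p.1 - t₀| ≤ δ ∧ _ := fun p hp =>
    ⟨by
      have h1 : dist p.1 t₀ ≤ dist p (t₀, (0 : ℝ)) := by
        rw [Prod.dist_eq]; exact le_max_left _ _
      rw [Metric.mem_ball] at hp
      rw [← Real.dist_eq]
      exact h1.trans (hp.le.trans (min_le_right _ _)),
    hη₀' p (Metric.ball_subset_ball (min_le_left _ _) hp)⟩
  -- points off the axis are off the curve
  have hoff : ∀ p ∈ Metric.ball (t₀, (0 : ℝ)) η, p.2 ≠ 0 → Φ p ∉ γ '' Icc x y := by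
    rintro p hp hp2 ⟨t, ht, h⟩
    obtain ⟨hp1, ⟨hq1, hq2⟩, -⟩ := hB p hp
    have htδ : |t - t₀| ≤ δ := by
      rw [abs_le]
      constructor
      · by_contra! hlt
        exact hq1 ⟨t, ⟨ht.1, by linarith⟩, h⟩
      · by_contra! hlt
        exact hq2 ⟨t, ⟨by linarith, ht.2⟩, h⟩
    have hc := hcone t p.1 (htδ.trans hδδ) (hp1.trans hδδ)
    have hv : (γ t - γ p.1) / d = p.2 * Complex.I := by
      rw [h, hΦ]; field_simp; ring
    rw [hv] at hc
    simp only [Complex.mul_re, Complex.ofReal_re, Complex.I_re, mul_zero, Complex.ofReal_im,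
      Complex.I_im, mul_one, sub_self, zero_sub, abs_neg, Complex.mul_im, add_zero] at hc
    have h0 : |t - p.1| = 0 := by linarith [hc.1, abs_nonneg (t - p.1)]
    rw [h0] at hc
    exact hp2 (abs_eq_zero.mp (le_antisymm (by simpa using hc.2) (abs_nonneg _)))
  -- Injectivity of Φ is not needed. Surjectivity of its derivative makes the image of the ball a
  -- neighbourhood of γ t₀, so the two sides and the curve cover it.
  have hmap : Filter.map Φ (𝓝 (t₀, 0)) = 𝓝 (γ t₀) := by
    rw [← hΦ0]
    have hs : HasStrictDerivAt γ d t₀ := hγ.contDiffAt.hasStrictDerivAt one_ne_zero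
    have h1 : HasStrictFDerivAt (fun p : ℝ × ℝ => γ p.1)
        ((ContinuousLinearMap.toSpanSingleton ℝ d).comp (ContinuousLinearMap.fst ℝ ℝ ℝ))
        (t₀, (0 : ℝ)) :=
      HasStrictFDerivAt.comp (t₀, (0 : ℝ)) (f := Prod.fst) hs.hasStrictFDerivAt
        hasStrictFDerivAt_fst
    have h2 : HasStrictFDerivAt (fun p : ℝ × ℝ => (p.2 : ℂ) * (Complex.I * d))
        ((ContinuousLinearMap.toSpanSingleton ℝ (Complex.I * d)).comp
          (ContinuousLinearMap.snd ℝ ℝ ℝ)) (t₀, (0 : ℝ)) := by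
      refine (ContinuousLinearMap.hasStrictFDerivAt _).congr_of_eventuallyEq
        (Eventually.of_forall fun p => ?_)
      simp
    refine (h1.add h2).map_nhds_eq_of_surj ?_
    rw [LinearMap.range_eq_top]
    intro c
    refine ⟨((c / d).re, (c / d).im), ?_⟩
    have h : ((c / d).re + (c / d).im * Complex.I) * d = c := by
      rw [Complex.re_add_im, div_mul_cancel₀ _ hd]
    conv_rhs => rw [← h]
    simp only [ContinuousLinearMap.coe_coe, _root_.add_apply,
      ContinuousLinearMap.comp_apply, ContinuousLinearMap.coe_fst', ContinuousLinearMap.coe_snd',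
      ContinuousLinearMap.toSpanSingleton_apply, Complex.real_smul]
    ring
  set B := Metric.ball (t₀, (0 : ℝ)) η
  set P : Set ℂ := Φ '' (B ∩ {p | 0 < p.2})
  set N : Set ℂ := Φ '' (B ∩ {p | p.2 < 0})
  have hball : Φ '' B ∈ 𝓝 (γ t₀) := by
    rw [← hmap]
    exact image_mem_map (Metric.ball_mem_nhds _ hηpos)
  -- the side on which the points of the normals lie
  have hside : ∀ t, |t - t₀| ≤ δ → ∀ p ∈ B, ∀ ε : ℝ,
      γ t + ε * (Complex.I * deriv γ t) = Φ p → 0 ≤ ε * p.2 ∧ (ε ≠ 0 → p.2 ≠ 0) := by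
    intro t ht p hp ε h
    have hc := hcone t p.1 (ht.trans hδδ) ((hB p hp).1.trans hδδ)
    have hdt := hder t (ht.trans hδδ)
    set ξ := (γ t - γ p.1) / d
    set θ := deriv γ t / d - 1 with hθ
    have hv : ξ + ε * (Complex.I * (1 + θ)) = p.2 * Complex.I := by
      have : γ t - γ p.1 + ε * (Complex.I * deriv γ t) = p.2 * (Complex.I * d) := by
        simp only [hΦ] at h
        linear_combination h
      simp only [ξ, hθ]
      field_simp
      linear_combination this
    have hre := congrArg Complex.re hv
    have him := congrArg Complex.im hv
    simp only [Complex.add_re, Complex.mul_re, Complex.ofReal_re, Complex.I_re, Complex.one_re,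
      zero_mul, Complex.I_im, Complex.add_im, Complex.one_im, zero_add, one_mul, zero_sub,
      Complex.ofReal_im, Complex.mul_im, add_zero, sub_zero, mul_zero, mul_one] at hre him
    have hθ1 := (Complex.abs_re_le_norm θ).trans hdt
    have hθ2 := (Complex.abs_im_le_norm θ).trans hdt
    have hξre : |ξ.re| ≤ |ε| / 4 := by
      have : ξ.re = ε * θ.im := by linarith
      rw [this, abs_mul]
      nlinarith [abs_nonneg ε]
    have htp : |t - p.1| ≤ |ε| / 2 := by
      have h1 := abs_sub_abs_le_abs_sub (t - p.1) ξ.re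
      rw [abs_sub_comm (t - p.1) ξ.re] at h1
      linarith [hc.1]
    have hp2 : |p.2 - ε| ≤ |ε| / 2 := by
      have h1 : p.2 - ε = ξ.im + ε * θ.re := by linarith
      rw [h1]
      refine (abs_add_le _ _).trans ?_
      rw [abs_mul]
      nlinarith [abs_nonneg ε, hc.2]
    rw [abs_le] at hp2
    rcases lt_trichotomy ε 0 with h0 | h0 | h0
    · rw [abs_of_neg h0] at hp2
      exact ⟨mul_nonneg_of_nonpos_of_nonpos h0.le (by linarith), fun _ => by linarith⟩
    · exact ⟨by simp [h0], fun h => absurd h0 h⟩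
    · rw [abs_of_pos h0] at hp2
      exact ⟨mul_nonneg h0.le (by linarith), fun _ => by linarith⟩
  have hnormal : ∀ᶠ t in 𝓝 t₀, ∀ᶠ ε : ℝ in 𝓝 0,
      |t - t₀| ≤ δ ∧ γ t + ε * (Complex.I * deriv γ t) ∈ Φ '' B := by
    have h1 : ∀ᶠ t in 𝓝 t₀, |t - t₀| < δ :=
      Metric.eventually_nhds_iff.mpr ⟨δ, hδ, fun t ht => by rwa [Real.dist_eq] at ht⟩
    have h2 : ∀ᶠ t in 𝓝 t₀, Φ '' B ∈ 𝓝 (γ t) :=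
      hγ.continuous.continuousAt.eventually (eventually_mem_nhds_iff.mpr hball)
    filter_upwards [h1, h2] with t ht1 ht2
    have hc : ContinuousAt (fun ε : ℝ => γ t + ε * (Complex.I * deriv γ t)) 0 := by fun_prop
    have h3 := hc.eventually (p := fun z => z ∈ Φ '' B) (by
      simp only [Complex.ofReal_zero, zero_mul, add_zero]; exact ht2)
    exact h3.mono fun ε hε => ⟨ht1.le, hε⟩
  -- slit plane conditions
  have hIccδ : ∀ t ∈ Icc (t₀ - δ) (t₀ + δ), |t - t₀| ≤ δ := fun t ht =>
    abs_le.mpr ⟨by linarith [ht.1], by linarith [ht.2]⟩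
  -- The quotient is i ξ + p.2 with ξ = (γ t − γ p.1)/d. It is real only if ξ.re = 0, hence t = p.1,
  -- and then it equals p.2 > 0.
  have hleft : ∀ p ∈ B, 0 < p.2 → ∀ t ∈ Icc (t₀ - δ) (t₀ + δ),
      (γ t - Φ p) / (-(Complex.I * d)) ∈ Complex.slitPlane := by
    intro p hp hp2 t ht
    have hc := hcone t p.1 ((hIccδ t ht).trans hδδ) ((hB p hp).1.trans hδδ)
    have hv : (γ t - Φ p) / (-(Complex.I * d)) = Complex.I * ((γ t - γ p.1) / d) + p.2 := by
      simp only [hΦ]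
      field_simp
      linear_combination (-(γ t - γ p.1)) * Complex.I_sq
    rw [hv, Complex.mem_slitPlane_iff]
    simp only [Complex.add_re, Complex.mul_re, Complex.I_re, zero_mul, Complex.I_im, one_mul,
      zero_sub, Complex.ofReal_re, Complex.add_im, Complex.mul_im, zero_add, Complex.ofReal_im,
      add_zero]
    by_contra! hcon
    rw [hcon.2, zero_sub, abs_neg] at hc
    have h0 : |t - p.1| = 0 := by linarith [hc.1, abs_nonneg (t - p.1)]
    rw [h0] at hc
    linarith [(abs_le.mp hc.2).2]
  have hright : ∀ p ∈ B, p.2 < 0 → ∀ t ∈ Icc (t₀ - δ) (t₀ + δ),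
      (γ t - Φ p) / (Complex.I * d) ∈ Complex.slitPlane := by
    intro p hp hp2 t ht
    have hc := hcone t p.1 ((hIccδ t ht).trans hδδ) ((hB p hp).1.trans hδδ)
    have hv : (γ t - Φ p) / (Complex.I * d) = -(Complex.I * ((γ t - γ p.1) / d) + p.2) := by
      simp only [hΦ]
      field_simp
      linear_combination (γ t - γ p.1) * Complex.I_sq
    rw [hv, Complex.mem_slitPlane_iff]
    simp only [Complex.neg_re, Complex.neg_im, Complex.add_re, Complex.mul_re, Complex.I_re,
      zero_mul, Complex.I_im, one_mul,
      zero_sub, Complex.ofReal_re, Complex.add_im, Complex.mul_im, zero_add, Complex.ofReal_im,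
      add_zero]
    by_contra! hcon
    rw [neg_eq_zero] at hcon
    rw [hcon.2, zero_sub, abs_neg] at hc
    have h0 : |t - p.1| = 0 := by linarith [hc.1, abs_nonneg (t - p.1)]
    rw [h0] at hc
    linarith [(abs_le.mp hc.2).1]
  -- The formula valid on the left. It is analytic in a whole neighbourhood of γ t₀, because only
  -- the far pieces of the curve and the two points γ (t₀ ± δ) enter, and the latter stay off the
  -- cut.
  set lam : ℂ → ℂ := fun z => cauchyTransform γ (deriv γ) x (t₀ - δ) z +
    cauchyTransform γ (deriv γ) (t₀ + δ) y z +
    (Complex.log ((γ (t₀ + δ) - z) / (-(Complex.I * d))) -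
      Complex.log ((γ (t₀ - δ) - z) / (-(Complex.I * d)))) with hlam
  have hrot : ∀ w : ℂ, w / (-(Complex.I * d)) = Complex.I * (w / d) := fun w => by
    field_simp
    linear_combination (-w) * Complex.I_sq
  have hrot' : ∀ w : ℂ, w / (Complex.I * d) = -Complex.I * (w / d) := fun w => by
    field_simp
    linear_combination w * Complex.I_sq
  have hsplit : ∀ z ∉ γ '' Icc x y, cauchyTransform γ (deriv γ) x y z =
      cauchyTransform γ (deriv γ) x (t₀ - δ) z +
      cauchyTransform γ (deriv γ) (t₀ + δ) y z +
      cauchyTransform γ (deriv γ) (t₀ - δ) (t₀ + δ) z := by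
    intro z hz
    have hi : IntervalIntegrable (deriv γ) MeasureTheory.volume x y := intervalIntegrable_deriv hγ
    rw [← cauchyTransform_add_adjacent hγ.continuous hδx (by linarith) hi hz,
      ← cauchyTransform_add_adjacent (x := t₀ - δ) hγ.continuous (by linarith) hδy
        (intervalIntegrable_deriv hγ) fun h => hz (image_mono (Icc_subset_Icc_left hδx) h)]
    ring
  refine ⟨P, N, lam, ⟨?_, ?_, ?_, ?_, ?_, ?_, ?_⟩, ?_, ?_, ?_, ?_, ?_⟩
  · exact ((convex_ball _ _).inter (convex_halfSpace_gt (LinearMap.snd ℝ ℝ ℝ).isLinear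
      0)).isPreconnected.image _ hΦc.continuousOn
  · exact ((convex_ball _ _).inter (convex_halfSpace_lt (LinearMap.snd ℝ ℝ ℝ).isLinear
      0)).isPreconnected.image _ hΦc.continuousOn
  · rintro _ ⟨p, ⟨hp, hp2⟩, rfl⟩
    exact hoff p hp (ne_of_gt hp2)
  · rintro _ ⟨p, ⟨hp, hp2⟩, rfl⟩
    exact hoff p hp (ne_of_lt hp2)
  · filter_upwards [hball]
    rintro _ ⟨p, hp, rfl⟩
    rcases lt_trichotomy p.2 0 with h | h | h
    · exact Or.inr (Or.inr ⟨p, ⟨hp, h⟩, rfl⟩)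
    · refine Or.inl ⟨p.1, ?_, by simp [hΦ, h]⟩
      have := abs_le.mp (hB p hp).1
      exact ⟨by linarith [this.1], by linarith [this.2]⟩
    · exact Or.inr (Or.inl ⟨p, ⟨hp, h⟩, rfl⟩)
  · filter_upwards [hnormal] with t ht
    filter_upwards [ht.filter_mono nhdsWithin_le_nhds, self_mem_nhdsWithin] with ε hε hpos
    obtain ⟨h1, p, hp, h2⟩ := hε
    have h3 := hside t h1 p hp ε h2.symm
    have hpos' : 0 < ε := hpos
    exact ⟨p, ⟨hp, lt_of_le_of_ne (nonneg_of_mul_nonneg_right h3.1 hpos')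
      (h3.2 hpos'.ne').symm⟩, h2⟩
  · filter_upwards [hnormal] with t ht
    have hneg : Tendsto (fun ε : ℝ => -ε) (𝓝[>] 0) (𝓝 0) := by
      have : Tendsto (fun ε : ℝ => -ε) (𝓝 0) (𝓝 (-0)) := continuous_neg.tendsto 0
      rw [neg_zero] at this
      exact this.mono_left nhdsWithin_le_nhds
    filter_upwards [hneg.eventually ht, self_mem_nhdsWithin] with ε hε hpos
    obtain ⟨h1, p, hp, h2⟩ := hε
    have h3 := hside t h1 p hp (-ε) h2.symm
    have hpos' : 0 < ε := hpos
    refine ⟨p, ⟨hp, lt_of_le_of_ne ?_ (h3.2 (by linarith))⟩, ?_⟩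
    · nlinarith [h3.1]
    · rw [h2]; push_cast; ring
  · rintro _ ⟨p, ⟨hp, hp2⟩, rfl⟩
    exact (hB p hp).2.2.2
  · rintro _ ⟨p, ⟨hp, hp2⟩, rfl⟩
    exact (hB p hp).2.2.2
  · filter_upwards [e1, e2, e3, e4] with z h1 h2 h3 h4
    have d1 := (hasDerivAt_cauchyTransform hγ.continuous hδx (intervalIntegrable_deriv hγ)
      h1).differentiableAt
    have d2 := (hasDerivAt_cauchyTransform hγ.continuous hδy (intervalIntegrable_deriv hγ)
      h2).differentiableAt
    refine (d1.add d2).add (DifferentiableAt.sub (DifferentiableAt.clog ?_ ?_)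
      (DifferentiableAt.clog ?_ ?_))
    · fun_prop
    · rw [hrot, Complex.mem_slitPlane_iff]
      right
      simpa using h3.ne'
    · fun_prop
    · rw [hrot, Complex.mem_slitPlane_iff]
      right
      simpa using h4.ne
  · rintro _ ⟨p, ⟨hp, hp2⟩, rfl⟩
    rw [hsplit _ (hoff p hp (ne_of_gt hp2)), cauchyTransform_deriv_eq_log hγ
      (x := t₀ - δ) (y := t₀ + δ) (by linarith) (neg_ne_zero.mpr hId) (hleft p hp hp2)]
  · rintro _ ⟨p, ⟨hp, hp2⟩, rfl⟩
    rw [hsplit _ (hoff p hp (ne_of_lt hp2)), cauchyTransform_deriv_eq_log hγ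
      (x := t₀ - δ) (y := t₀ + δ) (by linarith) hId (hright p hp hp2), hlam]
    obtain ⟨-, -, ⟨h3, h4⟩, -⟩ := hB p hp
    -- Turning the cut changes the logarithm by πi at γ (t₀ + δ) and by −πi at γ (t₀ − δ). The
    -- difference of the two is the jump 2πi.
    have l1 := log_I_mul_sub_log_neg_I_mul h3
    have l2 := log_I_mul_sub_log_neg_I_mul_of_neg h4
    simp only [hrot, hrot']
    linear_combination l2 - l1

/-! ### Gluing across sets with dense complement -/

/-- Local continuations agree with g off S, hence with each other on a dense set, hence everywhere
by continuity. Therefore z ↦ G z z is locally one of them. -/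
theorem exists_glue {g : ℂ → ℂ} {S U : Set ℂ} (hS : Dense Sᶜ) (hU : IsOpen U) (G : ℂ → ℂ → ℂ)
    (hc : ∀ z ∈ U, ∀ᶠ y in 𝓝 z, ContinuousAt (G z) y)
    (hG : ∀ z ∈ U, ∀ᶠ y in 𝓝 z, y ∉ S → g y = G z y) :
    ∃ g' : ℂ → ℂ, (∀ z ∈ U, ∀ᶠ y in 𝓝 z, g' y = G z y) ∧ ∀ z ∈ U, z ∉ S → g' z = g z := by
  refine ⟨fun z => G z z, fun z hz => ?_, fun z hz hzS => ((hG z hz).self_of_nhds hzS).symm⟩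
  filter_upwards [hc z hz, (hG z hz).eventually_nhds, hU.mem_nhds hz] with y h1 h2 hy
  have hne : (𝓝[Sᶜ] y).NeBot := mem_closure_iff_nhdsWithin_neBot.mp (hS y)
  have h3 : Tendsto (G y) (𝓝[Sᶜ] y) (𝓝 (G y y)) :=
    (hc y hy).self_of_nhds.tendsto.mono_left nhdsWithin_le_nhds
  have h4 : Tendsto (G z) (𝓝[Sᶜ] y) (𝓝 (G z y)) := h1.tendsto.mono_left nhdsWithin_le_nhds
  refine tendsto_nhds_unique (h3.congr' ?_) h4
  filter_upwards [(hG y hy).filter_mono nhdsWithin_le_nhds, h2.filter_mono nhdsWithin_le_nhds,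
    self_mem_nhdsWithin] with u hu1 hu2 hu
  exact (hu1 hu).symm.trans (hu2 hu)

/-- The values carry no topology, so that propositions and pairs are allowed as well as numbers. -/
theorem eq_of_isPreconnected {X α : Type*} [TopologicalSpace X] {f : X → α} {P : Set X}
    (hP : IsPreconnected P) (hf : ∀ z ∈ P, ∀ᶠ y in 𝓝 z, f y = f z) {x y : X} (hx : x ∈ P)
    (hy : y ∈ P) : f x = f y := by
  by_contra hne
  obtain ⟨z, -, hz1, hz2⟩ := hP {z | ∀ᶠ y in 𝓝 z, f y = f x} {z | ∀ᶠ y in 𝓝 z, f y ≠ f x}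
    isOpen_setOfPred_eventually_nhds isOpen_setOfPred_eventually_nhds
    (fun z hz => by
      by_cases h : f z = f x
      · exact Or.inl ((hf z hz).mono fun u hu => hu.trans h)
      · exact Or.inr ((hf z hz).mono fun u hu => hu.symm ▸ h))
    ⟨x, hx, hf x hx⟩ ⟨y, hy, (hf y hy).mono fun u hu => hu.symm ▸ Ne.symm hne⟩
  exact hz2.self_of_nhds hz1.self_of_nhds

theorem continuousOn_inv_const_sub {c : ℂ} {S : Set ℂ} (hc : c ∉ S) :
    ContinuousOn (fun z : ℂ => (c - z)⁻¹) S :=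
  (continuousOn_const.sub continuousOn_id).inv₀ fun z hz h =>
    hc ((show c = z from sub_eq_zero.mp h) ▸ hz)

/-! ### Arcs -/

/-- A Jordan arc from `-1` to `1` with a continuously differentiable parametrization that is
regular in the interior of the parameter interval. -/
structure IsRegularArc (γ : ℝ → ℂ) : Prop where
  contDiff : ContDiff ℝ 1 γ
  injOn : InjOn γ (Icc 0 1)
  deriv_ne : ∀ t ∈ Ioo (0 : ℝ) 1, deriv γ t ≠ 0
  start : γ 0 = -1
  finish : γ 1 = 1

theorem IsSmoothArc.isRegularArc {γ : ℝ → ℂ} (h : IsSmoothArc γ) : IsRegularArc γ :=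
  ⟨h.contDiff, h.injOn, fun t ht => h.deriv_ne t (Ioo_subset_Icc_self ht), h.start, h.finish⟩

theorem dense_compl_range {γ : ℝ → ℂ} (hγ : ContDiff ℝ 1 γ) : Dense (range γ)ᶜ :=
  hγ.dense_compl_range_of_finrank_lt_finrank (by simp)

theorem dense_compl_arcSet {γ : ℝ → ℂ} (hγ : ContDiff ℝ 1 γ) : Dense (arcSet γ)ᶜ :=
  (dense_compl_range hγ).mono (compl_subset_compl.mpr (image_subset_range _ _))

theorem tendsto_left_normal (γ : ℝ → ℂ) (t : ℝ) :
    Tendsto (fun ε : ℝ => γ t + ε * (Complex.I * deriv γ t)) (𝓝[>] 0) (𝓝 (γ t)) := by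
  have hc : Continuous fun ε : ℝ => γ t + ε * (Complex.I * deriv γ t) := by fun_prop
  have h := hc.tendsto 0
  rw [Complex.ofReal_zero, zero_mul, add_zero] at h
  exact h.mono_left nhdsWithin_le_nhds

theorem tendsto_right_normal (γ : ℝ → ℂ) (t : ℝ) :
    Tendsto (fun ε : ℝ => γ t - ε * (Complex.I * deriv γ t)) (𝓝[>] 0) (𝓝 (γ t)) := by
  have hc : Continuous fun ε : ℝ => γ t - ε * (Complex.I * deriv γ t) := by fun_prop
  have h := hc.tendsto 0
  rw [Complex.ofReal_zero, zero_mul, sub_zero] at h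
  exact h.mono_left nhdsWithin_le_nhds

namespace IsRegularArc

variable {γ : ℝ → ℂ}

theorem ne_one (h : IsRegularArc γ) {t : ℝ} (ht : t ∈ Ioo (0 : ℝ) 1) : γ t ≠ 1 := fun h1 =>
  ht.2.ne (h.injOn (Ioo_subset_Icc_self ht) (by simp) (h1.trans h.finish.symm))

theorem ne_neg_one (h : IsRegularArc γ) {t : ℝ} (ht : t ∈ Ioo (0 : ℝ) 1) : γ t ≠ -1 := fun h1 =>
  ht.1.ne' (h.injOn (Ioo_subset_Icc_self ht) (by simp) (h1.trans h.start.symm))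

theorem one_mem (h : IsRegularArc γ) : (1 : ℂ) ∈ arcSet γ := ⟨1, by simp, h.finish⟩

theorem neg_one_mem (h : IsRegularArc γ) : (-1 : ℂ) ∈ arcSet γ := ⟨0, by simp, h.start⟩

theorem exists_sides (h : IsRegularArc γ) {t₀ : ℝ} (ht₀ : t₀ ∈ Ioo (0 : ℝ) 1) {Ω : Set ℂ}
    (hΩ : Ω ∈ 𝓝 (γ t₀)) :
    ∃ (P N : Set ℂ) (lam : ℂ → ℂ), LocalSides γ (arcSet γ) t₀ P N ∧ P ⊆ Ω ∧ N ⊆ Ω ∧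
      (∀ᶠ z in 𝓝 (γ t₀), DifferentiableAt ℂ lam z) ∧
      (∀ z ∈ P, cauchyTransform γ (deriv γ) 0 1 z = lam z) ∧
      ∀ z ∈ N, cauchyTransform γ (deriv γ) 0 1 z = lam z - 2 * Real.pi * Complex.I :=
  exists_localSides h.contDiff ht₀ (h.deriv_ne t₀ ht₀)
    (fun _ ht he => h.injOn ht (Ioo_subset_Icc_self ht₀) he) hΩ

theorem isClosed (h : IsRegularArc γ) : IsClosed (arcSet γ) :=
  (isCompact_arcSet h.contDiff).isClosed

/-- Limits of a locally constant function from the two sides of an arc. -/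
theorem exists_sided_values (h : IsRegularArc γ) {f : ℂ → ℂ}
    (hf : ∀ z ∉ arcSet γ, ∀ᶠ y in 𝓝 z, f y = f z) :
    ∃ cl cr : ℂ, ∀ t ∈ Ioo (0 : ℝ) 1, ∀ P N : Set ℂ, LocalSides γ (arcSet γ) t P N →
      (∀ z ∈ P, f z = cl) ∧ ∀ z ∈ N, f z = cr := by
  have key : ∀ t ∈ Ioo (0 : ℝ) 1, ∃ c : ℂ × ℂ,
      ∀ᶠ u in 𝓝 t, (∀ᶠ ε : ℝ in 𝓝[>] 0, f (γ u + ε * (Complex.I * deriv γ u)) = c.1) ∧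
        ∀ᶠ ε : ℝ in 𝓝[>] 0, f (γ u - ε * (Complex.I * deriv γ u)) = c.2 := by
    intro t ht
    obtain ⟨P, N, -, hPN, -⟩ := h.exists_sides ht univ_mem
    have hcP : ∀ z ∈ P, ∀ᶠ y in 𝓝 z, f y = f z := fun z hz => hf z (hPN.left_subset hz)
    have hcN : ∀ z ∈ N, ∀ᶠ y in 𝓝 z, f y = f z := fun z hz => hf z (hPN.right_subset hz)
    obtain ⟨ε₁, h1⟩ := hPN.left_mem.self_of_nhds.exists
    obtain ⟨ε₂, h2⟩ := hPN.right_mem.self_of_nhds.exists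
    refine ⟨(f (γ t + ε₁ * (Complex.I * deriv γ t)), f (γ t - ε₂ * (Complex.I * deriv γ t))), ?_⟩
    filter_upwards [hPN.left_mem, hPN.right_mem] with u hu1 hu2
    exact ⟨hu1.mono fun ε hε => eq_of_isPreconnected hPN.preconnected_left hcP hε h1,
      hu2.mono fun ε hε => eq_of_isPreconnected hPN.preconnected_right hcN hε h2⟩
  choose! c hc using key
  -- The side values found at t also hold on the normals at nearby parameters, so they are locally
  -- constant along the open arc.
  have hconst : ∀ t ∈ Ioo (0 : ℝ) 1, c t = c (1 / 2) := by
    intro t ht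
    refine eq_of_isPreconnected isPreconnected_Ioo (fun u hu => ?_) ht
      (show (1 / 2 : ℝ) ∈ Ioo (0 : ℝ) 1 by norm_num)
    filter_upwards [hc u hu, isOpen_Ioo.mem_nhds hu] with v hv hv'
    have h1 := (hc v hv').self_of_nhds
    obtain ⟨ε, he1, he2⟩ := (h1.1.and hv.1).exists
    obtain ⟨ε', he1', he2'⟩ := (h1.2.and hv.2).exists
    exact Prod.ext (he1.symm.trans he2) (he1'.symm.trans he2')
  refine ⟨(c (1 / 2)).1, (c (1 / 2)).2, fun t ht P N hPN => ?_⟩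
  rw [← hconst t ht]
  have h1 := (hc t ht).self_of_nhds
  obtain ⟨ε, he1, he2⟩ := (h1.1.and hPN.left_mem.self_of_nhds).exists
  obtain ⟨ε', he1', he2'⟩ := (h1.2.and hPN.right_mem.self_of_nhds).exists
  refine ⟨fun z hz => ?_, fun z hz => ?_⟩
  · rw [← he1]
    exact eq_of_isPreconnected hPN.preconnected_left (fun z hz => hf z (hPN.left_subset hz)) hz he2
  · rw [← he1']
    exact eq_of_isPreconnected hPN.preconnected_right (fun z hz => hf z (hPN.right_subset hz)) hz
      he2'

/-- An arc does not separate the plane. -/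
theorem eq_of_locallyConstant (h : IsRegularArc γ) {f : ℂ → ℂ}
    (hf : ∀ z ∉ arcSet γ, ∀ᶠ y in 𝓝 z, f y = f z) {z z' : ℂ} (hz : z ∉ arcSet γ)
    (hz' : z' ∉ arcSet γ) : f z = f z' := by
  obtain ⟨cl, cr, hval⟩ := h.exists_sided_values hf
  -- The logarithm ℓ jumps by 2πi across the arc and f by cl − cr. With this κ the function κ ℓ − f
  -- does not jump and extends to ℂ ∖ {−1, 1}.
  set κ : ℂ := (cl - cr) / (2 * Real.pi * Complex.I) with hκ
  have hpi : (2 * Real.pi * Complex.I : ℂ) ≠ 0 := Complex.two_pi_I_ne_zero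
  have hκ' : κ * (2 * Real.pi * Complex.I) = cl - cr := div_mul_cancel₀ _ hpi
  set ℓ := cauchyTransform γ (deriv γ) 0 1 with hℓ
  set g : ℂ → ℂ := fun z => κ * ℓ z - f z with hg
  have hℓd : ∀ z ∉ arcSet γ, HasDerivAt ℓ ((-1 - z)⁻¹ - (1 - z)⁻¹) z := fun z hz => by
    have := hasDerivAt_cauchyTransform_deriv h.contDiff zero_le_one hz
    rwa [h.start, h.finish] at this
  have hgd : ∀ z ∉ arcSet γ, HasDerivAt g (κ * ((-1 - z)⁻¹ - (1 - z)⁻¹)) z := fun z hz => by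
    have h1 : HasDerivAt f 0 z := (hasDerivAt_const z (f z)).congr_of_eventuallyEq (hf z hz)
    exact (((hℓd z hz).const_mul κ).sub h1).congr_deriv (sub_zero _)
  set U : Set ℂ := {-1, 1}ᶜ with hU
  have hUfin : ({-1, 1} : Set ℂ).Finite := by simp
  have hUo : IsOpen U := hUfin.isClosed.isOpen_compl
  have hUmem : ∀ z, z ∉ arcSet γ → z ∈ U := by
    intro z hz hmem
    rcases hmem with rfl | rfl
    · exact hz h.neg_one_mem
    · exact hz h.one_mem
  have hloc : ∀ z ∈ U, ∃ G : ℂ → ℂ, (∀ᶠ y in 𝓝 z, DifferentiableAt ℂ G y) ∧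
      ∀ᶠ y in 𝓝 z, y ∉ arcSet γ → g y = G y := by
    intro z hzU
    by_cases hzS : z ∈ arcSet γ
    · obtain ⟨t, ht, rfl⟩ := hzS
      have ht' : t ∈ Ioo (0 : ℝ) 1 := by
        refine ⟨lt_of_le_of_ne ht.1 ?_, lt_of_le_of_ne ht.2 ?_⟩
        · rintro rfl; exact hzU (by simp [h.start])
        · rintro rfl; exact hzU (by simp [h.finish])
      obtain ⟨P, N, lam, hPN, -, -, hd, hP, hN⟩ := h.exists_sides ht' univ_mem
      obtain ⟨v1, v2⟩ := hval t ht' P N hPN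
      refine ⟨fun y => κ * lam y - cl, hd.mono fun y hy => (hy.const_mul κ).sub_const cl, ?_⟩
      filter_upwards [hPN.cover] with y hy hyS
      rcases hy with hy | hy | hy
      · exact absurd hy hyS
      · simp only [hg, hℓ, hP y hy, v1 y hy]
      · simp only [hg, hℓ, hN y hy, v2 y hy]
        linear_combination -hκ'
    · refine ⟨g, ?_, Eventually.of_forall fun _ _ => rfl⟩
      filter_upwards [h.isClosed.isOpen_compl.mem_nhds hzS] with y hy
      exact (hgd y hy).differentiableAt
  choose! G hGd hGg using hloc
  have hdense := dense_compl_arcSet h.contDiff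
  obtain ⟨g', hg'1, hg'2⟩ := exists_glue (g := g) hdense hUo G
    (fun z hz => (hGd z hz).mono fun y hy => hy.continuousAt) hGg
  have hg'd : DifferentiableOn ℂ g' U := fun z hz =>
    ((hGd z hz).self_of_nhds.congr_of_eventuallyEq (hg'1 z hz)).differentiableWithinAt
  have hoff : ∀ z ∉ arcSet γ, g' =ᶠ[𝓝 z] g := fun z hz => by
    filter_upwards [h.isClosed.isOpen_compl.mem_nhds hz] with y hy
    exact hg'2 y (hUmem y hy) hy
  have hderiv : EqOn (deriv g') (fun z => κ * ((-1 - z)⁻¹ - (1 - z)⁻¹)) U := by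
    have hsub : U ⊆ closure (U ∩ (arcSet γ)ᶜ) := hdense.open_subset_closure_inter hUo
    refine EqOn.of_subset_closure (s := U ∩ (arcSet γ)ᶜ) (fun z hz => ?_)
      (hg'd.deriv hUo).continuousOn ?_ inter_subset_left hsub
    · exact ((hgd z hz.2).congr_of_eventuallyEq (hoff z hz.2)).deriv
    · exact continuousOn_const.mul ((continuousOn_inv_const_sub (by simp [hU])).sub
        (continuousOn_inv_const_sub (by simp [hU])))
  have hcircle : ∀ z ∈ Metric.sphere (1 : ℂ) 1, z ∈ U := by
    intro z hz hmem
    rw [mem_sphere_iff_norm] at hz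
    rcases hmem with rfl | rfl
    · norm_num at hz
    · norm_num at hz
  -- The circle separates 1 from −1. Its integral vanishes because the extension g' is a primitive
  -- on it, while the pole at 1 contributes 2πi κ. So κ = 0, and g' has zero derivative on a
  -- connected set.
  have hI : (∮ z in C(1, 1), κ * ((-1 - z)⁻¹ - (1 - z)⁻¹)) = 0 := by
    refine circleIntegral.integral_eq_zero_of_hasDerivWithinAt (f := g') zero_le_one fun z hz => ?_
    have h1 := (hg'd.differentiableAt (hUo.mem_nhds (hcircle z hz))).hasDerivAt
    rw [hderiv (hcircle z hz)] at h1
    exact h1.hasDerivWithinAt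
  have hI1 : (∮ z in C(1, 1), (-1 - z : ℂ)⁻¹) = 0 := by
    refine DiffContOnCl.circleIntegral_eq_zero zero_le_one (DifferentiableOn.diffContOnCl ?_)
    rw [closure_ball _ one_ne_zero]
    refine ((differentiableOn_const _).sub differentiableOn_id).inv fun z hz h0 => ?_
    have : z = -1 := (sub_eq_zero.mp h0).symm
    rw [this, mem_closedBall_iff_norm] at hz
    norm_num at hz
  have hI2 : (∮ z in C(1, 1), (1 - z : ℂ)⁻¹) = -(2 * Real.pi * Complex.I) := by
    rw [← circleIntegral.integral_sub_center_inv (1 : ℂ) one_ne_zero, ← neg_one_mul,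
      ← circleIntegral.integral_const_mul]
    congr 1
    ext z
    rw [neg_one_mul, ← inv_neg, neg_sub]
  have hκ0 : κ = 0 := by
    have hci : ∀ c : ℂ, c ∉ Metric.sphere (1 : ℂ) 1 →
        CircleIntegrable (fun z : ℂ => (c - z)⁻¹) 1 1 := fun c hc =>
      ContinuousOn.circleIntegrable zero_le_one (continuousOn_inv_const_sub hc)
    rw [circleIntegral.integral_const_mul, circleIntegral.integral_sub (hci _ ?_) (hci _ ?_), hI1,
      hI2] at hI
    · simpa using hI
    · rw [mem_sphere_iff_norm, show (-1 - 1 : ℂ) = -2 by norm_num]; simp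
    · simp
  have hconst := hUo.is_const_of_deriv_eq_zero (𝕜 := ℂ)
    (hUfin.countable.isConnected_compl_of_one_lt_rank (by simp)).isPreconnected hg'd
    (fun z hz => by rw [hderiv hz, hκ0]; simp) (hUmem z hz) (hUmem z' hz')
  rw [hg'2 z (hUmem z hz) hz, hg'2 z' (hUmem z' hz') hz'] at hconst
  simpa [hg, hκ0] using hconst

end IsRegularArc

/-! ### One-sided traces of the square root -/

theorem wBranch_eq (γ : ℝ → ℂ) (z : ℂ) :
    wBranch γ z = (z + 1) * Complex.exp (cauchyTransform γ (deriv γ) 0 1 z / 2) := rfl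

namespace IsRegularArc

variable {γ : ℝ → ℂ}

theorem wBranch_sq (h : IsRegularArc γ) {z : ℂ} (hz : z ∉ arcSet γ) :
    wBranch γ z ^ 2 = z ^ 2 - 1 :=
  MultipointPade.wBranch_sq h.contDiff h.start h.finish hz

theorem wBranch_ne_zero (h : IsRegularArc γ) {z : ℂ} (hz : z ∉ arcSet γ) : wBranch γ z ≠ 0 := by
  intro h0
  have := h.wBranch_sq hz
  rw [h0, zero_pow two_ne_zero] at this
  have h2 : (z - 1) * (z + 1) = 0 := by linear_combination -this
  rcases mul_eq_zero.mp h2 with h2 | h2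
  · exact hz (sub_eq_zero.mp h2 ▸ h.one_mem)
  · exact hz (eq_neg_of_add_eq_zero_left h2 ▸ h.neg_one_mem)

theorem wBranch_differentiableAt (h : IsRegularArc γ) {z : ℂ} (hz : z ∉ arcSet γ) :
    DifferentiableAt ℂ (wBranch γ) z :=
  (wBranch_differentiableOn h.contDiff).differentiableAt (h.isClosed.isOpen_compl.mem_nhds hz)

/-- Near an interior point of the arc, the branch of the square root has an analytic continuation
from the left, which is its negative on the right. -/
theorem exists_branch (h : IsRegularArc γ) {t₀ : ℝ} (ht₀ : t₀ ∈ Ioo (0 : ℝ) 1) :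
    ∃ (P N : Set ℂ) (lam ω : ℂ → ℂ), LocalSides γ (arcSet γ) t₀ P N ∧
      (∀ᶠ z in 𝓝 (γ t₀), DifferentiableAt ℂ lam z) ∧
      (∀ z ∈ P, cauchyTransform γ (deriv γ) 0 1 z = lam z) ∧
      (∀ z ∈ N, cauchyTransform γ (deriv γ) 0 1 z = lam z - 2 * Real.pi * Complex.I) ∧
      (∀ᶠ z in 𝓝 (γ t₀), DifferentiableAt ℂ ω z) ∧
      (∀ z ∈ P, wBranch γ z = ω z) ∧ (∀ z ∈ N, wBranch γ z = -ω z) ∧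
      (∀ᶠ z in 𝓝 (γ t₀), ω z ^ 2 = z ^ 2 - 1) ∧
      ∀ᶠ t in 𝓝 t₀, leftTrace (wBranch γ) γ t = ω (γ t) := by
  obtain ⟨P, N, lam, hPN, -, -, hd, hP, hN⟩ := h.exists_sides ht₀ univ_mem
  set ω : ℂ → ℂ := fun z => (z + 1) * Complex.exp (lam z / 2) with hω
  have hωd : ∀ᶠ z in 𝓝 (γ t₀), DifferentiableAt ℂ ω z := hd.mono fun z hz => by
    have := (hz.div_const 2).cexp
    fun_prop
  have hωP : ∀ z ∈ P, wBranch γ z = ω z := fun z hz => by rw [wBranch_eq, hP z hz]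
  -- The jump 2πi of the logarithm is halved in the exponent and becomes the factor exp(−πi) = −1.
  have hωN : ∀ z ∈ N, wBranch γ z = -ω z := fun z hz => by
    rw [wBranch_eq, hN z hz, sub_div, Complex.exp_sub,
      show 2 * (Real.pi : ℂ) * Complex.I / 2 = Real.pi * Complex.I by ring, Complex.exp_pi_mul_I]
    simp [hω, div_neg]
  refine ⟨P, N, lam, ω, hPN, hd, hP, hN, hωd, hωP, hωN, ?_, ?_⟩
  · filter_upwards [hωd, hPN.cover.eventually_nhds] with z hz hcov
    have hne : (𝓝[(arcSet γ)ᶜ] z).NeBot :=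
      mem_closure_iff_nhdsWithin_neBot.mp (dense_compl_arcSet h.contDiff z)
    have h1 : Tendsto (fun y => ω y ^ 2) (𝓝[(arcSet γ)ᶜ] z) (𝓝 (ω z ^ 2)) :=
      (hz.continuousAt.pow 2).tendsto.mono_left nhdsWithin_le_nhds
    have h2 : Tendsto (fun y : ℂ => y ^ 2 - 1) (𝓝[(arcSet γ)ᶜ] z) (𝓝 (z ^ 2 - 1)) :=
      (((continuous_pow 2).sub continuous_const).tendsto z).mono_left nhdsWithin_le_nhds
    refine tendsto_nhds_unique (h1.congr' ?_) h2
    filter_upwards [hcov.filter_mono nhdsWithin_le_nhds, self_mem_nhdsWithin] with y hy hyS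
    rw [← h.wBranch_sq hyS]
    rcases hy with hy | hy | hy
    · exact absurd hy hyS
    · rw [hωP y hy]
    · rw [hωN y hy, neg_sq]
  · filter_upwards [h.contDiff.continuous.continuousAt.eventually hωd, hPN.left_mem] with t ht1 ht2
    refine Tendsto.limUnder_eq ?_
    have h1 := ht1.continuousAt.tendsto.comp (tendsto_left_normal γ t)
    refine h1.congr' ?_
    filter_upwards [ht2] with ε hε
    exact (hωP _ hε).symm

theorem leftTrace_sq (h : IsRegularArc γ) {t : ℝ} (ht : t ∈ Ioo (0 : ℝ) 1) :
    leftTrace (wBranch γ) γ t ^ 2 = γ t ^ 2 - 1 := by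
  obtain ⟨-, -, -, ω, -, -, -, -, -, -, -, hsq, htr⟩ := h.exists_branch ht
  rw [htr.self_of_nhds, hsq.self_of_nhds]

theorem leftTrace_ne_zero (h : IsRegularArc γ) {t : ℝ} (ht : t ∈ Ioo (0 : ℝ) 1) :
    leftTrace (wBranch γ) γ t ≠ 0 := by
  intro h0
  have := h.leftTrace_sq ht
  rw [h0, zero_pow two_ne_zero] at this
  have h2 : (γ t - 1) * (γ t + 1) = 0 := by linear_combination -this
  rcases mul_eq_zero.mp h2 with h2 | h2
  · exact h.ne_one ht (sub_eq_zero.mp h2)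
  · exact h.ne_neg_one ht (eq_neg_of_add_eq_zero_left h2)

theorem hasDerivAt_leftTrace (h : IsRegularArc γ) {t : ℝ} (ht : t ∈ Ioo (0 : ℝ) 1) :
    HasDerivAt (leftTrace (wBranch γ) γ)
      (γ t * (deriv γ t / leftTrace (wBranch γ) γ t)) t := by
  obtain ⟨-, -, -, ω, -, -, -, -, hωd, -, -, -, htr⟩ := h.exists_branch ht
  have hd := ((hωd.self_of_nhds.hasDerivAt.comp t
    (hasDerivAt_of_contDiff h.contDiff t)).congr_of_eventuallyEq htr)
  have h1 := hd.pow 2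
  have h2 := ((hasDerivAt_of_contDiff h.contDiff t).pow 2).sub_const 1
  have h3 : (fun u => leftTrace (wBranch γ) γ u ^ 2) =ᶠ[𝓝 t] fun u => γ u ^ 2 - 1 := by
    filter_upwards [isOpen_Ioo.mem_nhds ht] with u hu using h.leftTrace_sq hu
  have h4 := h1.unique (h2.congr_of_eventuallyEq h3)
  refine hd.congr_deriv ?_
  have hne := h.leftTrace_ne_zero ht
  field_simp
  simp only [Nat.cast_ofNat, Nat.add_one_sub_one, pow_one] at h4
  linear_combination h4 / 2

theorem continuousOn_leftTrace (h : IsRegularArc γ) :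
    ContinuousOn (leftTrace (wBranch γ) γ) (Ioo 0 1) := fun _ ht =>
  (h.hasDerivAt_leftTrace ht).continuousAt.continuousWithinAt

/-- The density `γ' / w_{γ+}` with respect to the parameter of the arc. -/
def _root_.MultipointPade.traceDensity (γ : ℝ → ℂ) (t : ℝ) : ℂ :=
  deriv γ t / leftTrace (wBranch γ) γ t

theorem continuousOn_traceDensity (h : IsRegularArc γ) :
    ContinuousOn (traceDensity γ) (Ioo 0 1) :=
  (h.contDiff.continuous_deriv le_rfl).continuousOn.div h.continuousOn_leftTrace
    fun _ ht => h.leftTrace_ne_zero ht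

/-- The function γ − w_+ lifts the arc through the Joukovski map. With φ = z − w, the logarithmic
derivative of (γ − w_+ − φ)/(γ − w_+ − 1/φ) along the arc is w γ'/(w_+ (γ − z)). The quotient equals
φ at the endpoint −1 and −φ at the endpoint 1, so the exponential of the integral is −1. -/
theorem exp_wBranch_mul_cauchyTransform (h : IsRegularArc γ)
    (hint : IntervalIntegrable (traceDensity γ) MeasureTheory.volume 0 1) {z : ℂ}
    (hz : z ∉ arcSet γ) :
    Complex.exp (wBranch γ z * cauchyTransform γ (traceDensity γ) 0 1 z) = -1 := by
  set w := wBranch γ z with hw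
  have hwsq : w ^ 2 = z ^ 2 - 1 := h.wBranch_sq hz
  set wp := leftTrace (wBranch γ) γ with hwp
  set b : ℝ → ℂ := fun t => (γ t - z)⁻¹ * traceDensity γ t with hb
  have hbint : IntervalIntegrable b MeasureTheory.volume 0 1 :=
    intervalIntegrable_cauchy h.contDiff.continuous zero_le_one hint hz
  have hbc : ContinuousOn b (Ioo 0 1) := by
    refine ContinuousOn.mul ?_ h.continuousOn_traceDensity
    exact ((continuousOn_inv_sub_const hz).comp h.contDiff.continuous.continuousOn
      (mapsTo_image _ _)).mono Ioo_subset_Icc_self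
  have hI : ∀ t ∈ Ioo (0 : ℝ) 1, HasDerivAt (fun u => ∫ s in (0 : ℝ)..u, b s) (b t) t := by
    intro t ht
    refine intervalIntegral.integral_hasDerivAt_right (hbint.mono_set ?_)
      (hbc.stronglyMeasurableAtFilter isOpen_Ioo t ht) (hbc.continuousAt (isOpen_Ioo.mem_nhds ht))
    rw [uIcc_of_le ht.1.le, uIcc_of_le zero_le_one]
    exact Icc_subset_Icc_right ht.2.le
  have hIc : ContinuousOn (fun u => ∫ s in (0 : ℝ)..u, b s) (Icc 0 1) := by
    have := intervalIntegral.continuousOn_primitive_interval (a := 0) (b := 1) (f := b)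
      (μ := MeasureTheory.volume) ((intervalIntegrable_iff_integrableOn_Icc_of_le
        zero_le_one).mp hbint |>.mono_set (by rw [uIcc_of_le zero_le_one]))
    rwa [uIcc_of_le zero_le_one] at this
  -- the fractional linear image of the lift of the arc under the Joukovski map
  set num : ℝ → ℂ := fun t => γ t - wp t - (z - w) with hnum
  set den : ℝ → ℂ := fun t => γ t - wp t - (z + w) with hden
  have hprod : ∀ t ∈ Ioo (0 : ℝ) 1, num t * den t = 2 * (γ t - wp t) * (γ t - z) := by
    intro t ht
    have h1 := h.leftTrace_sq ht
    rw [← hwp] at h1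
    simp only [hnum, hden]
    linear_combination h1 - hwsq
  have hlift : ∀ t ∈ Ioo (0 : ℝ) 1, γ t - wp t ≠ 0 := by
    intro t ht h0
    have h1 := h.leftTrace_sq ht
    rw [← hwp, ← sub_eq_zero.mp h0] at h1
    have : (1 : ℂ) = 0 := by linear_combination h1
    exact one_ne_zero this
  have hγz : ∀ t ∈ Ioo (0 : ℝ) 1, γ t - z ≠ 0 := fun t ht h0 =>
    hz ⟨t, Ioo_subset_Icc_self ht, sub_eq_zero.mp h0⟩
  have hnd : ∀ t ∈ Ioo (0 : ℝ) 1, num t * den t ≠ 0 := fun t ht => by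
    rw [hprod t ht]
    exact mul_ne_zero (mul_ne_zero two_ne_zero (hlift t ht)) (hγz t ht)
  set K : ℝ → ℂ := fun t => num t / den t * Complex.exp (-(w * ∫ s in (0 : ℝ)..t, b s)) with hK
  have hKd : ∀ t ∈ Ioo (0 : ℝ) 1, HasDerivAt K 0 t := by
    intro t ht
    have hden0 : den t ≠ 0 := right_ne_zero_of_mul (hnd t ht)
    have hwp0 : wp t ≠ 0 := h.leftTrace_ne_zero ht
    have d0 := (hasDerivAt_of_contDiff h.contDiff t).sub (h.hasDerivAt_leftTrace ht)
    have d1 : HasDerivAt num _ t := d0.sub_const (z - w)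
    have d2 : HasDerivAt den _ t := d0.sub_const (z + w)
    have d3 := ((hI t ht).const_mul w).fun_neg.cexp
    refine ((d1.div d2 hden0).mul d3).congr_deriv ?_
    set e := Complex.exp (-(w * ∫ s in (0 : ℝ)..t, b s))
    have hz0 := hγz t ht
    have hp := hprod t ht
    have hbt : b t = deriv γ t / (wp t * (γ t - z)) := by
      simp only [hb, traceDensity, ← hwp]
      field_simp
    have hdiff : den t - num t = -2 * w := by simp only [hnum, hden]; ring
    rw [← hwp, hbt, Pi.div_apply,
      show num t / den t * (e * -(w * (deriv γ t / (wp t * (γ t - z))))) =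
      -(num t * den t) * e * w * deriv γ t / (den t ^ 2 * wp t * (γ t - z)) by field_simp, hp]
    field_simp
    linear_combination e * (γ t - z) * (wp t - γ t) * deriv γ t * hdiff
  have hKconst : ∀ t ∈ Ioo (0 : ℝ) 1, K t = K (1 / 2) := fun t ht =>
    isOpen_Ioo.is_const_of_deriv_eq_zero isPreconnected_Ioo
      (fun u hu => (hKd u hu).differentiableAt.differentiableWithinAt)
      (fun u hu => (hKd u hu).deriv) ht (by norm_num)
  -- The trace is controlled only on the open arc. Its limits at the endpoints come from |w_+|² =
  -- |γ² − 1|, which lets the constancy of K be evaluated there.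
  have hwplim : ∀ u ∈ Icc (0 : ℝ) 1, γ u ^ 2 = 1 → Tendsto wp (𝓝[Ioo 0 1] u) (𝓝 0) := by
    intro u hu hu1
    have h1 : Tendsto (fun t => ‖γ t ^ 2 - 1‖) (𝓝[Ioo 0 1] u) (𝓝 0) := by
      have hc : Continuous fun t => ‖γ t ^ 2 - 1‖ := by
        have := h.contDiff.continuous
        fun_prop
      have := hc.tendsto u
      rw [hu1, sub_self, norm_zero] at this
      exact this.mono_left nhdsWithin_le_nhds
    have h2 : Tendsto (fun t => √‖γ t ^ 2 - 1‖) (𝓝[Ioo 0 1] u) (𝓝 0) := by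
      have := (Real.continuous_sqrt.tendsto 0).comp h1
      rwa [Real.sqrt_zero] at this
    rw [tendsto_zero_iff_norm_tendsto_zero]
    refine h2.congr' ?_
    filter_upwards [self_mem_nhdsWithin] with t ht
    rw [← h.leftTrace_sq ht, norm_pow, Real.sqrt_sq (norm_nonneg _)]
  have hφ : (z - w) * (z + w) = 1 := by linear_combination -hwsq
  have hz1 : z - w ≠ 0 := left_ne_zero_of_mul_eq_one hφ
  have hz2 : z + w ≠ 0 := right_ne_zero_of_mul_eq_one hφ
  have hφ1 : z + w ≠ 1 := fun h1 => by
    rw [h1, mul_one] at hφ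
    exact hz ((by linear_combination (h1 + hφ) / 2 : z = 1) ▸ h.one_mem)
  have hφ2 : z + w ≠ -1 := fun h1 => by
    rw [h1] at hφ
    exact hz ((by linear_combination (h1 - hφ) / 2 : z = -1) ▸ h.neg_one_mem)
  have hlim : ∀ u ∈ Icc (0 : ℝ) 1, γ u ^ 2 = 1 → γ u - (z + w) ≠ 0 →
      Tendsto K (𝓝[Ioo 0 1] u) (𝓝 ((γ u - (z - w)) / (γ u - (z + w)) *
        Complex.exp (-(w * ∫ s in (0 : ℝ)..u, b s)))) := by
    intro u hu hu1 hne
    have h1 : Tendsto γ (𝓝[Ioo 0 1] u) (𝓝 (γ u)) :=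
      (h.contDiff.continuous.tendsto u).mono_left nhdsWithin_le_nhds
    have h2 := h1.sub (hwplim u hu hu1)
    rw [sub_zero] at h2
    refine ((h2.sub_const (z - w)).div (h2.sub_const (z + w)) hne).mul ?_
    have h3 := (hIc u hu).mono_left (nhdsWithin_mono u Ioo_subset_Icc_self)
    exact (Complex.continuous_exp.tendsto _).comp (h3.const_mul w).neg
  have hne0 : (𝓝[Ioo (0 : ℝ) 1] 0).NeBot := left_nhdsWithin_Ioo_neBot zero_lt_one
  have hne1 : (𝓝[Ioo (0 : ℝ) 1] 1).NeBot := right_nhdsWithin_Ioo_neBot zero_lt_one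
  have hKlim : ∀ u : ℝ, Tendsto K (𝓝[Ioo 0 1] u) (𝓝 (K (1 / 2))) := fun u =>
    tendsto_const_nhds.congr' (by
      filter_upwards [self_mem_nhdsWithin] with t ht using (hKconst t ht).symm)
  have g0 := tendsto_nhds_unique (hlim 0 (by simp) (by simp [h.start])
    (by rw [h.start]; exact fun h0 => hφ2 (sub_eq_zero.mp h0).symm)) (hKlim 0)
  have g1 := tendsto_nhds_unique (hlim 1 (by simp) (by simp [h.finish])
    (by rw [h.finish]; exact fun h0 => hφ1 (sub_eq_zero.mp h0).symm)) (hKlim 1)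
  rw [h.start, intervalIntegral.integral_same, mul_zero, neg_zero, Complex.exp_zero, mul_one] at g0
  rw [h.finish, ← g0, Complex.exp_neg] at g1
  have e0 : (-1 - (z - w)) / (-1 - (z + w)) = z - w := by
    rw [div_eq_iff (fun h0 => hφ2 (sub_eq_zero.mp h0).symm)]
    linear_combination hφ
  have e1 : (1 - (z - w)) / (1 - (z + w)) = -(z - w) := by
    rw [div_eq_iff (fun h0 => hφ1 (sub_eq_zero.mp h0).symm)]
    linear_combination -hφ
  rw [e0, e1] at g1
  have hE := Complex.exp_ne_zero (w * ∫ s in (0 : ℝ)..1, b s)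
  field_simp at g1
  exact g1.symm

end IsRegularArc

/-! ### The Cauchy integral of `1 / w_+` -/

/-- Two logarithms of the same number differ by a multiple of 2πi. A difference of modulus less than
1 is therefore zero. -/
theorem eventually_eq_of_exp_eq {X : Type*} [TopologicalSpace X] {f : X → ℂ} {c : ℂ} {x : X}
    (hf : ContinuousAt f x) (he : ∀ᶠ y in 𝓝 x, Complex.exp (f y) = c) : ∀ᶠ y in 𝓝 x, f y = f x := by
  have h1 : ∀ᶠ y in 𝓝 x, ‖f y - f x‖ < 1 := by
    have := hf.eventually (Metric.ball_mem_nhds (f x) one_pos)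
    filter_upwards [this] with y hy
    exact mem_ball_iff_norm.mp hy
  filter_upwards [h1, he] with y hy hey
  obtain ⟨n, hn⟩ := Complex.exp_eq_exp_iff_exists_int.mp (hey.trans he.self_of_nhds.symm)
  rw [hn, add_sub_cancel_left, norm_mul, Complex.norm_intCast] at hy
  have hpi : ‖2 * (Real.pi : ℂ) * Complex.I‖ = 2 * Real.pi := by
    simp [abs_of_pos Real.pi_pos]
  rw [hpi] at hy
  have hn0 : n = 0 := by
    by_contra hne
    have h2 : (1 : ℝ) ≤ |(n : ℝ)| := by exact_mod_cast Int.one_le_abs hne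
    nlinarith [Real.pi_gt_three]
  rw [hn, hn0]
  simp

namespace IsRegularArc

variable {γ : ℝ → ℂ}

/-- Subtracting ω(z)⁻¹ times the logarithm replaces the density 1/w_+ near t₀ by 1/ω(γ t) − 1/ω(z).
This is O(|γ t − z|) and cancels the singular kernel, so dominated convergence gives one limit D for
both sides of the arc. It serves to fix a constant at a single point. -/
theorem tendsto_sub_inv_mul (h : IsRegularArc γ)
    (hint : IntervalIntegrable (traceDensity γ) MeasureTheory.volume 0 1) {t₀ : ℝ}
    (ht₀ : t₀ ∈ Ioo (0 : ℝ) 1) {ω : ℂ → ℂ} (hω : ∀ᶠ z in 𝓝 (γ t₀), DifferentiableAt ℂ ω z)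
    (hω0 : ω (γ t₀) ≠ 0) (htr : ∀ᶠ t in 𝓝 t₀, leftTrace (wBranch γ) γ t = ω (γ t)) :
    ∃ D : ℂ, Tendsto (fun z => cauchyTransform γ (traceDensity γ) 0 1 z -
      (ω z)⁻¹ * cauchyTransform γ (deriv γ) 0 1 z) (𝓝[(arcSet γ)ᶜ] (γ t₀)) (𝓝 D) := by
  set a : ℝ → ℂ := traceDensity γ with ha
  set F : ℂ → ℝ → ℂ := fun z t => (γ t - z)⁻¹ * a t - (ω z)⁻¹ * ((γ t - z)⁻¹ * deriv γ t) with hF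
  have hωa : AnalyticAt ℂ (fun z => (ω z)⁻¹) (γ t₀) :=
    (Complex.analyticAt_iff_eventually_differentiableAt.mpr hω).inv hω0
  have hωc : ContinuousAt (fun z => (ω z)⁻¹) (γ t₀) := hωa.continuousAt
  obtain ⟨C, s, hs, hLip⟩ := hωa.hasStrictDerivAt.hasStrictFDerivAt.exists_lipschitzOnWith
  obtain ⟨δ, hδ, hδtr⟩ := Metric.eventually_nhds_iff.mp
    (htr.and (h.contDiff.continuous.continuousAt.eventually hs))
  -- the curve is away from `γ t₀` for the other parameters
  set T : Set ℝ := Icc 0 1 \ Metric.ball t₀ δ with hT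
  have hTc : IsCompact T := isCompact_Icc.diff Metric.isOpen_ball
  have hTfar : ∃ r > 0, ∀ t ∈ T, r ≤ ‖γ t - γ t₀‖ := by
    rcases T.eq_empty_or_nonempty with hT0 | hTne
    · exact ⟨1, one_pos, by simp [hT0]⟩
    · have hc : Continuous fun t => ‖γ t - γ t₀‖ :=
        (h.contDiff.continuous.sub continuous_const).norm
      obtain ⟨u, hu, hmin⟩ := hTc.exists_isMinOn hTne hc.continuousOn
      refine ⟨_, norm_pos_iff.mpr (sub_ne_zero.mpr fun he => ?_), fun t ht => hmin ht⟩
      have := h.injOn hu.1 (Ioo_subset_Icc_self ht₀) he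
      exact hu.2 (this ▸ Metric.mem_ball_self hδ)
  obtain ⟨r, hr, hfar⟩ := hTfar
  have hdint : IntervalIntegrable (deriv γ) MeasureTheory.volume 0 1 :=
    intervalIntegrable_deriv h.contDiff
  have hb1 : ∀ᶠ z in 𝓝 (γ t₀), ‖(ω z)⁻¹‖ ≤ ‖(ω (γ t₀))⁻¹‖ + 1 :=
    (hωc.norm.eventually (gt_mem_nhds (lt_add_one _))).mono fun _ hz => hz.le
  have hb2 : ∀ᶠ z in 𝓝 (γ t₀), ‖z - γ t₀‖ < r / 2 := by
    filter_upwards [Metric.ball_mem_nhds (γ t₀) (half_pos hr)] with z hz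
    exact mem_ball_iff_norm.mp hz
  have hev : ∀ᶠ z in 𝓝[(arcSet γ)ᶜ] (γ t₀), z ∉ arcSet γ ∧ z ∈ s ∧
      ‖(ω z)⁻¹‖ ≤ ‖(ω (γ t₀))⁻¹‖ + 1 ∧ ‖z - γ t₀‖ < r / 2 := by
    filter_upwards [self_mem_nhdsWithin, mem_nhdsWithin_of_mem_nhds hs,
      hb1.filter_mono nhdsWithin_le_nhds, hb2.filter_mono nhdsWithin_le_nhds] with z h1 h2 h3 h4
    exact ⟨h1, h2, h3, h4⟩
  have hF1 : ∀ z ∉ arcSet γ, IntervalIntegrable (fun t => (γ t - z)⁻¹ * a t)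
      MeasureTheory.volume 0 1 := fun z hz =>
    intervalIntegrable_cauchy h.contDiff.continuous zero_le_one hint hz
  have hF2 : ∀ z ∉ arcSet γ, IntervalIntegrable (fun t => (γ t - z)⁻¹ * deriv γ t)
      MeasureTheory.volume 0 1 := fun z hz =>
    intervalIntegrable_cauchy h.contDiff.continuous zero_le_one hdint hz
  set B := ‖(ω (γ t₀))⁻¹‖ + 1 with hB
  have hB0 : 0 ≤ B := by positivity
  -- The first term is for parameters near t₀, where C is the Lipschitz constant of 1/ω. The second
  -- is for the others, where |γ t − z| ≥ r/2.
  set bound : ℝ → ℝ := fun t => C * ‖deriv γ t‖ + (r / 2)⁻¹ * (‖a t‖ + B * ‖deriv γ t‖) with hbd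
  have hlim : Tendsto (fun z => ∫ t in (0 : ℝ)..1, F z t) (𝓝[(arcSet γ)ᶜ] (γ t₀))
      (𝓝 (∫ t in (0 : ℝ)..1, F (γ t₀) t)) := by
    refine intervalIntegral.tendsto_integral_filter_of_dominated_convergence bound ?_ ?_ ?_ ?_
    · filter_upwards [self_mem_nhdsWithin] with z hz
      exact ((hF1 z hz).sub ((hF2 z hz).const_mul _)).def'.aestronglyMeasurable
    · filter_upwards [hev] with z ⟨hz1, hz2, hz3, hz4⟩
      refine Eventually.of_forall fun t ht => ?_
      rw [uIoc_of_le zero_le_one] at ht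
      have ht' := Ioc_subset_Icc_self ht
      have hne : γ t - z ≠ 0 := fun h0 => hz1 ⟨t, ht', sub_eq_zero.mp h0⟩
      by_cases htδ : t ∈ Metric.ball t₀ δ
      · obtain ⟨e1, e2⟩ := hδtr (Metric.mem_ball.mp htδ)
        have e3 : F z t = (γ t - z)⁻¹ * ((ω (γ t))⁻¹ - (ω z)⁻¹) * deriv γ t := by
          simp only [hF, ha, traceDensity, e1]
          ring
        have e4 : ‖(γ t - z)⁻¹ * ((ω (γ t))⁻¹ - (ω z)⁻¹)‖ ≤ C := by
          rw [norm_mul, norm_inv, inv_mul_le_iff₀ (norm_pos_iff.mpr hne), mul_comm]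
          exact hLip.norm_sub_le e2 hz2
        have e5 : 0 ≤ (r / 2)⁻¹ * (‖a t‖ + B * ‖deriv γ t‖) := by positivity
        rw [e3, norm_mul]
        calc _ ≤ C * ‖deriv γ t‖ := by gcongr
          _ ≤ _ := by simp only [hbd]; linarith
      · have e1 := hfar t ⟨ht', htδ⟩
        have e2 : r / 2 ≤ ‖γ t - z‖ := by
          have := norm_sub_le_norm_sub_add_norm_sub (γ t) z (γ t₀)
          linarith
        have e3 : F z t = (γ t - z)⁻¹ * (a t - (ω z)⁻¹ * deriv γ t) := by
          simp only [hF]; ring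
        have e5 : 0 ≤ C * ‖deriv γ t‖ := by positivity
        rw [e3, norm_mul, norm_inv]
        have e6 : ‖a t - (ω z)⁻¹ * deriv γ t‖ ≤ ‖a t‖ + B * ‖deriv γ t‖ := by
          refine (norm_sub_le _ _).trans ?_
          rw [norm_mul]
          gcongr
        calc _ ≤ (r / 2)⁻¹ * (‖a t‖ + B * ‖deriv γ t‖) := by gcongr
          _ ≤ _ := by simp only [hbd]; linarith
    · exact (hdint.norm.const_mul _).add ((hint.norm.add (hdint.norm.const_mul _)).const_mul _)
    · have hnull : ∀ᵐ t : ℝ, t ≠ t₀ := by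
        simp [MeasureTheory.ae_iff]
      filter_upwards [hnull] with t htne ht
      rw [uIoc_of_le zero_le_one] at ht
      have hne : γ t - γ t₀ ≠ 0 := fun h0 =>
        htne (h.injOn (Ioc_subset_Icc_self ht) (Ioo_subset_Icc_self ht₀) (sub_eq_zero.mp h0))
      have hc : ContinuousAt (fun z => (γ t - z)⁻¹) (γ t₀) :=
        (continuousAt_const.sub continuousAt_id).inv₀ hne
      exact (((hc.mul continuousAt_const).sub (hωc.mul
        (hc.mul continuousAt_const))).tendsto).mono_left
        nhdsWithin_le_nhds
  refine ⟨_, hlim.congr' ?_⟩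
  filter_upwards [self_mem_nhdsWithin] with z hz
  rw [intervalIntegral.integral_sub (hF1 z hz) ((hF2 z hz).const_mul _),
    intervalIntegral.integral_const_mul]
  rfl

/-- The product w · (transform) has exponential −1, so it is locally constant, and constant because
the arc does not separate the plane. Its value f is read off at the midpoint of the parameter
interval, where the common limit of `tendsto_sub_inv_mul` gives (f − λ)/ω = (−f − λ + 2πi)/ω, that
is f = πi. -/
theorem cauchyTransform_traceDensity (h : IsRegularArc γ)
    (hint : IntervalIntegrable (traceDensity γ) MeasureTheory.volume 0 1) {z : ℂ}
    (hz : z ∉ arcSet γ) :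
    cauchyTransform γ (traceDensity γ) 0 1 z = Real.pi * Complex.I / wBranch γ z := by
  set f : ℂ → ℂ := fun z => wBranch γ z * cauchyTransform γ (traceDensity γ) 0 1 z with hf
  have hfloc : ∀ z ∉ arcSet γ, ∀ᶠ y in 𝓝 z, f y = f z := by
    intro z hz
    refine eventually_eq_of_exp_eq (c := -1) ?_ ?_
    · exact (h.wBranch_differentiableAt hz).continuousAt.mul
        (hasDerivAt_cauchyTransform h.contDiff.continuous zero_le_one hint hz).continuousAt
    · filter_upwards [h.isClosed.isOpen_compl.mem_nhds hz] with y hy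
      exact h.exp_wBranch_mul_cauchyTransform hint hy
  have hfc : ∀ y ∉ arcSet γ, f y = f z := fun y hy => h.eq_of_locallyConstant hfloc hy hz
  have ht₀ : (1 / 2 : ℝ) ∈ Ioo (0 : ℝ) 1 := by norm_num
  obtain ⟨P, N, lam, ω, hPN, hlamd, hlamP, hlamN, hωd, hωP, hωN, hωsq, htr⟩ := h.exists_branch ht₀
  have hω0 : ω (γ (1 / 2)) ≠ 0 := by
    rw [← htr.self_of_nhds]; exact h.leftTrace_ne_zero ht₀
  obtain ⟨D, hD⟩ := h.tendsto_sub_inv_mul hint ht₀ hωd hω0 htr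
  have hωc := hωd.self_of_nhds.continuousAt
  have hlamc := hlamd.self_of_nhds.continuousAt
  have hside : ∀ (u : ℝ → ℂ), Tendsto u (𝓝[>] 0) (𝓝 (γ (1 / 2))) →
      (∀ᶠ ε in 𝓝[>] 0, u ε ∉ arcSet γ) →
      Tendsto (fun ε => cauchyTransform γ (traceDensity γ) 0 1 (u ε) -
      (ω (u ε))⁻¹ * cauchyTransform γ (deriv γ) 0 1 (u ε)) (𝓝[>] 0) (𝓝 D) := fun u hu hu' =>
    hD.comp (tendsto_nhdsWithin_iff.mpr ⟨hu, hu'⟩)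
  have hl := tendsto_left_normal γ (1 / 2)
  have hr := tendsto_right_normal γ (1 / 2)
  have hlP := hPN.left_mem.self_of_nhds
  have hrN := hPN.right_mem.self_of_nhds
  have el := hside _ hl (hlP.mono fun ε hε => hPN.left_subset hε)
  have er := hside _ hr (hrN.mono fun ε hε => hPN.right_subset hε)
  have cl : Tendsto (fun y => f z / ω y - (ω y)⁻¹ * lam y) (𝓝 (γ (1 / 2)))
      (𝓝 (f z / ω (γ (1 / 2)) - (ω (γ (1 / 2)))⁻¹ * lam (γ (1 / 2)))) :=
    ((continuousAt_const.div hωc hω0).sub ((hωc.inv₀ hω0).mul hlamc)).tendsto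
  have cr : Tendsto (fun y => -f z / ω y - (ω y)⁻¹ * (lam y - 2 * Real.pi * Complex.I))
      (𝓝 (γ (1 / 2))) (𝓝 (-f z / ω (γ (1 / 2)) -
        (ω (γ (1 / 2)))⁻¹ * (lam (γ (1 / 2)) - 2 * Real.pi * Complex.I))) :=
    ((continuousAt_const.div hωc hω0).sub
      ((hωc.inv₀ hω0).mul (hlamc.sub continuousAt_const))).tendsto
  have hval : ∀ y ∉ arcSet γ, cauchyTransform γ (traceDensity γ) 0 1 y = f z / wBranch γ y :=
    fun y hy => by rw [← hfc y hy, hf, mul_div_cancel_left₀ _ (h.wBranch_ne_zero hy)]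
  have hDl := tendsto_nhds_unique el ((cl.comp hl).congr' (by
    filter_upwards [hlP] with ε hε
    simp only [Function.comp_apply]
    rw [hval _ (hPN.left_subset hε), hωP _ hε, hlamP _ hε]))
  have hDr := tendsto_nhds_unique er ((cr.comp hr).congr' (by
    filter_upwards [hrN] with ε hε
    simp only [Function.comp_apply]
    rw [hval _ (hPN.right_subset hε), hωN _ hε, hlamN _ hε, div_neg, neg_div]))
  have hfz : f z = Real.pi * Complex.I := by
    rw [hDl] at hDr
    field_simp at hDr
    linear_combination hDr / 2
  rw [hval z hz, hfz]

end IsRegularArc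

/-! ### Integrability of `γ' / w_+` on smooth arcs -/

/-- The divided difference of γ at u, completed by the derivative, is continuous and nowhere zero on
a compact interval. -/
theorem exists_pos_mul_le_norm_sub {γ : ℝ → ℂ} (hγ : IsSmoothArc γ) {u : ℝ}
    (hu : u ∈ Icc (0 : ℝ) 1) : ∃ c > 0, ∀ t ∈ Icc (0 : ℝ) 1, c * |t - u| ≤ ‖γ t - γ u‖ := by
  have hd : DifferentiableAt ℝ γ u := hγ.contDiff.differentiable one_ne_zero u
  have hc : Continuous fun t => ‖dslope γ u t‖ := by
    refine Continuous.norm (continuous_iff_continuousAt.mpr fun t => ?_)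
    by_cases htu : t = u
    · rw [htu]; exact continuousAt_dslope_same.mpr hd
    · exact (continuousAt_dslope_of_ne htu).mpr hγ.contDiff.continuous.continuousAt
  obtain ⟨v, hv, hmin⟩ := isCompact_Icc.exists_isMinOn (s := Icc (0 : ℝ) 1) ⟨u, hu⟩ hc.continuousOn
  refine ⟨‖dslope γ u v‖, norm_pos_iff.mpr ?_, fun t ht => ?_⟩
  · by_cases hvu : v = u
    · rw [hvu, dslope_same]; exact hγ.deriv_ne u hu
    · rw [dslope_of_ne _ hvu, slope_def_module]
      refine smul_ne_zero (inv_ne_zero (sub_ne_zero.mpr hvu)) (sub_ne_zero.mpr fun he => hvu ?_)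
      exact hγ.injOn hv hu he
  · have h1 : ‖dslope γ u v‖ ≤ ‖dslope γ u t‖ := hmin ht
    rw [← sub_smul_dslope, norm_smul, Real.norm_eq_abs, mul_comm]
    gcongr

/-- Since |w_+|² = |γ + 1||γ − 1| ≥ c₀ c₁ t(1 − t), the density has only inverse square root
singularities at the endpoints. -/
theorem IsSmoothArc.intervalIntegrable_traceDensity {γ : ℝ → ℂ} (hγ : IsSmoothArc γ) :
    IntervalIntegrable (traceDensity γ) MeasureTheory.volume 0 1 := by
  have h := hγ.isRegularArc
  obtain ⟨c₀, hc₀, h0⟩ := exists_pos_mul_le_norm_sub hγ (u := 0) (by simp)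
  obtain ⟨c₁, hc₁, h1⟩ := exists_pos_mul_le_norm_sub hγ (u := 1) (by simp)
  obtain ⟨A, hA⟩ := isCompact_Icc.exists_bound_of_continuousOn (s := Icc (0 : ℝ) 1)
    (hγ.contDiff.continuous_deriv le_rfl).continuousOn
  have hA0 : 0 ≤ A := (norm_nonneg _).trans (hA 0 (by simp))
  rw [intervalIntegrable_iff_integrableOn_Ioo_of_le zero_le_one]
  set bound : ℝ → ℝ := fun t => A / √(c₀ * c₁) * (t ^ (-1 / 2 : ℝ) + (1 - t) ^ (-1 / 2 : ℝ)) * 2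
    with hbd
  have hi0 : IntervalIntegrable (fun t : ℝ => t ^ (-1 / 2 : ℝ)) MeasureTheory.volume 0 1 :=
    intervalIntegral.intervalIntegrable_rpow' (by norm_num)
  have hi1 : IntervalIntegrable (fun t : ℝ => (1 - t) ^ (-1 / 2 : ℝ)) MeasureTheory.volume 0 1 := by
    have := (hi0.comp_sub_left 1).symm
    simpa using this
  have hb : MeasureTheory.IntegrableOn bound (Ioo 0 1) :=
    (intervalIntegrable_iff_integrableOn_Ioo_of_le zero_le_one).mp
      (((hi0.add hi1).const_mul _).mul_const _)
  refine MeasureTheory.Integrable.mono' hb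
    (h.continuousOn_traceDensity.aestronglyMeasurable measurableSet_Ioo) ?_
  refine (MeasureTheory.ae_restrict_iff' measurableSet_Ioo).mpr
    (Eventually.of_forall fun t ht => ?_)
  have ht' := Ioo_subset_Icc_self ht
  have e0 := h0 t ht'
  have e1 := h1 t ht'
  rw [hγ.start, sub_zero, abs_of_pos ht.1, sub_neg_eq_add] at e0
  rw [hγ.finish, abs_sub_comm, abs_of_pos (sub_pos.mpr ht.2)] at e1
  have ht1 : 0 < 1 - t := sub_pos.mpr ht.2
  have ht0 : 0 < t := ht.1
  have hlow : c₀ * c₁ * (t * (1 - t)) ≤ ‖leftTrace (wBranch γ) γ t‖ ^ 2 := by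
    rw [← norm_pow, h.leftTrace_sq ht, show γ t ^ 2 - 1 = (γ t + 1) * (γ t - 1) by ring, norm_mul]
    calc _ = (c₀ * t) * (c₁ * (1 - t)) := by ring
      _ ≤ _ := by gcongr
  have hs : √(c₀ * c₁) * (√t * √(1 - t)) ≤ ‖leftTrace (wBranch γ) γ t‖ := by
    rw [← Real.sqrt_mul ht0.le, ← Real.sqrt_mul (by positivity)]
    exact Real.sqrt_le_iff.mpr ⟨norm_nonneg _, hlow⟩
  have hpos : 0 < √(c₀ * c₁) * (√t * √(1 - t)) := by positivity
  have hp : ∀ x : ℝ, 0 < x → x ^ (-1 / 2 : ℝ) = (√x)⁻¹ := fun x hx => by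
    rw [Real.sqrt_eq_rpow, ← Real.rpow_neg hx.le]; norm_num
  rw [traceDensity, norm_div]
  calc _ ≤ A / (√(c₀ * c₁) * (√t * √(1 - t))) := by
        have := hA t ht'
        gcongr
    _ = A / √(c₀ * c₁) * (√t * √(1 - t))⁻¹ := by field_simp
    _ ≤ A / √(c₀ * c₁) * (((√t)⁻¹ + (√(1 - t))⁻¹) * 2) := by
        gcongr
        have hst : 0 < √t := Real.sqrt_pos.mpr ht0
        have hst1 : 0 < √(1 - t) := Real.sqrt_pos.mpr ht1
        rw [inv_add_inv hst.ne' hst1.ne', inv_eq_one_div, div_mul_eq_mul_div]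
        gcongr
        -- The factor 2 in `bound` leaves room: after reduction to a common denominator only 1 ≤
        -- 2(√t + √(1 − t)) is needed.
        have h2 : 1 ≤ (√t + √(1 - t)) ^ 2 := by
          nlinarith [Real.sq_sqrt ht0.le, Real.sq_sqrt ht1.le, mul_pos hst hst1]
        nlinarith
    _ = _ := by simp only [hbd]; rw [hp t ht0, hp _ ht1]; ring

/-! ### The Cauchy-Pompeiu formula -/

/-- The integral of `h` over the boundary of the square with centre `0` and half side `R`. -/
def squareIntegral (h : ℂ → ℂ) (R : ℝ) : ℂ :=
  (∫ x : ℝ in -R..R, h (x + (-R : ℝ) * Complex.I)) - (∫ x : ℝ in -R..R, h (x + R * Complex.I)) +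
    Complex.I • (∫ y : ℝ in -R..R, h (R + y * Complex.I)) -
    Complex.I • ∫ y : ℝ in -R..R, h ((-R : ℝ) + y * Complex.I)

theorem norm_le_norm_add_mul_I (x y : ℝ) :
    |x| ≤ ‖(x + y * Complex.I : ℂ)‖ ∧ |y| ≤ ‖(x + y * Complex.I : ℂ)‖ := by
  have h1 := Complex.abs_re_le_norm (x + y * Complex.I)
  have h2 := Complex.abs_im_le_norm (x + y * Complex.I)
  simp at h1 h2
  exact ⟨h1, h2⟩

theorem integral_two_mul_div_sq_add_sq {R : ℝ} (hR : 0 < R) :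
    ∫ x : ℝ in -R..R, ((2 * R / (x ^ 2 + R ^ 2) : ℝ) : ℂ) = Real.pi := by
  rw [intervalIntegral.integral_ofReal]
  congr 1
  rw [intervalIntegral.integral_eq_sub_of_hasDerivAt (f := fun x => 2 * Real.arctan (x / R))]
  · rw [neg_div, div_self hR.ne', Real.arctan_neg, Real.arctan_one]; ring
  · intro x _
    refine (((hasDerivAt_id x).div_const R).arctan.const_mul 2).congr_deriv ?_
    simp only [id]
    field_simp
    ring
  · apply Continuous.intervalIntegrable
    refine continuous_const.div (by fun_prop) fun x => ?_
    positivity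

theorem squareIntegral_inv {R : ℝ} (hR : 0 < R) :
    squareIntegral (fun ζ => ζ⁻¹) R = 2 * Real.pi * Complex.I := by
  have hne : ∀ x y : ℝ, (x = R ∨ x = -R ∨ y = R ∨ y = -R) → (x + y * Complex.I : ℂ) ≠ 0 := by
    intro x y hxy h0
    have h1 := congrArg Complex.re h0
    have h2 := congrArg Complex.im h0
    simp at h1 h2
    rcases hxy with h | h | h | h <;> linarith
  have hint : ∀ u : ℝ → ℂ, Continuous u → (∀ x, u x ≠ 0) →
      IntervalIntegrable (fun x => (u x)⁻¹) MeasureTheory.volume (-R) R := fun u hu h0 =>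
    (hu.inv₀ h0).intervalIntegrable _ _
  have hpos : ∀ x : ℝ, ((x : ℂ) ^ 2 + (R : ℂ) ^ 2) ≠ 0 := fun x => by
    have : x ^ 2 + R ^ 2 ≠ 0 := by positivity
    exact_mod_cast this
  have e1 : (∫ x : ℝ in -R..R, (x + (-R : ℝ) * Complex.I : ℂ)⁻¹) -
      (∫ x : ℝ in -R..R, (x + R * Complex.I : ℂ)⁻¹) = Real.pi * Complex.I := by
    rw [← intervalIntegral.integral_sub
      (hint _ (by fun_prop) fun x => hne x (-R) (by simp))
      (hint _ (by fun_prop) fun x => hne x R (by simp)),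
      ← integral_two_mul_div_sq_add_sq hR, ← intervalIntegral.integral_mul_const]
    congr 1
    ext x
    have a1 := hne x (-R) (by simp)
    have a2 := hne x R (by simp)
    rw [inv_sub_inv a1 a2]
    push_cast at a1 ⊢
    have : ((x : ℂ) + -(R : ℂ) * Complex.I) * (x + R * Complex.I) = x ^ 2 + R ^ 2 := by
      linear_combination (-(R : ℂ) ^ 2) * Complex.I_sq
    rw [this]
    ring
  have e2 : (∫ y : ℝ in -R..R, (R + y * Complex.I : ℂ)⁻¹) -
      (∫ y : ℝ in -R..R, ((-R : ℝ) + y * Complex.I : ℂ)⁻¹) = Real.pi := by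
    rw [← intervalIntegral.integral_sub
      (hint _ (by fun_prop) fun x => hne R x (by simp))
      (hint _ (by fun_prop) fun x => hne (-R) x (by simp)),
      ← integral_two_mul_div_sq_add_sq hR]
    congr 1
    ext x
    have a1 := hne R x (by simp)
    have a2 := hne (-R) x (by simp)
    rw [inv_sub_inv a1 a2]
    push_cast at a2 ⊢
    rw [div_eq_div_iff (mul_ne_zero a1 a2) (hpos x)]
    linear_combination (-2) * (R : ℂ) * (x : ℂ) ^ 2 * Complex.I_sq
  simp only [squareIntegral, smul_eq_mul]
  linear_combination e1 + Complex.I * e2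

theorem norm_squareIntegral_le {h : ℂ → ℂ} {R C : ℝ} (hR : 0 < R)
    (hC : ∀ x y : ℝ, R ≤ |x| ∨ R ≤ |y| → ‖h (x + y * Complex.I)‖ ≤ C) :
    ‖squareIntegral h R‖ ≤ 8 * R * C := by
  have key : ∀ u : ℝ → ℂ, (∀ x, ‖u x‖ ≤ C) → ‖∫ x : ℝ in -R..R, u x‖ ≤ 2 * R * C := by
    intro u hu
    have := intervalIntegral.norm_integral_le_of_norm_le_const (a := -R) (b := R) (f := u) (C := C)
      fun x _ => hu x
    rwa [show R - -R = 2 * R by ring, abs_of_pos (by linarith), mul_comm] at this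
  have hRabs : R ≤ |R| := le_abs_self R
  have hRabs' : R ≤ |-R| := by rw [abs_neg]; exact hRabs
  have k1 := key (fun x : ℝ => h (x + (-R : ℝ) * Complex.I)) fun x => hC x (-R) (Or.inr hRabs')
  have k2 := key (fun x : ℝ => h (x + R * Complex.I)) fun x => hC x R (Or.inr hRabs)
  have k3 := key (fun y : ℝ => h (R + y * Complex.I)) fun y => hC R y (Or.inl hRabs)
  have k4 := key (fun y : ℝ => h ((-R : ℝ) + y * Complex.I)) fun y => hC (-R) y (Or.inl hRabs')
  unfold squareIntegral
  refine (norm_sub_le _ _).trans ?_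
  have k5 := norm_add_le ((∫ x : ℝ in -R..R, h (x + (-R : ℝ) * Complex.I)) -
    (∫ x : ℝ in -R..R, h (x + R * Complex.I)))
    (Complex.I • (∫ y : ℝ in -R..R, h (R + y * Complex.I)))
  have k6 := norm_sub_le (∫ x : ℝ in -R..R, h (x + (-R : ℝ) * Complex.I))
    (∫ x : ℝ in -R..R, h (x + R * Complex.I))
  rw [norm_smul, Complex.norm_I, one_mul] at k5 ⊢
  linarith

theorem integral_integral_eq_integral_complex {g : ℂ → ℂ} (hg : Continuous g)
    (hgc : HasCompactSupport g) {R : ℝ} (hR : ∀ ζ, g ζ ≠ 0 → ‖ζ‖ < R) :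
    ∫ x : ℝ in -R..R, ∫ y : ℝ in -R..R, g (x + y * Complex.I) = ∫ ζ, g ζ := by
  have e := Complex.volume_preserving_equiv_real_prod.symm
  have hi : MeasureTheory.Integrable g := hg.integrable_of_hasCompactSupport hgc
  rw [← e.integral_comp Complex.measurableEquivRealProd.symm.measurableEmbedding g]
  rw [MeasureTheory.Measure.volume_eq_prod, MeasureTheory.integral_prod]
  · have hin : ∀ x : ℝ, ∫ y : ℝ in -R..R, g (x + y * Complex.I) =
        ∫ y : ℝ, g (Complex.measurableEquivRealProd.symm (x, y)) := by
      intro x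
      have h1 : ∀ y : ℝ, g (Complex.measurableEquivRealProd.symm (x, y)) =
          g (x + y * Complex.I) := fun y => by
        congr 1
        simp [Complex.measurableEquivRealProd_symm_apply, Complex.mk_eq_add_mul_I]
      simp only [h1]
      refine intervalIntegral.integral_eq_integral_of_support_subset fun y hy => ?_
      have h2 := (norm_le_norm_add_mul_I x y).2.trans_lt (hR _ hy)
      rw [abs_lt] at h2
      exact ⟨h2.1, h2.2.le⟩
    simp only [← hin]
    refine intervalIntegral.integral_eq_integral_of_support_subset fun x hx => ?_
    by_contra hxR
    refine hx ?_
    have : ∀ y : ℝ, g (x + y * Complex.I) = 0 := fun y => by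
      by_contra hne
      have h2 := (norm_le_norm_add_mul_I x y).1.trans_lt (hR _ hne)
      rw [abs_lt] at h2
      exact hxR ⟨h2.1, h2.2.le⟩
    simp [this]
  · rw [← MeasureTheory.Measure.volume_eq_prod]
    exact (e.integrable_comp_emb
      Complex.measurableEquivRealProd.symm.measurableEmbedding).mpr hi

/-- The expression i F'(1) − F'(i) is 2i ∂F/∂ζ̄. Green's formula is applied on large squares to
(F(ζ) − F(0))/ζ. This quotient is continuous at 0 because F is complex differentiable there, so no
disc has to be removed. The boundary integral tends to (c − F(0)) 2πi. -/
theorem cauchyPompeiu_zero {F : ℂ → ℂ} {F' : ℂ → ℂ →L[ℝ] ℂ} (hF : ∀ ζ, HasFDerivAt F (F' ζ) ζ)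
    (hF' : Continuous F') {c : ℂ} (hc : Tendsto F (cocompact ℂ) (𝓝 c))
    (hsupp : HasCompactSupport fun ζ => Complex.I * F' ζ 1 - F' ζ Complex.I)
    (h0 : ∀ᶠ ζ in 𝓝 (0 : ℂ), Complex.I * F' ζ 1 - F' ζ Complex.I = 0)
    (hd : DifferentiableAt ℂ F 0) :
    (c - F 0) * (2 * Real.pi * Complex.I) =
      ∫ ζ, ζ⁻¹ * (Complex.I * F' ζ 1 - F' ζ Complex.I) := by
  set D : ℂ → ℂ := fun ζ => Complex.I * F' ζ 1 - F' ζ Complex.I with hD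
  set g : ℂ → ℂ := fun ζ => ζ⁻¹ * D ζ with hg
  have hDc : Continuous D := by fun_prop
  have hgc : Continuous g := by
    refine continuous_iff_continuousAt.mpr fun ζ => ?_
    by_cases hζ : ζ = 0
    · subst hζ
      refine (continuousAt_const (y := (0 : ℂ))).congr ?_
      filter_upwards [h0] with y hy
      simp only [hg, hD, hy, mul_zero]
    · exact (continuousAt_inv₀ hζ).mul hDc.continuousAt
  have hgs : HasCompactSupport g := hsupp.mul_left
  set h : ℂ → ℂ := dslope F 0 with hh
  set f' : ℂ → ℂ →L[ℝ] ℂ := fun ζ => ζ⁻¹ • F' ζ + (F ζ - F 0) •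
    ((ContinuousLinearMap.toSpanSingleton ℂ (-(ζ ^ 2)⁻¹)).restrictScalars ℝ) with hf'
  have hhd : ∀ ζ ≠ 0, HasFDerivAt h (f' ζ) ζ := by
    intro ζ hζ
    have h1 := ((hasDerivAt_inv hζ).hasFDerivAt.restrictScalars ℝ).mul ((hF ζ).sub_const (F 0))
    refine h1.congr_of_eventuallyEq ?_
    filter_upwards [isOpen_ne.mem_nhds hζ] with y hy
    rw [hh, dslope_of_ne _ hy, slope_def_field, sub_zero, div_eq_inv_mul]
    rfl
  have hhc : Continuous h := by
    refine continuous_iff_continuousAt.mpr fun ζ => ?_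
    by_cases hζ : ζ = 0
    · rw [hζ]; exact continuousAt_dslope_same.mpr hd
    · exact (hhd ζ hζ).continuousAt
  have hf'g : ∀ ζ, Complex.I • f' ζ 1 - f' ζ Complex.I = g ζ := fun ζ => by
    simp only [hf', hg, hD, _root_.add_apply, _root_.smul_apply,
      ContinuousLinearMap.coe_restrictScalars', ContinuousLinearMap.toSpanSingleton_apply,
      smul_eq_mul]
    ring
  obtain ⟨R₀, hR₀⟩ := hgs.isCompact.isBounded.exists_norm_le
  have hstokes : ∀ R : ℝ, 0 < R → R₀ < R → squareIntegral h R = ∫ ζ, g ζ := by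
    intro R hR hRR
    have := Complex.integral_boundary_rect_of_hasFDerivAt_real_off_countable h f'
      (⟨-R, -R⟩ : ℂ) (⟨R, R⟩ : ℂ) {0} (countable_singleton _) hhc.continuousOn
      (fun ζ hζ => hhd ζ hζ.2) (by
        simp only [hf'g]
        exact (hgc.integrable_of_hasCompactSupport hgs).integrableOn)
    simp only [hf'g] at this
    rw [squareIntegral, this]
    exact integral_integral_eq_integral_complex hgc hgs fun ζ hζ =>
      (hR₀ ζ (subset_tsupport g hζ)).trans_lt hRR
  -- The boundary of the square has length 8R, and there the integrand (F − c)/ζ is at most ε/R.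
  have hsmall : ∀ ε > 0, ‖(∫ ζ, g ζ) - (c - F 0) * (2 * Real.pi * Complex.I)‖ ≤ 8 * ε := by
    intro ε hε
    have h1 : ∀ᶠ ζ in cocompact ℂ, ‖F ζ - c‖ < ε := by
      filter_upwards [hc (Metric.ball_mem_nhds c hε)] with ζ hζ
      exact mem_ball_iff_norm.mp hζ
    obtain ⟨R₁, -, hR₁⟩ := (Filter.HasBasis.mem_iff (Metric.hasBasis_cobounded_compl_closedBall
      (0 : ℂ))).mp (Metric.cobounded_eq_cocompact (α := ℂ) ▸ h1)
    set R := max (max R₀ R₁) 0 + 1 with hR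
    have hRpos : 0 < R := by positivity
    have hRR₀ : R₀ < R := by
      have := (le_max_left R₀ R₁).trans (le_max_left _ (0 : ℝ)); linarith
    have hRR₁ : R₁ < R := by
      have := (le_max_right R₀ R₁).trans (le_max_left _ (0 : ℝ)); linarith
    rw [← hstokes R hRpos hRR₀, ← squareIntegral_inv hRpos]
    have hfar : ∀ x y : ℝ, R ≤ |x| ∨ R ≤ |y| → R ≤ ‖(x + y * Complex.I : ℂ)‖ := fun x y hxy =>
      hxy.elim (fun h => h.trans (norm_le_norm_add_mul_I x y).1)
        fun h => h.trans (norm_le_norm_add_mul_I x y).2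
    have hsub : squareIntegral h R - (c - F 0) * squareIntegral (fun ζ => ζ⁻¹) R =
        squareIntegral (fun ζ => h ζ - (c - F 0) * ζ⁻¹) R := by
      have hint : ∀ u : ℝ → ℂ, Continuous u → (∀ x, R ≤ ‖u x‖) →
          (∫ x : ℝ in -R..R, (h (u x) - (c - F 0) * (u x)⁻¹)) =
          (∫ x : ℝ in -R..R, h (u x)) - (c - F 0) * ∫ x : ℝ in -R..R, (u x)⁻¹ := by
        intro u hu hne
        have hi : IntervalIntegrable (fun x => (u x)⁻¹) MeasureTheory.volume (-R) R :=
          (hu.inv₀ fun x h0 => by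
            have := hne x
            rw [h0, norm_zero] at this
            linarith).intervalIntegrable _ _
        have hi' : IntervalIntegrable (fun x => h (u x)) MeasureTheory.volume (-R) R :=
          (hhc.comp hu).intervalIntegrable _ _
        rw [intervalIntegral.integral_sub hi' (hi.const_mul _), intervalIntegral.integral_const_mul]
      have hRabs : R ≤ |R| := le_abs_self R
      have hRabs' : R ≤ |-R| := by rw [abs_neg]; exact hRabs
      simp only [squareIntegral, smul_eq_mul]
      rw [hint (fun x : ℝ => x + (-R : ℝ) * Complex.I) (by fun_prop)
          fun x => hfar x (-R) (Or.inr hRabs'),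
        hint (fun x : ℝ => x + R * Complex.I) (by fun_prop) fun x => hfar x R (Or.inr hRabs),
        hint (fun x : ℝ => R + x * Complex.I) (by fun_prop) fun x => hfar R x (Or.inl hRabs),
        hint (fun x : ℝ => (-R : ℝ) + x * Complex.I) (by fun_prop)
          fun x => hfar (-R) x (Or.inl hRabs')]
      ring
    rw [hsub]
    refine (norm_squareIntegral_le (C := ε / R) hRpos fun x y hxy => ?_).trans (le_of_eq ?_)
    · have h2 := hfar x y hxy
      set ζ : ℂ := x + y * Complex.I
      have hζ : ζ ≠ 0 := fun h0 => by rw [h0, norm_zero] at h2; linarith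
      have h3 : ‖F ζ - c‖ < ε := hR₁ (by simpa using hRR₁.trans_le h2)
      have h4 : h ζ - (c - F 0) * ζ⁻¹ = (F ζ - c) * ζ⁻¹ := by
        rw [hh, dslope_of_ne _ hζ, slope_def_field, sub_zero]
        ring
      rw [h4, norm_mul, norm_inv, ← div_eq_mul_inv]
      gcongr
    · field_simp
  have hle : ‖(∫ ζ, g ζ) - (c - F 0) * (2 * Real.pi * Complex.I)‖ ≤ 0 := by
    refine le_of_forall_pos_le_add fun ε hε => ?_
    have := hsmall (ε / 8) (by positivity)
    linarith
  exact (sub_eq_zero.mp (norm_le_zero_iff.mp hle)).symm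

theorem cauchyPompeiu {F : ℂ → ℂ} {F' : ℂ → ℂ →L[ℝ] ℂ} (hF : ∀ ζ, HasFDerivAt F (F' ζ) ζ)
    (hF' : Continuous F') {c : ℂ} (hc : Tendsto F (cocompact ℂ) (𝓝 c))
    (hsupp : HasCompactSupport fun ζ => Complex.I * F' ζ 1 - F' ζ Complex.I) {z : ℂ}
    (h0 : ∀ᶠ ζ in 𝓝 z, Complex.I * F' ζ 1 - F' ζ Complex.I = 0)
    (hd : DifferentiableAt ℂ F z) :
    F z = c + ∫ ζ, (2 * Real.pi * Complex.I)⁻¹ *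
      (Complex.I * F' ζ 1 - F' ζ Complex.I) / (z - ζ) := by
  have hpi : (2 * Real.pi * Complex.I : ℂ) ≠ 0 := Complex.two_pi_I_ne_zero
  have ht : Tendsto (fun ζ : ℂ => ζ + z) (𝓝 0) (𝓝 z) := by
    have := (continuous_add_const z).tendsto (0 : ℂ)
    rwa [zero_add] at this
  have h1 := cauchyPompeiu_zero (F := fun ζ => F (ζ + z)) (F' := fun ζ => F' (ζ + z))
    (fun ζ => (hasFDerivAt_comp_add_right z).mpr (hF (ζ + z))) (by fun_prop)
    (c := c) (hc.comp (Homeomorph.addRight z).isClosedEmbedding.tendsto_cocompact)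
    (hsupp.comp_homeomorph (Homeomorph.addRight z)) (ht.eventually h0)
    ((differentiableAt_comp_add_right z).mpr (by rwa [zero_add]))
  have h2 : (∫ ζ, ζ⁻¹ * (Complex.I * F' (ζ + z) 1 - F' (ζ + z) Complex.I)) =
      ∫ ζ, (ζ - z)⁻¹ * (Complex.I * F' ζ 1 - F' ζ Complex.I) := by
    rw [← MeasureTheory.integral_add_right_eq_self
      (fun ζ => (ζ - z)⁻¹ * (Complex.I * F' ζ 1 - F' ζ Complex.I)) z]
    simp
  rw [h2, zero_add] at h1
  have h3 : (∫ ζ, (2 * Real.pi * Complex.I)⁻¹ * (Complex.I * F' ζ 1 - F' ζ Complex.I) / (z - ζ)) =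
      -(2 * Real.pi * Complex.I)⁻¹ *
        ∫ ζ, (ζ - z)⁻¹ * (Complex.I * F' ζ 1 - F' ζ Complex.I) := by
    rw [← MeasureTheory.integral_const_mul]
    congr 1
    ext ζ
    rw [← neg_sub ζ z, div_neg, div_eq_mul_inv]
    ring
  rw [h3, ← h1]
  field_simp
  ring

open scoped Manifold in
/-- A function analytic near a closed set `K` is there a superposition of simple fractions with
poles off `K`. -/
theorem exists_cauchy_representation {G K : Set ℂ} (hG : IsOpen G) (hK : IsClosed K)
    (hKG : K ⊆ G) {f : ℂ → ℂ} (hf : DifferentiableOn ℂ f G) {c : ℂ}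
    (h : (IsCompact K ∧ c = 0) ∨ (K ∈ cocompact ℂ ∧ Tendsto f (cocompact ℂ) (𝓝 c))) :
    ∃ ν : ℂ → ℂ, Continuous ν ∧ HasCompactSupport ν ∧ Disjoint (tsupport ν) K ∧
      ∀ z ∈ K, f z = c + ∫ ζ, ν ζ / (z - ζ) := by
  -- The cutoff is to be 1 near K and 0 off G'. If K is compact, G' is taken bounded, so that χ f
  -- vanishes near infinity. Otherwise K contains a neighbourhood of infinity, where χ f = f tends
  -- to c.
  obtain ⟨G', hG', hKG', hG'G, hG'b⟩ : ∃ G' : Set ℂ, IsOpen G' ∧ K ⊆ G' ∧ G' ⊆ G ∧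
      ((Bornology.IsBounded G' ∧ c = 0) ∨ (K ∈ cocompact ℂ ∧ Tendsto f (cocompact ℂ) (𝓝 c))) := by
    rcases h with ⟨hKc, hc⟩ | h
    · obtain ⟨R, hR⟩ := hKc.isBounded.subset_ball (0 : ℂ)
      exact ⟨G ∩ Metric.ball 0 R, hG.inter Metric.isOpen_ball, subset_inter hKG hR,
        inter_subset_left, Or.inl ⟨Metric.isBounded_ball.subset inter_subset_right, hc⟩⟩
    · exact ⟨G, hG, hKG, subset_rfl, Or.inr h⟩
  obtain ⟨χ, hχ0, hχ1, -⟩ := exists_contMDiffMap_zero_one_nhds_of_isClosed (n := 1)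
    𝓘(ℝ, ℂ) hG'.isClosed_compl hK (disjoint_compl_left_iff_subset.mpr hKG')
  have hχ : ContDiff ℝ 1 (χ : ℂ → ℝ) := χ.contMDiff.contDiff
  set F : ℂ → ℂ := fun ζ => χ ζ * f ζ with hF
  have hFout : ∀ ζ ∉ G', F =ᶠ[𝓝 ζ] 0 := fun ζ hζ => by
    filter_upwards [(eventually_nhdsSet_iff_forall.mp hχ0) ζ hζ] with y hy
    simp [hF, hy]
  have hFin : ∀ ζ ∈ K, F =ᶠ[𝓝 ζ] f := fun ζ hζ => by
    filter_upwards [(eventually_nhdsSet_iff_forall.mp hχ1) ζ hζ] with y hy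
    simp [hF, hy]
  have hFc : ContDiff ℝ 1 F := by
    refine contDiff_iff_contDiffAt.mpr fun ζ => ?_
    by_cases hζ : ζ ∈ G'
    · have h1 : ContDiffAt ℂ 1 f ζ :=
        (hf.contDiffOn hG).contDiffAt (hG.mem_nhds (hG'G hζ))
      exact (Complex.ofRealCLM.contDiff.contDiffAt.comp ζ hχ.contDiffAt).mul
        (h1.restrict_scalars ℝ)
    · exact contDiffAt_const.congr_of_eventuallyEq (hFout ζ hζ)
  set D : ℂ → ℂ := fun ζ => Complex.I * fderiv ℝ F ζ 1 - fderiv ℝ F ζ Complex.I with hD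
  have hDout : ∀ ζ ∉ G', D ζ = 0 := fun ζ hζ => by
    simp [hD, (hFout ζ hζ).fderiv_eq]
  have hfd : ∀ ζ ∈ K, DifferentiableAt ℂ f ζ := fun ζ hζ =>
    hf.differentiableAt (hG.mem_nhds (hKG hζ))
  have hDin : ∀ ζ ∈ K, D =ᶠ[𝓝 ζ] 0 := fun ζ hζ => by
    filter_upwards [(hFin ζ hζ).eventuallyEq_nhds, hG.mem_nhds (hKG hζ)] with y hy hyG
    have h1 := ((hf.differentiableAt (hG.mem_nhds hyG)).hasDerivAt.hasFDerivAt.restrictScalars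
      ℝ).congr_of_eventuallyEq hy
    simp only [hD, h1.fderiv]
    simp [mul_comm]
  have hFcd : Continuous (fderiv ℝ F) := hFc.continuous_fderiv one_ne_zero
  have hDc : Continuous D := by fun_prop
  -- D vanishes off G', where the cutoff is locally 0, and near K, where χ f is analytic. One of
  -- these regions contains a neighbourhood of infinity.
  have hDs : HasCompactSupport D := by
    rcases hG'b with ⟨hb, -⟩ | ⟨hb, -⟩
    · exact HasCompactSupport.intro (hb.isCompact_closure)
        fun ζ hζ => hDout ζ fun h => hζ (subset_closure h)
    · obtain ⟨t, ht, htK⟩ := mem_cocompact.mp hb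
      exact HasCompactSupport.intro ht fun ζ hζ => (hDin ζ (htK hζ)).self_of_nhds
  have hlim : Tendsto F (cocompact ℂ) (𝓝 c) := by
    rcases hG'b with ⟨hb, hc⟩ | ⟨hb, hlim⟩
    · rw [hc]
      refine tendsto_const_nhds.congr' ?_
      filter_upwards [hb.isCompact_closure.compl_mem_cocompact] with ζ hζ
      exact ((hFout ζ fun h => hζ (subset_closure h)).self_of_nhds).symm
    · refine hlim.congr' ?_
      filter_upwards [hb] with ζ hζ using (hFin ζ hζ).self_of_nhds.symm
  refine ⟨fun ζ => (2 * Real.pi * Complex.I)⁻¹ * D ζ, continuous_const.mul hDc, hDs.mul_left, ?_,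
    fun z hz => ?_⟩
  · rw [Set.disjoint_right]
    intro z hz
    rw [notMem_tsupport_iff_eventuallyEq]
    filter_upwards [hDin z hz] with y hy
    simp [hy]
  · have := cauchyPompeiu (fun ζ => (hFc.differentiable one_ne_zero ζ).hasFDerivAt) hFcd hlim hDs
      (hDin z hz) ((hfd z hz).congr_of_eventuallyEq (hFin z hz))
    rwa [(hFin z hz).self_of_nhds] at this

/-- Fubini and the partial fractions 1/((s − z)(s − ζ)) = (1/(s − ζ) − 1/(s − z))/(ζ − z) express
the transform of f a through the transform of a alone. The point z may lie in the support of ν; the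
single value ζ = z is negligible. -/
theorem cauchyTransform_mul_of_representation {γ a : ℝ → ℂ} {x y : ℝ} (hγ : Continuous γ)
    (hxy : x ≤ y) (ha : IntervalIntegrable a MeasureTheory.volume x y) {K : Set ℂ}
    (hK : γ '' Icc x y ⊆ K) {f ν : ℂ → ℂ} {c : ℂ} (hν : Continuous ν) (hνs : HasCompactSupport ν)
    (hνK : Disjoint (tsupport ν) K) (hrep : ∀ z ∈ K, f z = c + ∫ ζ, ν ζ / (z - ζ)) {z : ℂ}
    (hz : z ∉ γ '' Icc x y) :
    cauchyTransform γ (fun t => f (γ t) * a t) x y z = c * cauchyTransform γ a x y z +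
      ∫ ζ, ν ζ / (ζ - z) * (cauchyTransform γ a x y ζ - cauchyTransform γ a x y z) := by
  have hint := intervalIntegrable_cauchy hγ hxy ha hz
  set k : ℝ → ℂ → ℂ := fun t ζ => (γ t - z)⁻¹ * (ν ζ * (γ t - ζ)⁻¹) with hk
  have hmeas : Measurable fun p : ℝ × ℂ => k p.1 p.2 := by
    have h1 := hγ.measurable
    have h2 := hν.measurable
    fun_prop
  have hsupp : ∀ ζ ∈ tsupport ν, ζ ∉ γ '' Icc x y := fun ζ hζ h =>
    (Set.disjoint_left.mp hνK) hζ (hK h)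
  obtain ⟨B, hB⟩ := (isCompact_Icc.prod hνs.isCompact).exists_bound_of_continuousOn
    (s := Icc x y ×ˢ tsupport ν) (f := fun p : ℝ × ℂ => k p.1 p.2) (by
      have h1 : Continuous fun p : ℝ × ℂ => γ p.1 := hγ.comp continuous_fst
      have h2 : Continuous fun p : ℝ × ℂ => ν p.2 := hν.comp continuous_snd
      refine ContinuousOn.mul ?_ (h2.continuousOn.mul ?_)
      · refine (h1.sub continuous_const).continuousOn.inv₀ fun p hp h0 => ?_
        exact hz ⟨p.1, hp.1, sub_eq_zero.mp h0⟩
      · refine (h1.sub continuous_snd).continuousOn.inv₀ fun p hp h0 => ?_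
        exact hsupp p.2 hp.2 ⟨p.1, hp.1, sub_eq_zero.mp h0⟩)
  have hprod : MeasureTheory.Integrable (Function.uncurry fun (t : ℝ) (ζ : ℂ) => k t ζ * a t)
      ((MeasureTheory.volume.restrict (Ioc x y)).prod MeasureTheory.volume) := by
    have ha' : MeasureTheory.Integrable a (MeasureTheory.volume.restrict (Ioc x y)) :=
      (intervalIntegrable_iff_integrableOn_Ioc_of_le hxy).mp ha
    have hind : MeasureTheory.Integrable ((tsupport ν).indicator fun _ => (B : ℝ)) :=
      (MeasureTheory.integrable_indicator_iff (isClosed_tsupport ν).measurableSet).mpr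
        (MeasureTheory.integrableOn_const hνs.isCompact.measure_lt_top.ne)
    refine (ha'.norm.mul_prod hind).mono'
      (hmeas.aestronglyMeasurable.mul ha'.aestronglyMeasurable.comp_fst) ?_
    have hae : ∀ᵐ p ∂((MeasureTheory.volume.restrict (Ioc x y)).prod
        (MeasureTheory.volume : MeasureTheory.Measure ℂ)), p.1 ∈ Ioc x y :=
      MeasureTheory.Measure.quasiMeasurePreserving_fst.ae
        (MeasureTheory.ae_restrict_mem measurableSet_Ioc)
    filter_upwards [hae] with p hp
    rw [Function.uncurry, norm_mul, mul_comm]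
    by_cases hpν : p.2 ∈ tsupport ν
    · rw [indicator_of_mem hpν]
      have := hB p ⟨Ioc_subset_Icc_self hp, hpν⟩
      gcongr
    · rw [indicator_of_notMem hpν, hk]
      simp [image_eq_zero_of_notMem_tsupport hpν]
  have hlhs : cauchyTransform γ (fun t => f (γ t) * a t) x y z =
      c * cauchyTransform γ a x y z + ∫ t in x..y, ∫ ζ, k t ζ * a t := by
    unfold cauchyTransform
    have hin : IntervalIntegrable (fun t => ∫ ζ, k t ζ * a t) MeasureTheory.volume x y :=
      (intervalIntegrable_iff_integrableOn_Ioc_of_le hxy).mpr hprod.integral_prod_left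
    rw [← intervalIntegral.integral_const_mul,
      ← intervalIntegral.integral_add (hint.const_mul c) hin]
    refine intervalIntegral.integral_congr fun t ht => ?_
    rw [uIcc_of_le hxy] at ht
    simp only [hk]
    rw [hrep (γ t) (hK ⟨t, ht, rfl⟩), MeasureTheory.integral_mul_const,
      MeasureTheory.integral_const_mul]
    simp only [div_eq_mul_inv]
    ring
  rw [hlhs, intervalIntegral.integral_of_le hxy, MeasureTheory.integral_integral_swap hprod]
  congr 1
  refine MeasureTheory.integral_congr_ae ?_
  have hne : ∀ᵐ ζ : ℂ, ζ ≠ z := by simp [MeasureTheory.ae_iff]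
  filter_upwards [hne] with ζ hζ
  by_cases hζν : ζ ∈ tsupport ν
  · rw [← intervalIntegral.integral_of_le hxy]
    unfold cauchyTransform
    rw [← intervalIntegral.integral_sub (intervalIntegrable_cauchy hγ hxy ha (hsupp ζ hζν)) hint,
      ← intervalIntegral.integral_const_mul]
    refine intervalIntegral.integral_congr fun t ht => ?_
    rw [uIcc_of_le hxy] at ht
    have h1 : γ t - ζ ≠ 0 := fun h0 => hsupp ζ hζν ⟨t, ht, sub_eq_zero.mp h0⟩
    have h2 : γ t - z ≠ 0 := fun h0 => hz ⟨t, ht, sub_eq_zero.mp h0⟩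
    have h3 : ζ - z ≠ 0 := sub_ne_zero.mpr hζ
    simp only [hk]
    field_simp
    ring
  · simp [hk, image_eq_zero_of_notMem_tsupport hζν]

/-! ### Functions of the form `∫ ρ(s) / (s - z) ds / w_+(s)` for two arcs -/

/-- Comparison of the Cauchy integrals over two arcs with common endpoints: the density is analytic
on a closed set that contains the arcs and the points where the branches of the square root
differ by the sign `-σ`. -/
theorem cauchyTransform_traceDensity_sub {γ₁ γ₂ : ℝ → ℂ} (h₁ : IsRegularArc γ₁)
    (h₂ : IsRegularArc γ₂) (i₁ : IntervalIntegrable (traceDensity γ₁) MeasureTheory.volume 0 1)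
    (i₂ : IntervalIntegrable (traceDensity γ₂) MeasureTheory.volume 0 1) {σ : ℂ} (hσ : σ * σ = 1)
    {G K : Set ℂ} (hG : IsOpen G) (hK : IsClosed K) (hKG : K ⊆ G) {ρ : ℂ → ℂ}
    (hρ : DifferentiableOn ℂ ρ G) {c : ℂ}
    (hc : (IsCompact K ∧ c = 0) ∨ (K ∈ cocompact ℂ ∧ Tendsto ρ (cocompact ℂ) (𝓝 c)))
    (hK₁ : arcSet γ₁ ⊆ K) (hK₂ : arcSet γ₂ ⊆ K)
    (hKσ : ∀ z, z ∉ arcSet γ₁ → z ∉ arcSet γ₂ → wBranch γ₁ z = -σ * wBranch γ₂ z → z ∈ K) {z : ℂ}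
    (hz₁ : z ∉ arcSet γ₁) (hz₂ : z ∉ arcSet γ₂) :
    (wBranch γ₁ z = σ * wBranch γ₂ z →
      σ * cauchyTransform γ₂ (fun t => ρ (γ₂ t) * traceDensity γ₂ t) 0 1 z =
        cauchyTransform γ₁ (fun t => ρ (γ₁ t) * traceDensity γ₁ t) 0 1 z) ∧
    (wBranch γ₁ z = -σ * wBranch γ₂ z →
      σ * cauchyTransform γ₂ (fun t => ρ (γ₂ t) * traceDensity γ₂ t) 0 1 z =
        cauchyTransform γ₁ (fun t => ρ (γ₁ t) * traceDensity γ₁ t) 0 1 z +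
          2 * Real.pi * Complex.I * (σ * (ρ z / wBranch γ₂ z))) := by
  obtain ⟨ν, hν, hνs, hνK, hrep⟩ := exists_cauchy_representation hG hK hKG hρ hc
  have r₁ := cauchyTransform_mul_of_representation h₁.contDiff.continuous zero_le_one i₁ hK₁ hν hνs
    hνK hrep hz₁
  have r₂ := cauchyTransform_mul_of_representation h₂.contDiff.continuous zero_le_one i₂ hK₂ hν hνs
    hνK hrep hz₂
  set C₁ := cauchyTransform γ₁ (traceDensity γ₁) 0 1 with hC₁
  set C₂ := cauchyTransform γ₂ (traceDensity γ₂) 0 1 with hC₂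
  have v₁ : ∀ z ∉ arcSet γ₁, C₁ z = Real.pi * Complex.I / wBranch γ₁ z := fun z hz =>
    h₁.cauchyTransform_traceDensity i₁ hz
  have v₂ : ∀ z ∉ arcSet γ₂, C₂ z = Real.pi * Complex.I / wBranch γ₂ z := fun z hz =>
    h₂.cauchyTransform_traceDensity i₂ hz
  have hσ0 : σ ≠ 0 := left_ne_zero_of_mul_eq_one hσ
  have eqPlus : ∀ z, z ∉ arcSet γ₁ → z ∉ arcSet γ₂ → wBranch γ₁ z = σ * wBranch γ₂ z →
      C₁ z = σ * C₂ z := fun z hz1 hz2 hw => by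
    have := h₂.wBranch_ne_zero hz2
    rw [v₁ z hz1, v₂ z hz2, hw]
    field_simp
    linear_combination -hσ
  -- The poles of the representation avoid K, which contains all points with w₁ = −σ w₂. At the
  -- poles the square roots thus agree up to σ, and so do the transforms πi/w.
  have hsupp : ∀ ζ ∈ tsupport ν, ζ ∉ arcSet γ₁ ∧ ζ ∉ arcSet γ₂ ∧ C₁ ζ = σ * C₂ ζ := by
    intro ζ hζ
    have hζK : ζ ∉ K := Set.disjoint_left.mp hνK hζ
    have n₁ : ζ ∉ arcSet γ₁ := fun h => hζK (hK₁ h)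
    have n₂ : ζ ∉ arcSet γ₂ := fun h => hζK (hK₂ h)
    refine ⟨n₁, n₂, eqPlus ζ n₁ n₂ ?_⟩
    have hsq : (wBranch γ₁ ζ - σ * wBranch γ₂ ζ) * (wBranch γ₁ ζ + σ * wBranch γ₂ ζ) = 0 := by
      have e₁ := h₁.wBranch_sq n₁
      have e₂ := h₂.wBranch_sq n₂
      linear_combination e₁ - e₂ - wBranch γ₂ ζ ^ 2 * hσ
    rcases mul_eq_zero.mp hsq with h | h
    · exact sub_eq_zero.mp h
    · exact absurd (hKσ ζ n₁ n₂ (by linear_combination h)) hζK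
  rw [r₁, r₂, mul_add, ← MeasureTheory.integral_const_mul]
  refine ⟨fun hw => ?_, fun hw => ?_⟩
  · have e := eqPlus z hz₁ hz₂ hw
    congr 1
    · rw [e]; ring
    · congr 1
      ext ζ
      by_cases hζ : ζ ∈ tsupport ν
      · rw [(hsupp ζ hζ).2.2, e]; ring
      · simp [image_eq_zero_of_notMem_tsupport hζ]
  · have hw0 := h₂.wBranch_ne_zero hz₂
    have e : C₁ z = -(σ * C₂ z) := by
      rw [v₁ z hz₁, v₂ z hz₂, hw]
      field_simp
      linear_combination hσ
    have hzK := hrep z (hKσ z hz₁ hz₂ hw)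
    -- Here the transforms satisfy C₁ = σ C₂ at the poles but C₁ = −σ C₂ at z. The surplus
    -- integrates to 2σ C₂(z)(ρ(z) − c). Together with the terms in c this leaves 2σ C₂(z) ρ(z) =
    -- 2πi σ ρ(z)/w₂(z).
    have hpt : ∀ ζ, σ * (ν ζ / (ζ - z) * (C₂ ζ - C₂ z)) =
        ν ζ / (ζ - z) * (C₁ ζ - C₁ z) + 2 * (σ * C₂ z) * (ν ζ / (z - ζ)) := by
      intro ζ
      rw [← neg_sub ζ z, div_neg]
      by_cases hζ : ζ ∈ tsupport ν
      · rw [(hsupp ζ hζ).2.2, e]; ring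
      · simp [image_eq_zero_of_notMem_tsupport hζ]
    have hi : ∀ u : ℂ → ℂ, ContinuousOn u (tsupport ν) →
        MeasureTheory.Integrable fun ζ => ν ζ * u ζ := by
      intro u hu
      have h1 : MeasureTheory.IntegrableOn (fun ζ => ν ζ * u ζ) (tsupport ν) :=
        (hν.continuousOn.mul hu).integrableOn_compact hνs.isCompact
      refine (MeasureTheory.integrableOn_iff_integrable_of_support_subset ?_).mp h1
      intro ζ hζ
      exact subset_tsupport ν (left_ne_zero_of_mul hζ)
    have hzν : z ∉ tsupport ν := fun h => (Set.disjoint_left.mp hνK) h (hKσ z hz₁ hz₂ hw)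
    have i1 : MeasureTheory.Integrable fun ζ => ν ζ / (ζ - z) * (C₁ ζ - C₁ z) := by
      have := hi (fun ζ => (ζ - z)⁻¹ * (C₁ ζ - C₁ z)) ?_
      · simpa only [div_eq_mul_inv, mul_assoc] using this
      · refine (continuousOn_inv_sub_const hzν).mul (ContinuousOn.sub ?_ continuousOn_const)
        exact (differentiableOn_cauchyTransform h₁.contDiff.continuous zero_le_one
          i₁).continuousOn.mono fun ζ hζ => (hsupp ζ hζ).1
    have i2 : MeasureTheory.Integrable fun ζ => ν ζ / (z - ζ) := by
      simpa only [div_eq_mul_inv] using hi (fun ζ => (z - ζ)⁻¹) (continuousOn_inv_const_sub hzν)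
    simp only [hpt]
    rw [MeasureTheory.integral_add i1 (i2.const_mul _), MeasureTheory.integral_const_mul, e, hzK,
      v₂ z hz₂]
    ring

/-! ### Closed curves -/

/-- The winding number of a closed curve of period `1`. -/
def windingNumber (γ : ℝ → ℂ) (z : ℂ) : ℂ :=
  (2 * Real.pi * Complex.I)⁻¹ * cauchyTransform γ (deriv γ) 0 1 z

namespace IsSmoothJordanCurve

variable {γ : ℝ → ℂ}

theorem image_Icc (h : IsSmoothJordanCurve γ) (x : ℝ) : γ '' Icc x (x + 1) = range γ :=
  h.periodic.image_Icc one_pos x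

theorem arcSet_eq (h : IsSmoothJordanCurve γ) : arcSet γ = range γ := by
  have := h.image_Icc 0
  rwa [zero_add] at this

theorem isCompact_range (h : IsSmoothJordanCurve γ) : IsCompact (range γ) :=
  h.arcSet_eq ▸ isCompact_arcSet h.contDiff

theorem deriv_periodic (h : IsSmoothJordanCurve γ) : Function.Periodic (deriv γ) 1 := fun t => by
  rw [← deriv_comp_add_const]
  congr 1
  ext u
  exact h.periodic u

theorem cauchyTransform_shift (h : IsSmoothJordanCurve γ) (x : ℝ) (z : ℂ) :
    cauchyTransform γ (deriv γ) x (x + 1) z = cauchyTransform γ (deriv γ) 0 1 z := by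
  have hp : Function.Periodic (fun t => (γ t - z)⁻¹ * deriv γ t) 1 := fun t => by
    simp only [h.periodic t, h.deriv_periodic t]
  have := hp.intervalIntegral_add_eq x 0
  rwa [zero_add] at this

/-- The period interval is centred at t₀, so its identified endpoints do not interfere with
injectivity at t₀. -/
theorem eq_of_mem_Icc (h : IsSmoothJordanCurve γ) {t t₀ : ℝ}
    (ht : t ∈ Icc (t₀ - 1 / 2) (t₀ - 1 / 2 + 1)) (he : γ t = γ t₀) : t = t₀ := by
  have hf : ∀ u, γ (Int.fract u) = γ u := fun u => by
    have := h.periodic.sub_zsmul_eq (x := u) ⌊u⌋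
    rwa [zsmul_one] at this
  have h1 : Int.fract t = Int.fract t₀ := h.injOn ⟨Int.fract_nonneg _, Int.fract_lt_one _⟩
    ⟨Int.fract_nonneg _, Int.fract_lt_one _⟩ (by rw [hf, hf, he])
  obtain ⟨n, hn⟩ := Int.fract_eq_fract.mp h1
  have h2 : (n : ℝ) < 1 := by linarith [ht.2]
  have h3 : (-1 : ℝ) < n := by linarith [ht.1]
  have h4 : n < 1 := by exact_mod_cast h2
  have h5 : -1 < n := by exact_mod_cast h3
  have : n = 0 := by omega
  rw [this, Int.cast_zero] at hn
  linarith

theorem exp_cauchyTransform (h : IsSmoothJordanCurve γ) {z : ℂ} (hz : z ∉ range γ) :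
    Complex.exp (cauchyTransform γ (deriv γ) 0 1 z) = 1 := by
  rw [← h.arcSet_eq] at hz
  rw [exp_cauchyTransform_deriv h.contDiff zero_le_one hz]
  have h1 : γ 1 = γ 0 := by simpa using h.periodic 0
  rw [h1, div_self]
  intro h0
  exact hz ⟨0, by simp, sub_eq_zero.mp h0⟩

theorem continuousAt_cauchyTransform (h : IsSmoothJordanCurve γ) {z : ℂ} (hz : z ∉ range γ) :
    ContinuousAt (cauchyTransform γ (deriv γ) 0 1) z := by
  rw [← h.arcSet_eq] at hz
  exact (hasDerivAt_cauchyTransform h.contDiff.continuous zero_le_one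
    (intervalIntegrable_deriv h.contDiff) hz).continuousAt

theorem windingNumber_locallyConstant (h : IsSmoothJordanCurve γ) {z : ℂ} (hz : z ∉ range γ) :
    ∀ᶠ y in 𝓝 z, windingNumber γ y = windingNumber γ z := by
  have := eventually_eq_of_exp_eq (h.continuousAt_cauchyTransform hz) (by
    filter_upwards [h.isCompact_range.isClosed.isOpen_compl.mem_nhds hz] with y hy
    exact h.exp_cauchyTransform hy)
  filter_upwards [this] with y hy
  rw [windingNumber, windingNumber, hy]

/-- The integral is a multiple of 2πi and tends to 0 at infinity. -/
theorem windingNumber_cocompact (h : IsSmoothJordanCurve γ) :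
    ∀ᶠ z in cocompact ℂ, windingNumber γ z = 0 := by
  have h1 := (tendsto_cauchyTransform_cocompact (γ := γ) h.contDiff.continuous zero_le_one
    (intervalIntegrable_deriv h.contDiff)).eventually (Metric.ball_mem_nhds 0 one_pos)
  filter_upwards [h1, h.isCompact_range.compl_mem_cocompact] with z hz hzr
  have he := h.exp_cauchyTransform hzr
  obtain ⟨n, hn⟩ := Complex.exp_eq_one_iff.mp he
  rw [hn, dist_zero_right, norm_mul, Complex.norm_intCast] at hz
  have hpi : ‖2 * (Real.pi : ℂ) * Complex.I‖ = 2 * Real.pi := by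
    simp [abs_of_pos Real.pi_pos]
  rw [hpi] at hz
  have hn0 : n = 0 := by
    by_contra hne
    have h2 : (1 : ℝ) ≤ |(n : ℝ)| := by exact_mod_cast Int.one_le_abs hne
    nlinarith [Real.pi_gt_three]
  rw [windingNumber, hn, hn0]
  simp

/-- The winding number jumps by `1` from the right to the left of the curve. -/
theorem exists_sides (h : IsSmoothJordanCurve γ) (t₀ : ℝ) {Ω : Set ℂ} (hΩ : Ω ∈ 𝓝 (γ t₀)) :
    ∃ (P N : Set ℂ) (m : ℂ), LocalSides γ (range γ) t₀ P N ∧ P ⊆ Ω ∧ N ⊆ Ω ∧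
      (∀ z ∈ P, windingNumber γ z = m) ∧ ∀ z ∈ N, windingNumber γ z = m - 1 := by
  obtain ⟨P, N, lam, hPN, hPΩ, hNΩ, hd, hP, hN⟩ := exists_localSides h.contDiff
    (x := t₀ - 1 / 2) (y := t₀ - 1 / 2 + 1) ⟨by linarith, by linarith⟩ (h.deriv_ne t₀)
    (fun t ht he => h.eq_of_mem_Icc ht he) hΩ
  rw [h.image_Icc] at hPN
  simp only [h.cauchyTransform_shift] at hP hN
  have hpi : (2 * Real.pi * Complex.I : ℂ) ≠ 0 := Complex.two_pi_I_ne_zero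
  have hl := hPN.left_mem.self_of_nhds
  have hr := hPN.right_mem.self_of_nhds
  obtain ⟨ε₁, h1⟩ := hl.exists
  obtain ⟨ε₂, h2⟩ := hr.exists
  have hcP : ∀ z ∈ P, windingNumber γ z = windingNumber γ _ := fun z hz =>
    eq_of_isPreconnected hPN.preconnected_left
      (fun y hy => h.windingNumber_locallyConstant (hPN.left_subset hy)) hz h1
  have hcN : ∀ z ∈ N, windingNumber γ z = windingNumber γ _ := fun z hz =>
    eq_of_isPreconnected hPN.preconnected_right
      (fun y hy => h.windingNumber_locallyConstant (hPN.right_subset hy)) hz h2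
  refine ⟨P, N, _, hPN, hPΩ, hNΩ, hcP, fun z hz => ?_⟩
  rw [hcN z hz]
  set mP := windingNumber γ (γ t₀ + ε₁ * (Complex.I * deriv γ t₀))
  set mN := windingNumber γ (γ t₀ - ε₂ * (Complex.I * deriv γ t₀))
  have hc := hd.self_of_nhds.continuousAt.tendsto.const_mul (2 * Real.pi * Complex.I : ℂ)⁻¹
  have lP := hc.comp (tendsto_left_normal γ t₀)
  have lN := hc.comp (tendsto_right_normal γ t₀)
  have eP := tendsto_nhds_unique lP ((tendsto_const_nhds (x := mP)).congr' (by
    filter_upwards [hl] with ε hε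
    simp only [Function.comp_apply]
    rw [← hcP _ hε, windingNumber, hP _ hε]))
  have eN := tendsto_nhds_unique lN ((tendsto_const_nhds (x := mN + 1)).congr' (by
    filter_upwards [hr] with ε hε
    simp only [Function.comp_apply]
    rw [← hcN _ hε, windingNumber, hN _ hε]
    field_simp
    ring))
  rw [eP] at eN
  linear_combination -eN

/-- An unbounded component reaches the neighbourhood of infinity on which the winding number
vanishes. -/
theorem windingNumber_eq_zero (h : IsSmoothJordanCurve γ) {z : ℂ} (hz : z ∉ range γ)
    (hz' : z ∉ curveInterior (range γ)) : windingNumber γ z = 0 := by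
  have hub : ¬ Bornology.IsBounded (connectedComponentIn (range γ)ᶜ z) := fun hb => hz' ⟨hz, hb⟩
  obtain ⟨t, ht, htz⟩ := mem_cocompact.mp h.windingNumber_cocompact
  obtain ⟨y, hy, hyt⟩ : ∃ y ∈ connectedComponentIn (range γ)ᶜ z, y ∉ t := by
    by_contra! hcon
    exact hub (ht.isBounded.subset hcon)
  have := eq_of_isPreconnected (f := windingNumber γ) isPreconnected_connectedComponentIn
    (fun u hu => h.windingNumber_locallyConstant (connectedComponentIn_subset _ _ hu)) hy
    (mem_connectedComponentIn hz)
  rw [← this]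
  exact htz hyt

/-- The winding numbers m and m − 1 on the two sides are not both zero, so at least one side lies in
the interior. The Jordan curve theorem is not used. -/
theorem range_subset_closure (h : IsSmoothJordanCurve γ) :
    range γ ⊆ closure (curveInterior (range γ)) := by
  rintro _ ⟨t, rfl⟩
  obtain ⟨P, N, m, hPN, -, -, hP, hN⟩ := h.exists_sides t univ_mem
  have hmem : ∀ z ∉ range γ, windingNumber γ z ≠ 0 → z ∈ curveInterior (range γ) := by
    intro z hz hne
    by_contra hcon
    exact hne (h.windingNumber_eq_zero hz hcon)
  by_cases hm : m = 0
  · refine mem_closure_of_tendsto (tendsto_right_normal γ t) ?_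
    filter_upwards [hPN.right_mem.self_of_nhds] with ε hε
    exact hmem _ (hPN.right_subset hε) (by rw [hN _ hε, hm]; simp)
  · refine mem_closure_of_tendsto (tendsto_left_normal γ t) ?_
    filter_upwards [hPN.left_mem.self_of_nhds] with ε hε
    exact hmem _ (hPN.left_subset hε) (by rwa [hP _ hε])

end IsSmoothJordanCurve

theorem closure_curveInterior_subset {C : Set ℂ} (hC : IsClosed C) :
    closure (curveInterior C) ⊆ curveInterior C ∪ C := by
  intro z hz
  by_contra hcon
  rw [mem_union, not_or] at hcon
  have hopen : IsOpen (connectedComponentIn Cᶜ z) := hC.isOpen_compl.connectedComponentIn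
  obtain ⟨y, hy, hyI⟩ := mem_closure_iff.mp hz _ hopen (mem_connectedComponentIn hcon.2)
  exact hcon.1 ⟨hcon.2, connectedComponentIn_eq hy ▸ hyI.2⟩

/-- From a point outside a ball around C the radial ray escapes to infinity without meeting C, so
the component of that point is unbounded. -/
theorem isBounded_curveInterior {C : Set ℂ} (hC : IsCompact C) :
    Bornology.IsBounded (curveInterior C) := by
  obtain ⟨R, hR⟩ := hC.isBounded.subset_closedBall (0 : ℂ)
  refine (Metric.isBounded_closedBall (x := (0 : ℂ)) (r := max R 0)).subset fun z hz => ?_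
  by_contra hzR
  rw [mem_closedBall_zero_iff, not_le, max_lt_iff] at hzR
  have hray : (fun s : ℝ => (s : ℂ) * z) '' Ici 1 ⊆ connectedComponentIn Cᶜ z := by
    refine IsPreconnected.subset_connectedComponentIn
      (isPreconnected_Ici.image _ (by fun_prop)) ⟨1, by simp, by simp⟩ ?_
    rintro _ ⟨s, hs, rfl⟩ hsC
    have h1 := hR hsC
    have hs1 : (1 : ℝ) ≤ s := hs
    rw [mem_closedBall_zero_iff, norm_mul, Complex.norm_real, Real.norm_of_nonneg (by linarith)]
      at h1
    nlinarith
  obtain ⟨B, hB⟩ := hz.2.exists_norm_le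
  have hB0 : ‖z‖ ≤ B := hB z (mem_connectedComponentIn hz.1)
  have h3 : 0 ≤ B / ‖z‖ := div_nonneg ((norm_nonneg _).trans hB0) (norm_nonneg _)
  have h2 := hB _ (hray ⟨B / ‖z‖ + 1, by simpa using h3, rfl⟩)
  rw [norm_mul, Complex.norm_real, Real.norm_of_nonneg (by linarith), add_mul,
    div_mul_cancel₀ _ hzR.2.ne'] at h2
  linarith [hzR.2]

namespace IsSmoothJordanCurve

variable {γ : ℝ → ℂ}

/-- Cauchy's integral formula for a smooth Jordan curve. -/
theorem cauchyTransform_mul_deriv (h : IsSmoothJordanCurve γ) {G : Set ℂ} (hG : IsOpen G)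
    (hGγ : closure (curveInterior (range γ)) ⊆ G) {f : ℂ → ℂ} (hf : DifferentiableOn ℂ f G) {z : ℂ}
    (hz : z ∉ range γ) :
    cauchyTransform γ (fun t => f (γ t) * deriv γ t) 0 1 z =
      2 * Real.pi * Complex.I * (windingNumber γ z * f z) := by
  set K := closure (curveInterior (range γ)) with hK
  have hKc : IsCompact K := (isBounded_curveInterior h.isCompact_range).isCompact_closure
  obtain ⟨ν, hν, hνs, hνK, hrep⟩ := exists_cauchy_representation hG isClosed_closure hGγ hf
    (Or.inl ⟨hKc, rfl⟩)
  have hpi : (2 * Real.pi * Complex.I : ℂ) ≠ 0 := Complex.two_pi_I_ne_zero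
  -- The poles of the representation of f lie outside the curve. Only the value of the logarithmic
  -- integral at z remains, multiplied by the representation of f(z).
  have hout : ∀ ζ ∉ K, cauchyTransform γ (deriv γ) 0 1 ζ = 0 := fun ζ hζ => by
    have := h.windingNumber_eq_zero (fun h' => hζ (h.range_subset_closure h'))
      fun h' => hζ (subset_closure h')
    rw [windingNumber] at this
    exact (mul_eq_zero.mp this).resolve_left (inv_ne_zero hpi)
  have himg : γ '' Icc 0 1 = range γ := h.arcSet_eq
  rw [cauchyTransform_mul_of_representation h.contDiff.continuous zero_le_one
    (intervalIntegrable_deriv h.contDiff) (himg ▸ h.range_subset_closure) hν hνs hνK hrep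
    (himg ▸ hz), zero_mul, zero_add]
  set ℓ := cauchyTransform γ (deriv γ) 0 1
  have hpt : ∀ ζ, ν ζ / (ζ - z) * (ℓ ζ - ℓ z) = ℓ z * (ν ζ / (z - ζ)) := by
    intro ζ
    rw [← neg_sub ζ z, div_neg]
    by_cases hζ : ζ ∈ tsupport ν
    · rw [hout ζ (Set.disjoint_left.mp hνK hζ)]; ring
    · simp [image_eq_zero_of_notMem_tsupport hζ]
  simp only [hpt]
  rw [MeasureTheory.integral_const_mul, windingNumber]
  by_cases hzK : z ∈ K
  · rw [hrep z hzK, zero_add, ← mul_assoc, ← mul_assoc, mul_inv_cancel₀ hpi, one_mul]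
  · simp only [ℓ, hout z hzK]; ring

end IsSmoothJordanCurve

/-! ### The Joukovski map -/

theorem joukovski_inv (ζ : ℂ) : joukovski ζ⁻¹ = joukovski ζ := by
  simp only [joukovski, inv_inv, add_comm]

theorem joukovski_eq_iff {ζ τ : ℂ} (hζ : ζ ≠ 0) (hτ : τ ≠ 0) :
    joukovski ζ = joukovski τ ↔ ζ = τ ∨ ζ = τ⁻¹ := by
  constructor
  · intro h
    have h1 : (ζ - τ) * (ζ * τ - 1) = 0 := by
      simp only [joukovski] at h
      field_simp at h
      linear_combination h
    rcases mul_eq_zero.mp h1 with h2 | h2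
    · exact Or.inl (sub_eq_zero.mp h2)
    · exact Or.inr (eq_inv_of_mul_eq_one_left (sub_eq_zero.mp h2))
  · rintro (rfl | rfl)
    · rfl
    · exact joukovski_inv τ

theorem hasDerivAt_joukovski {ζ : ℂ} (hζ : ζ ≠ 0) :
    HasDerivAt joukovski ((1 - (ζ ^ 2)⁻¹) / 2) ζ :=
  (((hasDerivAt_id ζ).add (hasDerivAt_inv hζ)).div_const 2).congr_deriv (by ring)

theorem contDiff_joukovski_comp {γ : ℝ → ℂ} (hγ : ContDiff ℝ 1 γ) (h0 : ∀ t, γ t ≠ 0) :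
    ContDiff ℝ 1 fun t => joukovski (γ t) := (hγ.add (hγ.inv h0)).div_const 2

theorem joukovski_deriv_ne_zero {ζ : ℂ} (h1 : ζ ^ 2 ≠ 1) :
    (1 - (ζ ^ 2)⁻¹) / 2 ≠ 0 := by
  intro h
  have h2 : 1 - (ζ ^ 2)⁻¹ = 0 := by simpa using h
  exact h1 (inv_eq_one.mp (sub_eq_zero.mp h2).symm)

theorem joukovski_sq_sub_one {ζ : ℂ} (hζ : ζ ≠ 0) :
    joukovski ζ ^ 2 - 1 = ((ζ - ζ⁻¹) / 2) ^ 2 := by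
  simp only [joukovski]
  field_simp
  ring

theorem phi_coe (γ : ℝ → ℂ) (z : ℂ) : phi γ z = z - wBranch γ z := rfl

namespace IsRegularArc

variable {γ : ℝ → ℂ}

theorem phi_mul (h : IsRegularArc γ) {z : ℂ} (hz : z ∉ arcSet γ) :
    (z - wBranch γ z) * (z + wBranch γ z) = 1 := by
  linear_combination -h.wBranch_sq hz

theorem phi_ne_zero (h : IsRegularArc γ) {z : ℂ} (hz : z ∉ arcSet γ) : phi γ z ≠ 0 :=
  left_ne_zero_of_mul_eq_one (h.phi_mul hz)

theorem inv_phi (h : IsRegularArc γ) {z : ℂ} (hz : z ∉ arcSet γ) :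
    (phi γ z)⁻¹ = z + wBranch γ z :=
  (eq_inv_of_mul_eq_one_right (h.phi_mul hz)).symm

theorem joukovski_phi (h : IsRegularArc γ) {z : ℂ} (hz : z ∉ arcSet γ) :
    joukovski (phi γ z) = z := by
  rw [joukovski, h.inv_phi hz, phi_coe]
  ring

end IsRegularArc

/-! ### The involution `τ ↦ 1 / τ` of a Jordan curve through `±1` -/

/-- This is applied to either half of Γ_0, to see that inversion exchanges the halves. If one
interior point had its inverse in the same half, connectedness would give this for all of them.
Inversion would then act on the interior of the half as a continuous involution of an interval, and
its fixed point would satisfy ζ² = 1. -/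
theorem inv_notMem_image {g : ℝ → ℂ} (hg : Continuous g) {a b : ℝ}
    (hinj : InjOn g (Icc a b)) {C : Set ℂ} (hC : IsClosed C) (h0 : ∀ t, g t ≠ 0)
    (hcov : ∀ u ∈ Ioo a b, (g u)⁻¹ ∈ g '' Icc a b ∨ (g u)⁻¹ ∈ C)
    (hcap : ∀ ζ ∈ g '' Icc a b, ζ ∈ C → ζ ^ 2 = 1) (hne : ∀ u ∈ Ioo a b, g u ^ 2 ≠ 1)
    (hend : g a ^ 2 = 1 ∧ g b ^ 2 = 1) {t : ℝ} (ht : t ∈ Ioo a b) : (g t)⁻¹ ∉ g '' Icc a b := by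
  rintro ⟨t', ht', hgt⟩
  have hinv : Continuous fun u => (g u)⁻¹ := hg.inv₀ h0
  have hcl : IsClosed (g '' Icc a b) := isClosed_image_Icc hg
  have hne' : ∀ u ∈ Ioo a b, ((g u)⁻¹) ^ 2 ≠ 1 := fun u hu h => hne u hu (by
    rwa [inv_pow, inv_eq_one] at h)
  have hall : ∀ u ∈ Ioo a b, (g u)⁻¹ ∈ g '' Icc a b := by
    intro u hu
    by_contra hcon
    obtain ⟨v, hv, hv1, hv2⟩ := isPreconnected_closed_iff.mp (isPreconnected_Ioo (a := a) (b := b))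
      _ _ (hcl.preimage hinv) (hC.preimage hinv) hcov ⟨t, ht, t', ht', hgt⟩
      ⟨u, hu, (hcov u hu).resolve_left hcon⟩
    exact hne' v hv (hcap _ hv1 hv2)
  have ht'' : t' ∈ Ioo a b := by
    refine ⟨lt_of_le_of_ne ht'.1 ?_, lt_of_le_of_ne ht'.2 ?_⟩
    · rintro rfl; exact hne' t ht (hgt ▸ hend.1)
    · rintro rfl; exact hne' t ht (hgt ▸ hend.2)
  -- A and B collect the parameters whose partner lies weakly before, respectively after, them. Both
  -- are closed, they cover the interval, and t and its partner t' show that both meet it. A common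
  -- point is its own partner.
  set A : Set ℝ := Prod.snd '' ((Icc a b ×ˢ Icc a b) ∩ {p : ℝ × ℝ | p.1 ≤ p.2 ∧ g p.1 * g p.2 = 1})
    with hA
  set B : Set ℝ := Prod.snd '' ((Icc a b ×ˢ Icc a b) ∩ {p : ℝ × ℝ | p.2 ≤ p.1 ∧ g p.1 * g p.2 = 1})
    with hB
  have hmul : IsClosed {p : ℝ × ℝ | g p.1 * g p.2 = 1} :=
    isClosed_eq (by fun_prop) continuous_const
  have hAc : IsClosed A := (((isCompact_Icc.prod isCompact_Icc).inter_right
    ((isClosed_le continuous_fst continuous_snd).inter hmul)).image continuous_snd).isClosed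
  have hBc : IsClosed B := (((isCompact_Icc.prod isCompact_Icc).inter_right
    ((isClosed_le continuous_snd continuous_fst).inter hmul)).image continuous_snd).isClosed
  have hmem : ∀ u ∈ Ioo a b, ∀ s ∈ Icc a b, g s * g u = 1 → (s ≤ u → u ∈ A) ∧ (u ≤ s → u ∈ B) :=
    fun u hu s hs h => ⟨fun hle => ⟨(s, u), ⟨⟨hs, Ioo_subset_Icc_self hu⟩, hle, h⟩, rfl⟩,
      fun hle => ⟨(s, u), ⟨⟨hs, Ioo_subset_Icc_self hu⟩, hle, h⟩, rfl⟩⟩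
  have hcovAB : Ioo a b ⊆ A ∪ B := by
    intro u hu
    obtain ⟨s, hs, h⟩ := hall u hu
    have h1 : g s * g u = 1 := by rw [h, inv_mul_cancel₀ (h0 u)]
    rcases le_total s u with hle | hle
    · exact Or.inl ((hmem u hu s hs h1).1 hle)
    · exact Or.inr ((hmem u hu s hs h1).2 hle)
  have h1 : g t' * g t = 1 := by rw [hgt, inv_mul_cancel₀ (h0 t)]
  have h2 : g t * g t' = 1 := by rw [mul_comm, h1]
  have hAB : (Ioo a b ∩ A).Nonempty ∧ (Ioo a b ∩ B).Nonempty := by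
    rcases le_total t' t with hle | hle
    · exact ⟨⟨t, ht, (hmem t ht t' ht' h1).1 hle⟩,
        ⟨t', ht'', (hmem t' ht'' t (Ioo_subset_Icc_self ht) h2).2 hle⟩⟩
    · exact ⟨⟨t', ht'', (hmem t' ht'' t (Ioo_subset_Icc_self ht) h2).1 hle⟩,
        ⟨t, ht, (hmem t ht t' ht' h1).2 hle⟩⟩
  obtain ⟨u, hu, ⟨p, ⟨hp, hp1, hp2⟩, hpu⟩, ⟨q, ⟨hq, hq1, hq2⟩, hqu⟩⟩ :=
    isPreconnected_closed_iff.mp (isPreconnected_Ioo (a := a) (b := b)) _ _ hAc hBc hcovAB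
      hAB.1 hAB.2
  subst hpu
  have hpq : p.1 = q.1 := by
    refine hinj hp.1 hq.1 (mul_right_cancel₀ (h0 p.2) ?_)
    rw [hp2, ← hqu, hq2]
  have hpp : p.1 = p.2 := le_antisymm hp1 (by rw [← hqu, hpq]; exact hq1)
  refine hne _ hu ?_
  rw [sq, ← hp2, hpp]

/-! ### Symmetric contours -/

namespace IsSymmetricContour

variable {L : ℝ → ℂ} {E : ℕ → Multiset (OnePoint ℂ)} {k : ℕ} {g : ℕ → ℝ → ℂ}

theorem ne_zero (h : IsSymmetricContour L E k g) {l : ℕ} (hl : l ≤ k) (t : ℝ) : g l t ≠ 0 :=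
  fun h0 => h.zero_notMem l hl ⟨t, h0⟩

theorem range_zero_eq (h : IsSymmetricContour L E k g) :
    range (g 0) = g 0 '' Icc 0 (1 / 2) ∪ g 0 '' Icc (1 / 2) 1 := by
  rw [← image_union, Icc_union_Icc_eq_Icc (by norm_num) (by norm_num)]
  exact (h.smooth 0 (Nat.zero_le _)).arcSet_eq.symm

theorem g_one (h : IsSymmetricContour L E k g) : g 0 1 = -1 := by
  have := (h.smooth 0 (Nat.zero_le _)).periodic 0
  rw [zero_add] at this
  rw [this, h.neg_one]

theorem injOn_left (h : IsSymmetricContour L E k g) : InjOn (g 0) (Icc 0 (1 / 2)) :=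
  (h.smooth 0 (Nat.zero_le _)).injOn.mono (Icc_subset_Ico_right (by norm_num))

theorem eq_of_mem_right (h : IsSymmetricContour L E k g) {s t : ℝ} (hs : s ∈ Icc (0 : ℝ) 1)
    (ht : t ∈ Ioo (0 : ℝ) 1) (he : g 0 s = g 0 t) : s = t := by
  have hinj := (h.smooth 0 (Nat.zero_le _)).injOn
  rcases hs.2.lt_or_eq with hs1 | rfl
  · exact hinj ⟨hs.1, hs1⟩ ⟨ht.1.le, ht.2⟩ he
  · rw [h.g_one, ← h.neg_one] at he
    exact absurd (hinj (by simp) ⟨ht.1.le, ht.2⟩ he) ht.1.ne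

theorem injOn_right (h : IsSymmetricContour L E k g) : InjOn (g 0) (Icc (1 / 2) 1) := by
  intro s hs t ht he
  have hs' : s ∈ Icc (0 : ℝ) 1 := ⟨by linarith [hs.1], hs.2⟩
  have ht' : t ∈ Icc (0 : ℝ) 1 := ⟨by linarith [ht.1], ht.2⟩
  rcases ht.2.lt_or_eq with h1 | h1
  · exact h.eq_of_mem_right hs' ⟨by linarith [ht.1], h1⟩ he
  · rcases hs.2.lt_or_eq with h2 | h2
    · exact (h.eq_of_mem_right ht' ⟨by linarith [hs.1], h2⟩ he.symm).symm
    · rw [h1, h2]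

theorem sq_ne_one (h : IsSymmetricContour L E k g) {u : ℝ} (hu : u ∈ Ioo (0 : ℝ) 1)
    (hu' : u ≠ 1 / 2) : g 0 u ^ 2 ≠ 1 := by
  intro hsq
  rcases sq_eq_sq_iff_eq_or_eq_neg.mp (hsq.trans (one_pow 2).symm) with h1 | h1
  · exact hu' (h.eq_of_mem_right (s := 1 / 2) (by norm_num) hu (h.one.trans h1.symm)).symm
  · exact hu.1.ne (h.eq_of_mem_right (s := 0) (by norm_num) hu (h.neg_one.trans h1.symm))

theorem sq_eq_one_of_mem_inter (h : IsSymmetricContour L E k g) {ζ : ℂ}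
    (h1 : ζ ∈ g 0 '' Icc 0 (1 / 2)) (h2 : ζ ∈ g 0 '' Icc (1 / 2) 1) : ζ ^ 2 = 1 := by
  obtain ⟨s, hs, rfl⟩ := h1
  obtain ⟨t, ht, he⟩ := h2
  rcases ht.2.lt_or_eq with h3 | rfl
  · have := h.eq_of_mem_right (s := s) ⟨hs.1, by linarith [hs.2]⟩ ⟨by linarith [ht.1], h3⟩ he.symm
    have hs2 : s = 1 / 2 := le_antisymm hs.2 (this ▸ ht.1)
    rw [hs2, h.one]; norm_num
  · rw [← he, h.g_one]; norm_num

theorem inv_mem_range (h : IsSymmetricContour L E k g) (u : ℝ) :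
    (g 0 u)⁻¹ ∈ g 0 '' Icc 0 (1 / 2) ∨ (g 0 u)⁻¹ ∈ g 0 '' Icc (1 / 2) 1 := by
  have := (h.inv_mem (g 0 u)).mpr ⟨u, rfl⟩
  rwa [h.range_zero_eq] at this

theorem inv_notMem_left (h : IsSymmetricContour L E k g) {u : ℝ} (hu : u ∈ Ioo (0 : ℝ) (1 / 2)) :
    (g 0 u)⁻¹ ∉ g 0 '' Icc 0 (1 / 2) := by
  have hc := (h.smooth 0 (Nat.zero_le _)).contDiff.continuous
  refine inv_notMem_image hc h.injOn_left (isClosed_image_Icc hc (x := 1 / 2) (y := 1))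
    (h.ne_zero (Nat.zero_le _)) (fun u _ => h.inv_mem_range u)
    (fun ζ h1 h2 => h.sq_eq_one_of_mem_inter h1 h2)
    (fun v hv => h.sq_ne_one ⟨hv.1, by linarith [hv.2]⟩ hv.2.ne) ?_ hu
  rw [h.neg_one, h.one]; norm_num

theorem inv_notMem_right (h : IsSymmetricContour L E k g) {u : ℝ} (hu : u ∈ Ioo (1 / 2 : ℝ) 1) :
    (g 0 u)⁻¹ ∉ g 0 '' Icc (1 / 2) 1 := by
  have hc := (h.smooth 0 (Nat.zero_le _)).contDiff.continuous
  refine inv_notMem_image hc h.injOn_right (isClosed_image_Icc hc (x := 0) (y := 1 / 2))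
    (h.ne_zero (Nat.zero_le _)) (fun u _ => (h.inv_mem_range u).symm)
    (fun ζ h1 h2 => h.sq_eq_one_of_mem_inter h2 h1)
    (fun v hv => h.sq_ne_one ⟨by linarith [hv.1], hv.2⟩ hv.1.ne') ?_ hu
  rw [h.g_one, h.one]; norm_num

theorem contDiff_delta0 (h : IsSymmetricContour L E k g) : ContDiff ℝ 1 (delta0 g) := by
  have h1 : ContDiff ℝ 1 fun t : ℝ => g 0 (t / 2) :=
    (h.smooth 0 (Nat.zero_le _)).contDiff.comp (contDiff_id.div_const 2)
  exact contDiff_joukovski_comp h1 fun t => h.ne_zero (Nat.zero_le _) _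

theorem hasDerivAt_delta0 (h : IsSymmetricContour L E k g) (t : ℝ) :
    HasDerivAt (delta0 g)
      ((1 - (g 0 (t / 2) ^ 2)⁻¹) / 2 * (deriv (g 0) (t / 2) / 2)) t := by
  have h1 := hasDerivAt_of_contDiff (h.smooth 0 (Nat.zero_le _)).contDiff (t / 2)
  have h2 := h1.scomp t ((hasDerivAt_id t).div_const 2)
  refine ((hasDerivAt_joukovski (h.ne_zero (Nat.zero_le _) (t / 2))).comp t h2).congr_deriv ?_
  rw [Complex.real_smul]
  push_cast
  ring

/-- The Joukovski map identifies only τ with 1/τ, and inversion sends the interior of the half arc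
to the other half. Its derivative vanishes at ±1, so this parametrization is not regular at the
endpoints. -/
theorem isRegularArc_delta0 (h : IsSymmetricContour L E k g) : IsRegularArc (delta0 g) where
  contDiff := h.contDiff_delta0
  injOn := by
    have key : ∀ s ∈ Icc (0 : ℝ) 1, ∀ t ∈ Icc (0 : ℝ) 1, g 0 (s / 2) = (g 0 (t / 2))⁻¹ →
        g 0 (s / 2) = g 0 (t / 2) := by
      intro s hs t ht he
      by_cases ht' : t ∈ Ioo (0 : ℝ) 1
      · refine absurd ⟨s / 2, ⟨by linarith [hs.1], by linarith [hs.2]⟩, he⟩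
          (h.inv_notMem_left (u := t / 2) ⟨by linarith [ht'.1], by linarith [ht'.2]⟩)
      · have : t = 0 ∨ t = 1 := by
          by_contra! hcon
          exact ht' ⟨lt_of_le_of_ne ht.1 hcon.1.symm, lt_of_le_of_ne ht.2 hcon.2⟩
        rcases this with rfl | rfl
        · rw [he, zero_div, h.neg_one]; norm_num
        · rw [he, h.one]; norm_num
    intro s hs t ht he
    have := (joukovski_eq_iff (h.ne_zero (Nat.zero_le _) _) (h.ne_zero (Nat.zero_le _) _)).mp he
    have h1 : g 0 (s / 2) = g 0 (t / 2) := this.elim id (key s hs t ht)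
    have := h.injOn_left ⟨by linarith [hs.1], by linarith [hs.2]⟩
      ⟨by linarith [ht.1], by linarith [ht.2]⟩ h1
    linarith
  deriv_ne t ht := by
    rw [(h.hasDerivAt_delta0 t).deriv]
    refine mul_ne_zero (joukovski_deriv_ne_zero
      (h.sq_ne_one ⟨by linarith [ht.1], by linarith [ht.2]⟩ (by linarith [ht.2]))) ?_
    exact div_ne_zero ((h.smooth 0 (Nat.zero_le _)).deriv_ne _) two_ne_zero
  start := by simp only [delta0, zero_div, h.neg_one, joukovski]; norm_num
  finish := by simp only [delta0, h.one, joukovski]; norm_num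

theorem joukovski_image_range_zero (h : IsSymmetricContour L E k g) :
    joukovski '' range (g 0) = arcSet (delta0 g) := by
  have hleft : ∀ u ∈ Icc (0 : ℝ) (1 / 2), joukovski (g 0 u) ∈ arcSet (delta0 g) := fun u hu =>
    ⟨2 * u, ⟨by linarith [hu.1], by linarith [hu.2]⟩, by
      rw [delta0, mul_div_cancel_left₀ _ (two_ne_zero)]⟩
  refine Subset.antisymm ?_ ?_
  · rintro _ ⟨τ, hτ, rfl⟩
    rw [h.range_zero_eq] at hτ
    rcases hτ with ⟨u, hu, rfl⟩ | ⟨u, hu, rfl⟩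
    · exact hleft u hu
    · by_cases hu' : u ∈ Ioo (1 / 2 : ℝ) 1
      · obtain ⟨v, hv, he⟩ := (h.inv_mem_range u).resolve_right (h.inv_notMem_right hu')
        rw [← joukovski_inv, ← he]
        exact hleft v hv
      · have : u = 1 / 2 ∨ u = 1 := by
          by_contra! hcon
          exact hu' ⟨lt_of_le_of_ne hu.1 hcon.1.symm, lt_of_le_of_ne hu.2 hcon.2⟩
        rcases this with rfl | rfl
        · exact hleft _ (by norm_num)
        · rw [h.g_one, ← h.neg_one]
          exact hleft 0 (by norm_num)
  · rintro _ ⟨t, -, rfl⟩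
    exact ⟨_, ⟨t / 2, rfl⟩, rfl⟩

/-- With τ = g 0 (t/2) one has |w_+| = |τ − 1/τ|/2. Its zeros at ±1 cancel those of the derivative
of the Joukovski map, leaving a bounded quotient |g'/(2τ)|. -/
theorem intervalIntegrable_traceDensity (h : IsSymmetricContour L E k g) :
    IntervalIntegrable (traceDensity (delta0 g)) MeasureTheory.volume 0 1 := by
  have hr := h.isRegularArc_delta0
  have hs := h.smooth 0 (Nat.zero_le _)
  rw [intervalIntegrable_iff_integrableOn_Ioo_of_le zero_le_one]
  have hc : Continuous fun t : ℝ => ‖(g 0 (t / 2))⁻¹‖ * ‖deriv (g 0) (t / 2) / 2‖ := by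
    have h1 : Continuous fun t : ℝ => g 0 (t / 2) :=
      hs.contDiff.continuous.comp (continuous_id.div_const 2)
    have h2 : Continuous fun t : ℝ => deriv (g 0) (t / 2) :=
      (hs.contDiff.continuous_deriv le_rfl).comp (continuous_id.div_const 2)
    exact (h1.inv₀ fun t => h.ne_zero (Nat.zero_le _) _).norm.mul (h2.div_const 2).norm
  refine MeasureTheory.Integrable.mono'
    ((intervalIntegrable_iff_integrableOn_Ioo_of_le zero_le_one).mp
      (hc.intervalIntegrable (μ := MeasureTheory.volume) 0 1))
    (hr.continuousOn_traceDensity.aestronglyMeasurable measurableSet_Ioo) ?_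
  refine (MeasureTheory.ae_restrict_iff' measurableSet_Ioo).mpr
    (Eventually.of_forall fun t ht => ?_)
  have h0 := h.ne_zero (Nat.zero_le _) (t / 2)
  have hsq : ‖leftTrace (wBranch (delta0 g)) (delta0 g) t‖ =
      ‖(g 0 (t / 2) - (g 0 (t / 2))⁻¹) / 2‖ := by
    have := hr.leftTrace_sq ht
    rw [delta0, joukovski_sq_sub_one h0] at this
    have h2 := congrArg norm this
    rw [norm_pow, norm_pow] at h2
    exact (pow_left_inj₀ (norm_nonneg _) (norm_nonneg _) two_ne_zero).mp h2
  have hpos : 0 < ‖leftTrace (wBranch (delta0 g)) (delta0 g) t‖ :=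
    norm_pos_iff.mpr (hr.leftTrace_ne_zero ht)
  rw [traceDensity, norm_div, div_le_iff₀ hpos, hsq, (h.hasDerivAt_delta0 t).deriv, ← norm_mul,
    ← norm_mul]
  refine le_of_eq (congrArg norm ?_)
  field_simp

/-! ### The closed curves of the contour -/

theorem disjoint_gammaSet (h : IsSymmetricContour L E k g) {l l' : ℤ} (hl : l ∈ Icc (-(k : ℤ)) k)
    (hl' : l' ∈ Icc (-(k : ℤ)) k) (hne : l ≠ l') {τ : ℂ} (hτ : τ ∈ gammaSet g l) :
    τ ∉ gammaSet g l' := fun hτ' => Set.disjoint_left.mp (h.disjoint hl hl' hne) hτ hτ'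

theorem gammaSet_natCast (g : ℕ → ℝ → ℂ) (l : ℕ) : gammaSet g l = range (g l) := by
  simp [gammaSet]

theorem mem_gammaSet_neg (g : ℕ → ℝ → ℂ) {l : ℕ} (hl : 1 ≤ l) {τ : ℂ} :
    τ ∈ gammaSet g (-(l : ℤ)) ↔ τ⁻¹ ∈ range (g l) := by
  have : ¬ (0 : ℤ) ≤ -(l : ℤ) := by omega
  simp only [gammaSet, if_neg this, Int.natAbs_neg, Int.natAbs_natCast]
  rfl

theorem mem_gammaUnion_iff (_ : IsSymmetricContour L E k g) {τ : ℂ} :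
    τ ∈ gammaUnion k g ↔ τ ∈ range (g 0) ∨
      ∃ l : ℕ, 1 ≤ l ∧ l ≤ k ∧ (τ ∈ range (g l) ∨ τ⁻¹ ∈ range (g l)) := by
  simp only [gammaUnion, mem_iUnion, mem_Icc, exists_prop]
  constructor
  · rintro ⟨l, ⟨hl1, hl2⟩, hτ⟩
    obtain ⟨n, rfl | rfl⟩ := l.eq_nat_or_neg
    · rw [gammaSet_natCast] at hτ
      rcases Nat.eq_zero_or_pos n with rfl | hn
      · exact Or.inl hτ
      · exact Or.inr ⟨n, hn, by omega, Or.inl hτ⟩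
    · rcases Nat.eq_zero_or_pos n with rfl | hn
      · left
        have : (-((0 : ℕ) : ℤ)) = ((0 : ℕ) : ℤ) := by simp
        rwa [this, gammaSet_natCast] at hτ
      · rw [mem_gammaSet_neg g hn] at hτ
        exact Or.inr ⟨n, hn, by omega, Or.inr hτ⟩
  · rintro (hτ | ⟨l, hl1, hl2, hτ | hτ⟩)
    · exact ⟨((0 : ℕ) : ℤ), by simp, by rwa [gammaSet_natCast]⟩
    · exact ⟨l, by omega, by rwa [gammaSet_natCast]⟩
    · exact ⟨-(l : ℤ), by omega, by rwa [mem_gammaSet_neg g hl1]⟩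

theorem inv_mem_gammaUnion (h : IsSymmetricContour L E k g) {τ : ℂ} :
    τ⁻¹ ∈ gammaUnion k g ↔ τ ∈ gammaUnion k g := by
  rw [h.mem_gammaUnion_iff, h.mem_gammaUnion_iff, h.inv_mem τ, inv_inv]
  simp only [or_comm]

theorem zero_notMem_gammaUnion (h : IsSymmetricContour L E k g) : (0 : ℂ) ∉ gammaUnion k g := by
  rw [h.mem_gammaUnion_iff, inv_zero]
  rintro (h0 | ⟨l, -, hl, h0 | h0⟩)
  · exact h.zero_notMem 0 (Nat.zero_le _) h0
  · exact h.zero_notMem l hl h0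
  · exact h.zero_notMem l hl h0

theorem isClosed_gammaUnion (h : IsSymmetricContour L E k g) : IsClosed (gammaUnion k g) := by
  have : gammaUnion k g = range (g 0) ∪ ⋃ l ∈ Finset.Icc 1 k,
      (range (g l) ∪ range fun t => (g l t)⁻¹) := by
    ext τ
    rw [h.mem_gammaUnion_iff]
    simp only [mem_union, mem_iUnion, Finset.mem_Icc, exists_prop, and_assoc, mem_range,
      inv_eq_iff_eq_inv]
  rw [this]
  refine (h.smooth 0 (Nat.zero_le _)).isCompact_range.isClosed.union
    (isClosed_biUnion_finset fun l hl => ?_)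
  have hl' := (Finset.mem_Icc.mp hl).2
  have hs := h.smooth l hl'
  refine hs.isCompact_range.isClosed.union ?_
  have : (range fun t => (g l t)⁻¹) = (fun t => (g l t)⁻¹) '' Icc 0 1 := by
    refine Subset.antisymm ?_ (image_subset_range _ _)
    rintro _ ⟨t, rfl⟩
    obtain ⟨s, hs1, hs2⟩ : g l t ∈ g l '' Icc 0 1 := by
      rw [show g l '' Icc 0 1 = range (g l) from hs.arcSet_eq]
      exact mem_range_self t
    exact ⟨s, hs1, by simp only [hs2]⟩
  rw [this]
  exact isClosed_image_Icc (hs.contDiff.continuous.inv₀ (h.ne_zero hl'))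

theorem joukovski_mem_deltaSet (h : IsSymmetricContour L E k g) {τ : ℂ} (hτ : τ ≠ 0) :
    joukovski τ ∈ deltaSet k g ↔ τ ∈ gammaUnion k g := by
  refine ⟨?_, fun h' => ⟨τ, h', rfl⟩⟩
  rintro ⟨ζ, hζ, he⟩
  have hζ0 : ζ ≠ 0 := fun h0 => h.zero_notMem_gammaUnion (h0 ▸ hζ)
  rcases (joukovski_eq_iff hζ0 hτ).mp he with rfl | rfl
  · exact hζ
  · exact h.inv_mem_gammaUnion.mp hζ

theorem mem_deltaSet_iff (h : IsSymmetricContour L E k g) {z : ℂ} :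
    z ∈ deltaSet k g ↔ z ∈ arcSet (delta0 g) ∨
      ∃ l : ℕ, 1 ≤ l ∧ l ≤ k ∧ z ∈ range (deltaCurve g l) := by
  rw [← h.joukovski_image_range_zero, deltaSet]
  constructor
  · rintro ⟨τ, hτ, rfl⟩
    rcases h.mem_gammaUnion_iff.mp hτ with hτ | ⟨l, hl1, hl2, ⟨t, ht⟩ | ⟨t, ht⟩⟩
    · exact Or.inl ⟨τ, hτ, rfl⟩
    · exact Or.inr ⟨l, hl1, hl2, t, by rw [deltaCurve, ht]⟩
    · exact Or.inr ⟨l, hl1, hl2, t, by rw [deltaCurve, ht, joukovski_inv]⟩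
  · rintro (⟨τ, hτ, rfl⟩ | ⟨l, hl1, hl2, t, rfl⟩)
    · exact ⟨τ, h.mem_gammaUnion_iff.mpr (Or.inl hτ), rfl⟩
    · exact ⟨_, h.mem_gammaUnion_iff.mpr (Or.inr ⟨l, hl1, hl2, Or.inl ⟨t, rfl⟩⟩), rfl⟩

theorem arcSet_subset_deltaSet (h : IsSymmetricContour L E k g) :
    arcSet (delta0 g) ⊆ deltaSet k g := fun _ hz => h.mem_deltaSet_iff.mpr (Or.inl hz)

theorem range_subset_deltaSet (h : IsSymmetricContour L E k g) {l : ℕ} (hl : 1 ≤ l) (hl' : l ≤ k) :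
    range (deltaCurve g l) ⊆ deltaSet k g := fun _ hz =>
  h.mem_deltaSet_iff.mpr (Or.inr ⟨l, hl, hl', hz⟩)

theorem notMem_of_mem_range (h : IsSymmetricContour L E k g) {l : ℕ} (hl : 1 ≤ l) (hl' : l ≤ k)
    {m : ℤ} (hm : m ∈ Icc (-(k : ℤ)) k) (hne : (l : ℤ) ≠ m) (t : ℝ) : g l t ∉ gammaSet g m :=
  h.disjoint_gammaSet (l := l) ⟨by omega, by omega⟩ hm hne
    (by rw [gammaSet_natCast]; exact mem_range_self t)

theorem notMem_range_zero (h : IsSymmetricContour L E k g) {l : ℕ} (hl : 1 ≤ l) (hl' : l ≤ k)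
    (t : ℝ) : g l t ∉ range (g 0) := by
  have := h.notMem_of_mem_range hl hl' (m := ((0 : ℕ) : ℤ)) ⟨by omega, by omega⟩ (by omega) t
  rwa [gammaSet_natCast] at this

theorem deltaCurve_notMem_arcSet (h : IsSymmetricContour L E k g) {l : ℕ} (hl : 1 ≤ l)
    (hl' : l ≤ k) (t : ℝ) : deltaCurve g l t ∉ arcSet (delta0 g) := by
  rw [← h.joukovski_image_range_zero]
  rintro ⟨τ, hτ, he⟩
  have hτ0 : τ ≠ 0 := fun h0 => h.zero_notMem 0 (Nat.zero_le _) (h0 ▸ hτ)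
  rcases (joukovski_eq_iff hτ0 (h.ne_zero hl' t)).mp he with rfl | rfl
  · exact h.notMem_range_zero hl hl' t hτ
  · exact h.notMem_range_zero hl hl' t ((h.inv_mem _).mp hτ)

theorem deltaCurve_notMem_range (h : IsSymmetricContour L E k g) {l l' : ℕ} (hl : 1 ≤ l)
    (hl' : l ≤ k) (hm : 1 ≤ l') (hm' : l' ≤ k) (hne : l ≠ l') (t : ℝ) :
    deltaCurve g l t ∉ range (deltaCurve g l') := by
  rintro ⟨s, he⟩
  rcases (joukovski_eq_iff (h.ne_zero hm' s) (h.ne_zero hl' t)).mp he with h1 | h1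
  · refine h.notMem_of_mem_range hl hl' (m := l') ⟨by omega, by omega⟩ (by omega) t ?_
    rw [gammaSet_natCast, ← h1]
    exact mem_range_self s
  · refine h.notMem_of_mem_range hl hl' (m := -(l' : ℤ)) ⟨by omega, by omega⟩ (by omega) t ?_
    rw [mem_gammaSet_neg g hm, ← h1]
    exact mem_range_self s

/-- Injectivity is the disjointness of Γ_l and Γ_{−l}. Regularity holds because Γ_l is disjoint from
Γ_0 and so misses ±1. -/
theorem isSmoothJordanCurve_deltaCurve (h : IsSymmetricContour L E k g) {l : ℕ} (hl : 1 ≤ l)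
    (hl' : l ≤ k) : IsSmoothJordanCurve (deltaCurve g l) where
  contDiff := contDiff_joukovski_comp (h.smooth l hl').contDiff (h.ne_zero hl')
  periodic t := by simp only [deltaCurve, (h.smooth l hl').periodic t]
  injOn := by
    intro s hs t ht he
    rcases (joukovski_eq_iff (h.ne_zero hl' s) (h.ne_zero hl' t)).mp he with h1 | h1
    · exact (h.smooth l hl').injOn hs ht h1
    · refine absurd ?_ (h.notMem_of_mem_range hl hl' (m := -(l : ℤ)) ⟨by omega, by omega⟩
        (by omega) t)
      rw [mem_gammaSet_neg g hl, ← h1]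
      exact mem_range_self s
  deriv_ne t := by
    have h1 := (hasDerivAt_joukovski (h.ne_zero hl' t)).comp t
      (hasDerivAt_of_contDiff (h.smooth l hl').contDiff t)
    have h2 : deriv (deltaCurve g l) t = _ := h1.deriv
    rw [h2]
    refine mul_ne_zero (joukovski_deriv_ne_zero fun hsq => ?_)
      ((h.smooth l hl').deriv_ne t)
    rcases sq_eq_sq_iff_eq_or_eq_neg.mp (hsq.trans (one_pow 2).symm) with h3 | h3
    · exact h.notMem_range_zero hl hl' t ⟨1 / 2, h.one.trans h3.symm⟩
    · exact h.notMem_range_zero hl hl' t ⟨0, h.neg_one.trans h3.symm⟩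

theorem isClosed_deltaSet (h : IsSymmetricContour L E k g) : IsClosed (deltaSet k g) := by
  have : deltaSet k g = arcSet (delta0 g) ∪ ⋃ l ∈ Finset.Icc 1 k, range (deltaCurve g l) := by
    ext z
    rw [h.mem_deltaSet_iff]
    simp only [mem_union, mem_iUnion, Finset.mem_Icc, exists_prop, and_assoc]
  rw [this]
  refine h.isRegularArc_delta0.isClosed.union (isClosed_biUnion_finset fun l hl => ?_)
  rw [Finset.mem_Icc] at hl
  exact (h.isSmoothJordanCurve_deltaCurve hl.1 hl.2).isCompact_range.isClosed

theorem isCompact_deltaSet (h : IsSymmetricContour L E k g) : IsCompact (deltaSet k g) := by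
  have : deltaSet k g = arcSet (delta0 g) ∪ ⋃ l ∈ Finset.Icc 1 k, range (deltaCurve g l) := by
    ext z
    rw [h.mem_deltaSet_iff]
    simp only [mem_union, mem_iUnion, Finset.mem_Icc, exists_prop, and_assoc]
  rw [this]
  refine (isCompact_arcSet h.contDiff_delta0).union ((Finset.Icc 1 k).isCompact_biUnion
    fun l hl => ?_)
  rw [Finset.mem_Icc] at hl
  exact (h.isSmoothJordanCurve_deltaCurve hl.1 hl.2).isCompact_range

theorem dense_compl_deltaSet (h : IsSymmetricContour L E k g) : Dense (deltaSet k g)ᶜ := by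
  have : (deltaSet k g)ᶜ = (arcSet (delta0 g))ᶜ ∩ ⋂ l ∈ Finset.Icc 1 k,
      (range (deltaCurve g l))ᶜ := by
    ext z
    rw [mem_compl_iff, h.mem_deltaSet_iff]
    simp only [not_or, not_exists, not_and, mem_inter_iff, mem_compl_iff, mem_iInter,
      Finset.mem_Icc, and_imp]
  rw [this]
  have hcurve : ∀ l ∈ Finset.Icc 1 k, IsSmoothJordanCurve (deltaCurve g l) := fun l hl =>
    h.isSmoothJordanCurve_deltaCurve (Finset.mem_Icc.mp hl).1 (Finset.mem_Icc.mp hl).2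
  refine (dense_compl_arcSet h.contDiff_delta0).inter_of_isOpen_left ?_
    h.isRegularArc_delta0.isClosed.isOpen_compl
  refine dense_biInter_of_isOpen (fun l hl => ?_) (Finset.countable_toSet _) fun l hl => ?_
  · exact (hcurve l hl).isCompact_range.isClosed.isOpen_compl
  · exact dense_compl_range (hcurve l hl).contDiff

end IsSymmetricContour

/-! ### Zeros and poles of the functions `B_i` -/

section Blaschke

variable {L : ℝ → ℂ} {E : ℕ → Multiset (OnePoint ℂ)} {i : ℕ}

theorem blaschkeNum_eq_zero_iff {ζ : ℂ} :
    blaschkeNum L E i ζ = 0 ↔ ∃ e ∈ E i, ζ = phi L e := by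
  simp only [blaschkeNum, Multiset.prod_eq_zero_iff, Multiset.mem_map, sub_eq_zero]

theorem blaschkeDen_eq_zero_iff {ζ : ℂ} :
    blaschkeDen L E i ζ = 0 ↔ ∃ e ∈ E i, ζ * phi L e = 1 := by
  simp only [blaschkeDen, Multiset.prod_eq_zero_iff, Multiset.mem_map, sub_eq_zero,
    eq_comm (a := (1 : ℂ))]

theorem differentiable_blaschkeNum (L : ℝ → ℂ) (E : ℕ → Multiset (OnePoint ℂ)) (i : ℕ) :
    Differentiable ℂ (blaschkeNum L E i) := by
  unfold blaschkeNum
  induction E i using Multiset.induction_on with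
  | empty => simp
  | cons e s ih =>
    simp only [Multiset.map_cons, Multiset.prod_cons]
    exact (differentiable_id.sub_const _).mul ih

theorem differentiable_blaschkeDen (L : ℝ → ℂ) (E : ℕ → Multiset (OnePoint ℂ)) (i : ℕ) :
    Differentiable ℂ (blaschkeDen L E i) := by
  unfold blaschkeDen
  induction E i using Multiset.induction_on with
  | empty => simp
  | cons e s ih =>
    simp only [Multiset.map_cons, Multiset.prod_cons]
    exact ((differentiable_id.mul_const _).const_sub 1).mul ih

/-- This and `blaschkeNum_inv` are B_i(1/ζ) = 1/B_i(ζ) with denominators cleared. Through the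
symmetry of Γ they turn an upper bound for |B_i| into a lower one. -/
theorem blaschkeDen_inv (L : ℝ → ℂ) (E : ℕ → Multiset (OnePoint ℂ)) (i : ℕ) {ζ : ℂ} (hζ : ζ ≠ 0) :
    ζ ^ Multiset.card (E i) * blaschkeDen L E i ζ⁻¹ = blaschkeNum L E i ζ := by
  unfold blaschkeNum blaschkeDen
  induction E i using Multiset.induction_on with
  | empty => simp
  | cons e s ih =>
    simp only [Multiset.map_cons, Multiset.prod_cons, Multiset.card_cons, ← ih]
    field_simp
    ring

theorem blaschkeNum_inv (L : ℝ → ℂ) (E : ℕ → Multiset (OnePoint ℂ)) (i : ℕ) {ζ : ℂ} (hζ : ζ ≠ 0) :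
    ζ ^ Multiset.card (E i) * blaschkeNum L E i ζ⁻¹ = blaschkeDen L E i ζ := by
  unfold blaschkeNum blaschkeDen
  induction E i using Multiset.induction_on with
  | empty => simp
  | cons e s ih =>
    simp only [Multiset.map_cons, Multiset.prod_cons, Multiset.card_cons, ← ih]
    field_simp
    ring

theorem phi_infty (γ : ℝ → ℂ) : phi γ OnePoint.infty = 0 := rfl

/-- Numerator and denominator of `B_i` have no common zeros. -/
theorem IsInterpolationScheme.blaschkeDen_ne_zero (hE : IsInterpolationScheme L E)
    (hL : IsRegularArc L) {ζ : ℂ} (h : blaschkeNum L E i ζ = 0) : blaschkeDen L E i ζ ≠ 0 := by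
  intro h'
  obtain ⟨e, he, rfl⟩ := blaschkeNum_eq_zero_iff.mp h
  obtain ⟨e', he', hprod⟩ := blaschkeDen_eq_zero_iff.mp h'
  induction e using OnePoint.rec with
  | infty => simp [phi_infty] at hprod
  | coe z =>
    induction e' using OnePoint.rec with
    | infty => simp [phi_infty] at hprod
    | coe z' =>
      have hz := hE.notMem i z he
      have hz' := hE.notMem i z' he'
      have hinv : phi L z = (phi L z')⁻¹ := eq_inv_of_mul_eq_one_left hprod
      have hzz : z = z' := by
        rw [← hL.joukovski_phi hz, ← hL.joukovski_phi hz', hinv, joukovski_inv]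
      subst hzz
      rw [hL.inv_phi hz, phi_coe] at hinv
      exact hL.wBranch_ne_zero hz (by linear_combination -hinv / 2)

/-! ### Points where `B_i` tends to zero or to infinity -/

theorem TendsZeroOn.mono {K K' : Set ℂ} (h : TendsZeroOn L E K) (hK : K' ⊆ K) :
    TendsZeroOn L E K' := fun ε hε => (h ε hε).mono fun _ hi ζ hζ => hi ζ (hK hζ)

theorem TendsZeroOn.union {K K' : Set ℂ} (h : TendsZeroOn L E K) (h' : TendsZeroOn L E K') :
    TendsZeroOn L E (K ∪ K') := fun ε hε => by
  filter_upwards [h ε hε, h' ε hε] with i h1 h2 ζ hζ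
  exact hζ.elim (h1 ζ) (h2 ζ)

/-- With ε = 1/2 in both inequalities, numerator and denominator would both vanish at ζ, which is
excluded. -/
theorem IsInterpolationScheme.not_tendsInftyOn (hE : IsInterpolationScheme L E)
    (hL : IsRegularArc L) {ζ : ℂ} (h : TendsZeroOn L E {ζ}) : ¬ TendsInftyOn L E {ζ} := by
  intro h'
  obtain ⟨i, h1, h2⟩ := ((h (1 / 2) (by norm_num)).and (h' (1 / 2) (by norm_num))).exists
  have e1 := h1 ζ rfl
  have e2 := h2 ζ rfl
  have n0 : ‖blaschkeNum L E i ζ‖ = 0 :=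
    le_antisymm (by linarith [norm_nonneg (blaschkeNum L E i ζ)]) (norm_nonneg _)
  have d0 : ‖blaschkeDen L E i ζ‖ = 0 :=
    le_antisymm (by linarith [norm_nonneg (blaschkeDen L E i ζ)]) (norm_nonneg _)
  exact hE.blaschkeDen_ne_zero hL (norm_eq_zero.mp n0) (norm_eq_zero.mp d0)

namespace IsSymmetricContour

variable {k : ℕ} {g : ℕ → ℝ → ℂ}

theorem tendsInftyOn (h : IsSymmetricContour L E k g) {ζ : ℂ} (hζ : ζ ∉ gammaUnion k g)
    (h0 : ¬ TendsZeroOn L E {ζ}) : TendsInftyOn L E {ζ} := by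
  have hsub : {ζ} ⊆ connectedComponentIn (gammaUnion k g)ᶜ ζ :=
    singleton_subset_iff.mpr (mem_connectedComponentIn hζ)
  exact ((h.dichotomy ζ hζ).resolve_left fun h' => h0 (h' _ hsub isCompact_singleton)) _ hsub
    isCompact_singleton

theorem exists_nhds_tendsZeroOn (h : IsSymmetricContour L E k g) (hE : IsInterpolationScheme L E)
    (hL : IsRegularArc L) {ζ : ℂ} (hζ : ζ ∉ gammaUnion k g) (h0 : TendsZeroOn L E {ζ}) :
    ∃ K ∈ 𝓝 ζ, TendsZeroOn L E K := by
  have hmem := mem_connectedComponentIn (F := (gammaUnion k g)ᶜ) hζ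
  have hopen : IsOpen (connectedComponentIn (gammaUnion k g)ᶜ ζ) :=
    h.isClosed_gammaUnion.isOpen_compl.connectedComponentIn
  obtain ⟨K, hK, hKsub, hKc⟩ := local_compact_nhds (hopen.mem_nhds hmem)
  refine ⟨K, hK, ((h.dichotomy ζ hζ).resolve_right fun h' => ?_) K hKsub hKc⟩
  exact hE.not_tendsInftyOn hL h0 (h' _ (singleton_subset_iff.mpr hmem) isCompact_singleton)

theorem tendsZeroOn_of_isCompact (h : IsSymmetricContour L E k g) (hE : IsInterpolationScheme L E)
    (hL : IsRegularArc L) {K : Set ℂ} (hK : IsCompact K)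
    (hK' : ∀ ζ ∈ K, ζ ∉ gammaUnion k g ∧ TendsZeroOn L E {ζ}) : TendsZeroOn L E K := by
  refine hK.induction_on (p := TendsZeroOn L E)
    (fun ε _ => Eventually.of_forall fun i ζ hζ => hζ.elim)
    (fun s t hst ht => ht.mono hst) (fun s t hs ht => hs.union ht) fun ζ hζ => ?_
  obtain ⟨V, hV, hV0⟩ := h.exists_nhds_tendsZeroOn hE hL (hK' ζ hζ).1 (hK' ζ hζ).2
  exact ⟨V, mem_nhdsWithin_of_mem_nhds hV, hV0⟩

theorem eventually_tendsZeroOn_iff (h : IsSymmetricContour L E k g) (hE : IsInterpolationScheme L E)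
    (hL : IsRegularArc L) {ζ : ℂ} (hζ : ζ ∉ gammaUnion k g) :
    ∀ᶠ τ in 𝓝 ζ, TendsZeroOn L E {τ} ↔ TendsZeroOn L E {ζ} := by
  have hmem := mem_connectedComponentIn (F := (gammaUnion k g)ᶜ) hζ
  have hopen : IsOpen (connectedComponentIn (gammaUnion k g)ᶜ ζ) :=
    h.isClosed_gammaUnion.isOpen_compl.connectedComponentIn
  filter_upwards [hopen.mem_nhds hmem] with τ hτ
  have s1 := singleton_subset_iff.mpr hmem
  have s2 := singleton_subset_iff.mpr hτ
  rcases h.dichotomy ζ hζ with h' | h'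
  · exact iff_of_true (h' _ s2 isCompact_singleton) (h' _ s1 isCompact_singleton)
  · exact iff_of_false (fun h0 => hE.not_tendsInftyOn hL h0 (h' _ s2 isCompact_singleton))
      (fun h0 => hE.not_tendsInftyOn hL h0 (h' _ s1 isCompact_singleton))

/-- At a zero of the denominator on Γ the bound M would make the numerator vanish as well. Zeros of
the numerator are excluded by inversion. -/
theorem blaschke_ne_zero (h : IsSymmetricContour L E k g) (hE : IsInterpolationScheme L E)
    (hL : IsRegularArc L) {τ : ℂ} (hτ : τ ∈ gammaUnion k g) (i : ℕ) :
    blaschkeNum L E i τ ≠ 0 ∧ blaschkeDen L E i τ ≠ 0 := by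
  obtain ⟨M, -, hM⟩ := h.bounded
  have hτ0 : τ ≠ 0 := fun h0 => h.zero_notMem_gammaUnion (h0 ▸ hτ)
  have key : ∀ τ ∈ gammaUnion k g, blaschkeDen L E i τ ≠ 0 := by
    intro τ hτ hd
    have := hM i τ hτ
    rw [hd, norm_zero, mul_zero] at this
    exact hE.blaschkeDen_ne_zero hL (norm_le_zero_iff.mp this) hd
  refine ⟨?_, key τ hτ⟩
  rw [← blaschkeDen_inv L E i hτ0]
  exact mul_ne_zero (pow_ne_zero _ hτ0) (key _ (h.inv_mem_gammaUnion.mpr hτ))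

theorem exists_norm_blaschkeDen_le (h : IsSymmetricContour L E k g) :
    ∃ M : ℝ, 0 < M ∧ ∀ i, ∀ τ ∈ gammaUnion k g,
      ‖blaschkeDen L E i τ‖ ≤ M * ‖blaschkeNum L E i τ‖ := by
  obtain ⟨M, hM0, hM⟩ := h.bounded
  refine ⟨M, hM0, fun i τ hτ => ?_⟩
  have hτ0 : τ ≠ 0 := fun h0 => h.zero_notMem_gammaUnion (h0 ▸ hτ)
  rw [← blaschkeDen_inv L E i hτ0, ← blaschkeNum_inv L E i hτ0, norm_mul, norm_mul,
    mul_left_comm]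
  exact mul_le_mul_of_nonneg_left (hM i _ (h.inv_mem_gammaUnion.mpr hτ)) (norm_nonneg _)

/-! ### The domains `D_Δ^0` and `D_Δ^∞` -/

theorem notMem_arcSet (h : IsSymmetricContour L E k g) {z : ℂ} (hz : z ∉ deltaSet k g) :
    z ∉ arcSet (delta0 g) := fun h' => hz (h.arcSet_subset_deltaSet h')

theorem phi_mem_gammaUnion (h : IsSymmetricContour L E k g) {z : ℂ} (hz : z ∉ arcSet (delta0 g)) :
    phi (delta0 g) z ∈ gammaUnion k g ↔ z ∈ deltaSet k g := by
  have hr := h.isRegularArc_delta0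
  rw [← h.joukovski_mem_deltaSet (hr.phi_ne_zero hz), hr.joukovski_phi hz]

theorem differentiableAt_phi (h : IsSymmetricContour L E k g) {z : ℂ}
    (hz : z ∉ arcSet (delta0 g)) : DifferentiableAt ℂ (fun z : ℂ => phi (delta0 g) z) z :=
  differentiableAt_id.sub (h.isRegularArc_delta0.wBranch_differentiableAt hz)

theorem mem_domainZero (L : ℝ → ℂ) (E : ℕ → Multiset (OnePoint ℂ)) (k : ℕ) (g : ℕ → ℝ → ℂ) {z : ℂ} :
    (z : OnePoint ℂ) ∈ domainZero L E k g ↔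
      z ∉ deltaSet k g ∧ TendsZeroOn L E {phi (delta0 g) z} := by
  refine and_congr_left fun _ => ⟨fun h hz => h z hz rfl, fun h s hs he => ?_⟩
  rw [OnePoint.coe_eq_coe] at he
  exact h (he ▸ hs)

theorem infty_mem_domainZero (L : ℝ → ℂ) (E : ℕ → Multiset (OnePoint ℂ)) (k : ℕ) (g : ℕ → ℝ → ℂ) :
    OnePoint.infty ∈ domainZero L E k g ↔ TendsZeroOn L E {0} :=
  ⟨fun h => h.2, fun h => ⟨fun s _ => (OnePoint.coe_ne_infty s).symm, h⟩⟩

theorem eventually_mem_domainZero_iff (h : IsSymmetricContour L E k g)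
    (hE : IsInterpolationScheme L E) (hL : IsRegularArc L) {z : ℂ} (hz : z ∉ deltaSet k g) :
    ∀ᶠ y : ℂ in 𝓝 z, (y : OnePoint ℂ) ∈ domainZero L E k g ↔
      (z : OnePoint ℂ) ∈ domainZero L E k g := by
  have hz0 := h.notMem_arcSet hz
  filter_upwards [(h.differentiableAt_phi hz0).continuousAt.eventually
    (h.eventually_tendsZeroOn_iff hE hL (mt (h.phi_mem_gammaUnion hz0).mp hz)),
    h.isClosed_deltaSet.isOpen_compl.mem_nhds hz] with y h1 h2
  rw [mem_domainZero, mem_domainZero, h1]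
  exact and_congr_left fun _ => iff_of_true h2 hz

/-- The reciprocal of φ is z + w = 2z + O(1). -/
theorem tendsto_phi_cocompact {γ : ℝ → ℂ} (hγ : IsRegularArc γ) :
    Tendsto (fun z : ℂ => phi γ z) (cocompact ℂ) (𝓝 0) := by
  obtain ⟨C, hC⟩ := (wBranch_isBigO hγ.contDiff).bound
  rw [tendsto_zero_iff_norm_tendsto_zero]
  have h1 : Tendsto (fun z : ℂ => (2 * ‖z‖ - C)⁻¹) (cocompact ℂ) (𝓝 0) :=
    (tendsto_atTop_add_const_right _ (-C) ((tendsto_norm_cocompact_atTop (E := ℂ)).const_mul_atTop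
      two_pos)).inv_tendsto_atTop
  refine squeeze_zero' (Eventually.of_forall fun _ => norm_nonneg _) ?_ h1
  filter_upwards [hC, (isCompact_arcSet hγ.contDiff).compl_mem_cocompact,
    (tendsto_norm_cocompact_atTop (E := ℂ)).eventually_gt_atTop (|C|)] with z hz hzγ hzC
  rw [← inv_inv (phi γ z), norm_inv, hγ.inv_phi hzγ]
  have h2 : 2 * ‖z‖ ≤ ‖z + wBranch γ z‖ + ‖wBranch γ z - z‖ := by
    have := norm_sub_le (z + wBranch γ z) (wBranch γ z - z)
    rw [show z + wBranch γ z - (wBranch γ z - z) = 2 * z by ring, norm_mul] at this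
    simpa using this
  rw [norm_one, mul_one] at hz
  exact inv_anti₀ (by linarith [le_abs_self C, norm_nonneg z]) (by linarith)

theorem eventually_cocompact_mem_domainZero_iff (h : IsSymmetricContour L E k g)
    (hE : IsInterpolationScheme L E) (hL : IsRegularArc L) :
    ∀ᶠ y : ℂ in cocompact ℂ, (y : OnePoint ℂ) ∈ domainZero L E k g ↔
      OnePoint.infty ∈ domainZero L E k g := by
  filter_upwards [(tendsto_phi_cocompact h.isRegularArc_delta0).eventually
    (h.eventually_tendsZeroOn_iff hE hL h.zero_notMem_gammaUnion),
    h.isCompact_deltaSet.compl_mem_cocompact] with y h1 h2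
  rw [mem_domainZero, infty_mem_domainZero, h1, and_iff_right (show y ∉ deltaSet k g from h2)]

/-! ### Interpolation nodes -/

/-- Since J(φ_L(z)) = z, a node on Δ would give the zero φ_L(z) of B_i on the symmetric set Γ. -/
theorem node_notMem_deltaSet (h : IsSymmetricContour L E k g) (hE : IsInterpolationScheme L E)
    (hL : IsRegularArc L) {z : ℂ} (hz : (z : OnePoint ℂ) ∈ E i) : z ∉ deltaSet k g := by
  intro hzΔ
  have hzL := hE.notMem i z hz
  refine (h.blaschke_ne_zero hE hL (τ := phi L z) ?_ i).1 (blaschkeNum_eq_zero_iff.mpr ⟨z, hz, rfl⟩)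
  rwa [← h.joukovski_mem_deltaSet (hL.phi_ne_zero hzL), hL.joukovski_phi hzL]

/-- At a node, φ_{Δ_0} is φ_L or 1/φ_L, that is a zero or a pole of B_i, depending on the relative
sign of the square roots. Zeros are excluded where B_i → ∞, poles where B_i → 0. -/
theorem eventually_node_mem_domainZero (h : IsSymmetricContour L E k g)
    (hE : IsInterpolationScheme L E) (hL : IsRegularArc L) :
    ∀ᶠ i in atTop, ∀ z : ℂ, (z : OnePoint ℂ) ∈ E i →
      (wBranch L z = wBranch (delta0 g) z → (z : OnePoint ℂ) ∈ domainZero L E k g) ∧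
      (wBranch L z = -wBranch (delta0 g) z → (z : OnePoint ℂ) ∉ domainZero L E k g) := by
  filter_upwards [h.regular] with i hi z hz
  have hzΔ := h.node_notMem_deltaSet hE hL hz
  have hz0 := h.notMem_arcSet hzΔ
  have hzL := hE.notMem i z hz
  rw [mem_domainZero]
  refine ⟨fun hw => ⟨hzΔ, ?_⟩, fun hw hcon => (hi _).1 hcon.2 ?_⟩
  · by_contra h0
    refine (hi _).2 (h.tendsInftyOn (mt (h.phi_mem_gammaUnion hz0).mp hzΔ) h0)
      (blaschkeNum_eq_zero_iff.mpr ⟨z, hz, ?_⟩)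
    rw [phi_coe, phi_coe, hw]
  · refine blaschkeDen_eq_zero_iff.mpr ⟨z, hz, ?_⟩
    rw [phi_coe, phi_coe, hw]
    exact h.isRegularArc_delta0.phi_mul hz0 ▸ by ring

theorem eventually_infty_notMem (h : IsSymmetricContour L E k g)
    (hinf : OnePoint.infty ∉ domainZero L E k g) : ∀ᶠ i in atTop, OnePoint.infty ∉ E i := by
  rw [infty_mem_domainZero] at hinf
  filter_upwards [h.regular] with i hi hmem
  exact (hi 0).2 (h.tendsInftyOn h.zero_notMem_gammaUnion hinf)
    (blaschkeNum_eq_zero_iff.mpr ⟨_, hmem, rfl⟩)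

end IsSymmetricContour

end Blaschke

namespace IsSymmetricContour

variable {L : ℝ → ℂ} {E : ℕ → Multiset (OnePoint ℂ)} {k : ℕ} {g : ℕ → ℝ → ℂ}

/-! ### The two sides of the closed curves `Δ_l` -/

/-- The complement of the parts of `Δ` different from `Δ_l`. -/
def isolating (k : ℕ) (g : ℕ → ℝ → ℂ) (l : ℕ) : Set ℂ :=
  (arcSet (delta0 g))ᶜ ∩ ⋂ l' ∈ (Finset.Icc 1 k).erase l, (range (deltaCurve g l'))ᶜ

theorem isOpen_isolating (h : IsSymmetricContour L E k g) (l : ℕ) : IsOpen (isolating k g l) := by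
  refine h.isRegularArc_delta0.isClosed.isOpen_compl.inter (isOpen_biInter_finset fun l' hl' => ?_)
  have hl := Finset.mem_Icc.mp (Finset.mem_of_mem_erase hl')
  exact (h.isSmoothJordanCurve_deltaCurve hl.1 hl.2).isCompact_range.isClosed.isOpen_compl

theorem deltaCurve_mem_isolating (h : IsSymmetricContour L E k g) {l : ℕ} (hl : 1 ≤ l)
    (hl' : l ≤ k) (t : ℝ) : deltaCurve g l t ∈ isolating k g l := by
  refine ⟨h.deltaCurve_notMem_arcSet hl hl' t, mem_iInter₂.mpr fun l' hm => ?_⟩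
  have hm' := Finset.mem_Icc.mp (Finset.mem_of_mem_erase hm)
  exact h.deltaCurve_notMem_range hl hl' hm'.1 hm'.2 (Finset.ne_of_mem_erase hm).symm t

theorem notMem_deltaSet_of_isolating (h : IsSymmetricContour L E k g) {l : ℕ} {z : ℂ}
    (hz : z ∈ isolating k g l) (hz' : z ∉ range (deltaCurve g l)) : z ∉ deltaSet k g := by
  rw [h.mem_deltaSet_iff]
  rintro (h0 | ⟨l', hm, hm', h1⟩)
  · exact hz.1 h0
  · by_cases hll : l' = l
    · exact hz' (hll ▸ h1)
    · exact mem_iInter₂.mp hz.2 l' (Finset.mem_erase.mpr ⟨hll, Finset.mem_Icc.mpr ⟨hm, hm'⟩⟩) h1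

theorem mem_domainZero_iff_of_isPreconnected (h : IsSymmetricContour L E k g)
    (hE : IsInterpolationScheme L E) (hL : IsRegularArc L) {P : Set ℂ} (hP : IsPreconnected P)
    (hPΔ : ∀ z ∈ P, z ∉ deltaSet k g) {x y : ℂ} (hx : x ∈ P) (hy : y ∈ P) :
    (x : OnePoint ℂ) ∈ domainZero L E k g ↔ (y : OnePoint ℂ) ∈ domainZero L E k g := by
  have := eq_of_isPreconnected (f := fun z : ℂ => (z : OnePoint ℂ) ∈ domainZero L E k g) hP
    (fun z hz => (h.eventually_mem_domainZero_iff hE hL (hPΔ z hz)).mono fun y hy => propext hy)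
    hx hy
  exact iff_of_eq this

theorem left_mem_domainZero (h : IsSymmetricContour L E k g) (hE : IsInterpolationScheme L E)
    (hL : IsRegularArc L) {l : ℕ} (hl : 1 ≤ l) (hl' : l ≤ k) {t : ℝ} {P N : Set ℂ}
    (hPN : LocalSides (deltaCurve g l) (range (deltaCurve g l)) t P N)
    (hP : P ⊆ isolating k g l) {z : ℂ} (hz : z ∈ P) : (z : OnePoint ℂ) ∈ domainZero L E k g := by
  obtain ⟨ε, h1, h2⟩ := ((h.oriented l hl hl' t).and hPN.left_mem.self_of_nhds).exists
  exact (h.mem_domainZero_iff_of_isPreconnected hE hL hPN.preconnected_left (fun y hy =>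
    h.notMem_deltaSet_of_isolating (hP hy) (hPN.left_subset hy)) hz h2).mpr h1

/-- A closed curve `Δ_l` with `D_Δ^0` on both sides is impossible by the maximum principle. -/
theorem exists_not_mem_domainZero (h : IsSymmetricContour L E k g)
    (hE : IsInterpolationScheme L E) (hL : IsRegularArc L) {l : ℕ} (hl : 1 ≤ l) (hl' : l ≤ k)
    {U : Set ℂ} (hU : IsOpen U) (hUΔ : range (deltaCurve g l) ⊆ U) :
    ∃ z ∈ U, z ∉ range (deltaCurve g l) ∧ (z : OnePoint ℂ) ∉ domainZero L E k g := by
  by_contra! hcon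
  have hc := (h.isSmoothJordanCurve_deltaCurve hl hl').isCompact_range
  set C := range (deltaCurve g l) with hC
  set W := U ∩ (arcSet (delta0 g))ᶜ with hW
  have hWo : IsOpen W := hU.inter h.isRegularArc_delta0.isClosed.isOpen_compl
  have hCW : C ⊆ W := fun z hz => ⟨hUΔ hz, by
    obtain ⟨t, rfl⟩ := hz
    exact h.deltaCurve_notMem_arcSet hl hl' t⟩
  -- On a thin neighbourhood V of the curve all b_i with large i would be holomorphic, and they
  -- would tend to 0 uniformly on its frontier.
  obtain ⟨δ, hδ, hδW⟩ := hc.exists_cthickening_subset_open hWo hCW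
  set V := Metric.thickening δ C with hV
  have hclV : closure V ⊆ W := (Metric.closure_thickening_subset_cthickening δ C).trans hδW
  have hCV : C ⊆ V := Metric.self_subset_thickening hδ C
  have hVb : Bornology.IsBounded V := hc.isBounded.thickening
  have hF : IsCompact (frontier V) :=
    hVb.isCompact_closure.of_isClosed_subset isClosed_frontier frontier_subset_closure
  have hFC : ∀ z ∈ frontier V, z ∉ C := fun z hz hzC => by
    rw [Metric.isOpen_thickening.frontier_eq] at hz
    exact hz.2 (hCV hzC)
  have hFW : ∀ z ∈ frontier V, z ∈ W := fun z hz => hclV (frontier_subset_closure hz)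
  have hFzero : TendsZeroOn L E ((fun z : ℂ => phi (delta0 g) z) '' frontier V) := by
    refine h.tendsZeroOn_of_isCompact hE hL (hF.image_of_continuousOn fun z hz =>
      (h.differentiableAt_phi (hFW z hz).2).continuousAt.continuousWithinAt) ?_
    rintro _ ⟨z, hz, rfl⟩
    have h1 := (mem_domainZero L E k g).mp (hcon z (hFW z hz).1 (hFC z hz))
    exact ⟨mt (h.phi_mem_gammaUnion (hFW z hz).2).mp h1.1, h1.2⟩
  obtain ⟨M, hM0, hM⟩ := h.exists_norm_blaschkeDen_le
  -- On the curve itself |b_i| ≥ 1/M by inversion symmetry, so the maximum principle with 1/(2M) on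
  -- the frontier is contradictory.
  obtain ⟨i, hi, hi'⟩ := (h.regular.and (hFzero (1 / (2 * M)) (by positivity))).exists
  have hden : ∀ z ∈ W, blaschkeDen L E i (phi (delta0 g) z) ≠ 0 := by
    intro z hz
    by_cases hzC : z ∈ C
    · exact (h.blaschke_ne_zero hE hL ((h.phi_mem_gammaUnion hz.2).mpr
        (h.range_subset_deltaSet hl hl' hzC)) i).2
    · exact (hi _).1 ((mem_domainZero L E k g).mp (hcon z hz.1 hzC)).2
  have hdiff : DifferentiableOn ℂ (fun z : ℂ => blaschkeNum L E i (phi (delta0 g) z) /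
      blaschkeDen L E i (phi (delta0 g) z)) W := by
    intro z hz
    have hp := h.differentiableAt_phi hz.2
    exact (((differentiable_blaschkeNum L E i _).comp z hp).div
      ((differentiable_blaschkeDen L E i _).comp z hp) (hden z hz)).differentiableWithinAt
  have hz0 : deltaCurve g l 0 ∈ C := mem_range_self 0
  have hmax := Complex.norm_le_of_forall_mem_frontier_norm_le hVb
    (DifferentiableOn.diffContOnCl (hdiff.mono hclV)) (C := 1 / (2 * M)) (fun z hz => by
      rw [norm_div, div_le_iff₀ (norm_pos_iff.mpr (hden z (hFW z hz)))]
      exact hi' _ ⟨z, hz, rfl⟩) (subset_closure (hCV hz0))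
  have hd := norm_pos_iff.mpr (hden _ (hCW hz0))
  rw [norm_div, div_le_iff₀ hd] at hmax
  have := hM i _ ((h.phi_mem_gammaUnion (hCW hz0).2).mpr (h.range_subset_deltaSet hl hl' hz0))
  have h3 := mul_le_mul_of_nonneg_left hmax hM0.le
  rw [← mul_assoc, show M * (1 / (2 * M)) = 1 / 2 by field_simp] at h3
  linarith

/-- Whether the right-hand side lies in D_Δ^0 does not depend on the position along the curve. If it
did lie there, D_Δ^0 would fill a punctured neighbourhood of the whole curve. -/
theorem right_notMem_domainZero (h : IsSymmetricContour L E k g) (hE : IsInterpolationScheme L E)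
    (hL : IsRegularArc L) {l : ℕ} (hl : 1 ≤ l) (hl' : l ≤ k) {t : ℝ} {P N : Set ℂ}
    (hPN : LocalSides (deltaCurve g l) (range (deltaCurve g l)) t P N)
    (hN : N ⊆ isolating k g l) {z : ℂ} (hz : z ∈ N) : (z : OnePoint ℂ) ∉ domainZero L E k g := by
  intro hz0
  have hs := h.isSmoothJordanCurve_deltaCurve hl hl'
  have hopen := h.isOpen_isolating l
  have hmem := h.deltaCurve_mem_isolating hl hl'
  have hsides : ∀ u : ℝ, ∃ P N : Set ℂ,
      LocalSides (deltaCurve g l) (range (deltaCurve g l)) u P N ∧ P ⊆ isolating k g l ∧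
        N ⊆ isolating k g l := fun u => by
    obtain ⟨P, N, -, h1, h2, h3, -⟩ := hs.exists_sides u (hopen.mem_nhds (hmem u))
    exact ⟨P, N, h1, h2, h3⟩
  choose P' N' hPN' hP' hN' using hsides
  set r : ℝ → Prop := fun u => ∀ᶠ ε : ℝ in 𝓝[>] 0,
    ((deltaCurve g l u - ε * (Complex.I * deriv (deltaCurve g l) u) : ℂ) : OnePoint ℂ) ∈
      domainZero L E k g with hr
  have hiff : ∀ {u : ℝ} {N : Set ℂ}, IsPreconnected N → (∀ y ∈ N, y ∉ deltaSet k g) →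
      (∀ᶠ ε : ℝ in 𝓝[>] 0, deltaCurve g l u - ε * (Complex.I * deriv (deltaCurve g l) u) ∈ N) →
      ∀ y ∈ N, (r u ↔ (y : OnePoint ℂ) ∈ domainZero L E k g) := by
    intro u N hNc hNΔ hu y hy
    refine ⟨fun hru => ?_, fun hy0 => hu.mono fun ε hε =>
      (h.mem_domainZero_iff_of_isPreconnected hE hL hNc hNΔ hε hy).mpr hy0⟩
    obtain ⟨ε, h1, h2⟩ := (hu.and hru).exists
    exact (h.mem_domainZero_iff_of_isPreconnected hE hL hNc hNΔ h1 hy).mp h2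
  have hΔ' : ∀ u, ∀ y ∈ N' u, y ∉ deltaSet k g := fun u y hy =>
    h.notMem_deltaSet_of_isolating (hN' u hy) ((hPN' u).right_subset hy)
  have hloc : ∀ u, ∀ᶠ u' in 𝓝 u, r u' = r u := by
    intro u
    obtain ⟨ε, hε⟩ := (hPN' u).right_mem.self_of_nhds.exists
    filter_upwards [(hPN' u).right_mem] with u' hu'
    exact propext ((hiff (hPN' u).preconnected_right (hΔ' u) hu' _ hε).trans
      (hiff (hPN' u).preconnected_right (hΔ' u) (hPN' u).right_mem.self_of_nhds _ hε).symm)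
  have hrt : r t := (hiff hPN.preconnected_right (fun y hy =>
    h.notMem_deltaSet_of_isolating (hN hy) (hPN.right_subset hy)) hPN.right_mem.self_of_nhds z
      hz).mpr hz0
  have hrall : ∀ u, r u := fun u => by
    rw [eq_of_isPreconnected (f := r) isPreconnected_univ (fun u _ => hloc u) (mem_univ u)
      (mem_univ t)]
    exact hrt
  obtain ⟨y, hyU, hyC, hy0⟩ := h.exists_not_mem_domainZero hE hL hl hl'
    (U := {y | ∀ᶠ x in 𝓝 y, x ∈ range (deltaCurve g l) ∨ (x : OnePoint ℂ) ∈ domainZero L E k g})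
    isOpen_setOfPred_eventually_nhds (by
      rintro _ ⟨u, rfl⟩
      filter_upwards [(hPN' u).cover] with x hx
      refine hx.imp_right fun hx => hx.elim
        (fun hx => h.left_mem_domainZero hE hL hl hl' (hPN' u) (hP' u) hx) fun hx => ?_
      exact (hiff (hPN' u).preconnected_right (hΔ' u) (hPN' u).right_mem.self_of_nhds x hx).mp
        (hrall u))
  exact hyU.self_of_nhds.elim hyC hy0

/-! ### Winding numbers -/

open Classical in
/-- The number of the curves `Δ_l`, `l > 0`, around a point, counted with orientation, in terms of
the domain that contains the point. -/
theorem sum_windingNumber (h : IsSymmetricContour L E k g) (hE : IsInterpolationScheme L E)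
    (hL : IsRegularArc L) {z : ℂ} (hz : z ∉ deltaSet k g) :
    ∑ l ∈ Finset.Icc 1 k, windingNumber (deltaCurve g l) z =
      (if (z : OnePoint ℂ) ∈ domainZero L E k g then 1 else 0) -
        if OnePoint.infty ∈ domainZero L E k g then 1 else 0 := by
  -- Crossing Δ_l from right to left raises both the winding sum and the indicator of D_Δ^0 by 1. So
  -- V extends to a locally constant function off the arc Δ_0, hence a constant, which is evaluated
  -- near infinity.
  set V : ℂ → ℂ := fun z => ∑ l ∈ Finset.Icc 1 k, windingNumber (deltaCurve g l) z -
    if (z : OnePoint ℂ) ∈ domainZero L E k g then 1 else 0 with hV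
  have hcurve : ∀ l ∈ Finset.Icc 1 k, IsSmoothJordanCurve (deltaCurve g l) := fun l hl =>
    h.isSmoothJordanCurve_deltaCurve (Finset.mem_Icc.mp hl).1 (Finset.mem_Icc.mp hl).2
  have hsum : ∀ (s : Finset ℕ) (z : ℂ), s ⊆ Finset.Icc 1 k →
      (∀ l ∈ s, z ∉ range (deltaCurve g l)) →
      ∀ᶠ y in 𝓝 z, ∑ l ∈ s, windingNumber (deltaCurve g l) y =
        ∑ l ∈ s, windingNumber (deltaCurve g l) z := by
    intro s z hs hz
    have : ∀ᶠ y in 𝓝 z, ∀ l ∈ s, windingNumber (deltaCurve g l) y =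
        windingNumber (deltaCurve g l) z :=
      (Finset.eventually_all s).mpr fun l hl =>
        (hcurve l (hs hl)).windingNumber_locallyConstant (hz l hl)
    exact this.mono fun y hy => Finset.sum_congr rfl hy
  have hloc : ∀ z ∈ (arcSet (delta0 g))ᶜ, ∃ c : ℂ, ∀ᶠ y in 𝓝 z, y ∉ deltaSet k g → V y = c := by
    intro z hz
    by_cases hzΔ : z ∈ deltaSet k g
    · obtain ⟨l, hl, hl', t, rfl⟩ := (h.mem_deltaSet_iff.mp hzΔ).resolve_left hz
      have hlI : l ∈ Finset.Icc 1 k := Finset.mem_Icc.mpr ⟨hl, hl'⟩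
      have hiso := h.deltaCurve_mem_isolating hl hl' t
      obtain ⟨P, N, m, hPN, hP, hN, hPm, hNm⟩ := (hcurve l hlI).exists_sides t
        ((h.isOpen_isolating l).mem_nhds hiso)
      refine ⟨∑ l' ∈ (Finset.Icc 1 k).erase l, windingNumber (deltaCurve g l') (deltaCurve g l t) +
        (m - 1), ?_⟩
      filter_upwards [hPN.cover, hsum _ _ (Finset.erase_subset l _)
        (fun l' hm => mem_iInter₂.mp hiso.2 l' hm)] with y hy hys hyΔ
      simp only [hV]
      rw [← Finset.sum_erase_add _ _ hlI, hys]
      rcases hy with hy | hy | hy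
      · exact absurd (h.range_subset_deltaSet hl hl' hy) hyΔ
      · rw [hPm y hy, if_pos (h.left_mem_domainZero hE hL hl hl' hPN hP hy)]
        ring
      · rw [hNm y hy, if_neg (h.right_notMem_domainZero hE hL hl hl' hPN hN hy)]
        ring
    · refine ⟨V z, ?_⟩
      filter_upwards [hsum _ z subset_rfl fun l hl hzl => hzΔ (h.range_subset_deltaSet
        (Finset.mem_Icc.mp hl).1 (Finset.mem_Icc.mp hl).2 hzl),
        h.eventually_mem_domainZero_iff hE hL hzΔ] with y h1 h2 _
      simp only [hV]
      rw [h1]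
      simp only [h2]
  choose! c hc using hloc
  obtain ⟨V', hV'1, hV'2⟩ := exists_glue (g := V) h.dense_compl_deltaSet
    h.isRegularArc_delta0.isClosed.isOpen_compl (fun z _ => c z)
    (fun z _ => Eventually.of_forall fun y => continuousAt_const) hc
  have hfar : ∀ᶠ y in cocompact ℂ, ∀ l ∈ Finset.Icc 1 k, windingNumber (deltaCurve g l) y = 0 :=
    (Finset.eventually_all _).mpr fun l hl => (hcurve l hl).windingNumber_cocompact
  obtain ⟨y, ⟨hy1, hy2⟩, hy3⟩ := ((hfar.and (h.eventually_cocompact_mem_domainZero_iff hE hL)).and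
    h.isCompact_deltaSet.compl_mem_cocompact).exists
  have hVy : V y = -if OnePoint.infty ∈ domainZero L E k g then 1 else 0 := by
    simp only [hV]
    rw [Finset.sum_eq_zero hy1, zero_sub]
    simp only [hy2]
  have hVz : V z = V y := by
    rw [← hV'2 z (h.notMem_arcSet hz) hz, ← hV'2 y (h.notMem_arcSet hy3) hy3]
    exact h.isRegularArc_delta0.eq_of_locallyConstant (fun z hz => (hV'1 z hz).mono fun y hy =>
      hy.trans (hV'1 z hz).self_of_nhds.symm) (h.notMem_arcSet hz) (h.notMem_arcSet hy3)
  rw [hVy] at hVz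
  simp only [hV] at hVz
  linear_combination hVz

end IsSymmetricContour

/-! ### Polynomial factors in Cauchy transforms -/

/-- The Cauchy transform of a polynomial multiple of a density. -/
theorem exists_polynomial_cauchyTransform {γ b : ℝ → ℂ} {x y : ℝ} (hγ : Continuous γ) (hxy : x ≤ y)
    (hb : IntervalIntegrable b MeasureTheory.volume x y) (P : ℂ[X]) :
    ∃ Q : ℂ[X], ∀ z ∉ γ '' Icc x y, cauchyTransform γ (fun t => P.eval (γ t) * b t) x y z =
      P.eval z * cauchyTransform γ b x y z + Q.eval z := by
  have hint : ∀ (P : ℂ[X]), IntervalIntegrable (fun t => P.eval (γ t) * b t)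
      MeasureTheory.volume x y := fun P =>
    intervalIntegrable_comp_mul hγ hxy hb (f := fun s => P.eval s) P.continuous.continuousOn
  induction P using Polynomial.induction_on with
  | C c =>
    refine ⟨0, fun z _ => ?_⟩
    simp only [eval_C, cauchyTransform, mul_left_comm _ c, eval_zero, add_zero,
      intervalIntegral.integral_const_mul]
  | add p q hp hq =>
    obtain ⟨Q₁, h₁⟩ := hp
    obtain ⟨Q₂, h₂⟩ := hq
    refine ⟨Q₁ + Q₂, fun z hz => ?_⟩
    have : cauchyTransform γ (fun t => (p + q).eval (γ t) * b t) x y z =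
        cauchyTransform γ (fun t => p.eval (γ t) * b t) x y z +
          cauchyTransform γ (fun t => q.eval (γ t) * b t) x y z := by
      unfold cauchyTransform
      rw [← intervalIntegral.integral_add (intervalIntegrable_cauchy hγ hxy (hint p) hz)
        (intervalIntegrable_cauchy hγ hxy (hint q) hz)]
      simp only [eval_add, add_mul, mul_add]
    rw [this, h₁ z hz, h₂ z hz]
    simp only [eval_add]
    ring
  | monomial n c ih =>
    obtain ⟨Q, hQ⟩ := ih
    -- From s/(s − z) = z/(s − z) + 1: each further power of s contributes one moment of the
    -- density.
    refine ⟨X * Q + C (∫ t in x..y, (C c * X ^ n).eval (γ t) * b t), fun z hz => ?_⟩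
    have : cauchyTransform γ (fun t => (C c * X ^ (n + 1)).eval (γ t) * b t) x y z =
        z * cauchyTransform γ (fun t => (C c * X ^ n).eval (γ t) * b t) x y z +
          ∫ t in x..y, (C c * X ^ n).eval (γ t) * b t := by
      unfold cauchyTransform
      rw [← intervalIntegral.integral_const_mul, ← intervalIntegral.integral_add
        ((intervalIntegrable_cauchy hγ hxy (hint _) hz).const_mul z) (hint _)]
      refine intervalIntegral.integral_congr fun t ht => ?_
      rw [uIcc_of_le hxy] at ht
      have hne : γ t - z ≠ 0 := fun h0 => hz ⟨t, ht, sub_eq_zero.mp h0⟩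
      simp only [eval_mul, eval_C, eval_pow, eval_X]
      field_simp
      ring
    rw [this, hQ z hz]
    simp only [eval_mul, eval_C, eval_pow, eval_X, eval_add]
    ring

/-! ### Cauchy integrals over `Δ` -/

theorem varsigma_mul_self (L : ℝ → ℂ) (E : ℕ → Multiset (OnePoint ℂ)) (k : ℕ) (g : ℕ → ℝ → ℂ) :
    varsigma L E k g * varsigma L E k g = 1 := by
  unfold varsigma
  split_ifs <;> norm_num

/-- The Cauchy integral of `f ds / w` over the contour, with `w = σ w_{Δ_0 +}` on the arc. -/
def deltaCauchy (σ : ℂ) (k : ℕ) (g : ℕ → ℝ → ℂ) (f : ℂ → ℂ) (z : ℂ) : ℂ :=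
  σ * cauchyTransform (delta0 g) (fun t => f (delta0 g t) * traceDensity (delta0 g) t) 0 1 z +
    ∑ l ∈ Finset.Icc 1 k, cauchyTransform (deltaCurve g l) (fun t =>
      f (deltaCurve g l t) / wBranch (delta0 g) (deltaCurve g l t) * deriv (deltaCurve g l) t) 0 1 z

theorem deltaIntegral_eq_deltaCauchy (L : ℝ → ℂ) (E : ℕ → Multiset (OnePoint ℂ)) (k : ℕ)
    (g : ℕ → ℝ → ℂ) (f : ℂ → ℂ) (z : ℂ) :
    deltaIntegral L E k g (fun s => f s / (s - z)) = deltaCauchy (varsigma L E k g) k g f z := by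
  have hσ := varsigma_mul_self L E k g
  have hσ' : (varsigma L E k g)⁻¹ = varsigma L E k g := inv_eq_of_mul_eq_one_right hσ
  unfold deltaIntegral deltaCauchy
  congr 1
  · unfold pathIntegral cauchyTransform integrandZero traceDensity
    rw [← intervalIntegral.integral_const_mul]
    congr 1
    ext t
    rw [div_eq_mul_inv _ (varsigma L E k g * _), mul_inv, hσ']
    ring
  · refine Finset.sum_congr rfl fun l _ => ?_
    unfold pathIntegral cauchyTransform integrandCurve
    congr 1
    ext t
    ring

theorem rhoHatDelta_eq (L : ℝ → ℂ) (E : ℕ → Multiset (OnePoint ℂ)) (k : ℕ)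
    (g : ℕ → ℝ → ℂ) (ρ : ℂ → ℂ) (z : ℂ) :
    rhoHatDelta L E k g ρ z =
      (2 * Real.pi * Complex.I)⁻¹ * deltaCauchy (varsigma L E k g) k g ρ z := by
  rw [rhoHatDelta, deltaIntegral_eq_deltaCauchy]

theorem rhoHat_eq (L : ℝ → ℂ) (ρ : ℂ → ℂ) (z : ℂ) :
    rhoHat L ρ z = (2 * Real.pi * Complex.I)⁻¹ *
      cauchyTransform L (fun t => ρ (L t) * traceDensity L t) 0 1 z := by
  unfold rhoHat pathIntegral cauchyTransform traceDensity
  congr 2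
  ext t
  ring

namespace IsSymmetricContour

variable {L : ℝ → ℂ} {E : ℕ → Multiset (OnePoint ℂ)} {k : ℕ} {g : ℕ → ℝ → ℂ}

theorem intervalIntegrable_arc (h : IsSymmetricContour L E k g) {f : ℂ → ℂ}
    (hf : ContinuousOn f (deltaSet k g)) :
    IntervalIntegrable (fun t => f (delta0 g t) * traceDensity (delta0 g) t)
      MeasureTheory.volume 0 1 :=
  intervalIntegrable_comp_mul h.contDiff_delta0.continuous zero_le_one
    h.intervalIntegrable_traceDensity (hf.mono h.arcSet_subset_deltaSet)

theorem intervalIntegrable_curve (h : IsSymmetricContour L E k g) {f : ℂ → ℂ}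
    (hf : ContinuousOn f (deltaSet k g)) {l : ℕ} (hl : l ∈ Finset.Icc 1 k) :
    IntervalIntegrable (fun t => f (deltaCurve g l t) / wBranch (delta0 g) (deltaCurve g l t) *
      deriv (deltaCurve g l) t) MeasureTheory.volume 0 1 := by
  rw [Finset.mem_Icc] at hl
  have hs := h.isSmoothJordanCurve_deltaCurve hl.1 hl.2
  have hr := h.isRegularArc_delta0
  have hsub : deltaCurve g l '' Icc 0 1 ⊆ (arcSet (delta0 g))ᶜ := by
    rintro _ ⟨t, -, rfl⟩
    exact h.deltaCurve_notMem_arcSet hl.1 hl.2 t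
  refine intervalIntegrable_comp_mul hs.contDiff.continuous zero_le_one
    (intervalIntegrable_deriv hs.contDiff) (f := fun s => f s / wBranch (delta0 g) s) ?_
  refine (hf.mono ((image_subset_range _ _).trans (h.range_subset_deltaSet hl.1 hl.2))).div
    (fun z hz => (hr.wBranch_differentiableAt (hsub hz)).continuousAt.continuousWithinAt)
    fun z hz => hr.wBranch_ne_zero (hsub hz)

theorem notMem_image_curve (h : IsSymmetricContour L E k g) {l : ℕ} (hl : l ∈ Finset.Icc 1 k)
    {z : ℂ} (hz : z ∉ deltaSet k g) : z ∉ deltaCurve g l '' Icc 0 1 := fun hz' =>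
  hz (h.range_subset_deltaSet (Finset.mem_Icc.mp hl).1 (Finset.mem_Icc.mp hl).2
    (image_subset_range _ _ hz'))

theorem continuous_deltaCurve (h : IsSymmetricContour L E k g) {l : ℕ}
    (hl : l ∈ Finset.Icc 1 k) : Continuous (deltaCurve g l) :=
  (h.isSmoothJordanCurve_deltaCurve (Finset.mem_Icc.mp hl).1
    (Finset.mem_Icc.mp hl).2).contDiff.continuous

theorem deltaIntegrable (h : IsSymmetricContour L E k g) {f : ℂ → ℂ}
    (hf : ContinuousOn f (deltaSet k g)) {z : ℂ} (hz : z ∉ deltaSet k g) :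
    DeltaIntegrable L E k g fun s => f s / (s - z) := by
  have hfz : ContinuousOn (fun s => f s / (s - z)) (deltaSet k g) := by
    simp only [div_eq_mul_inv]
    exact hf.mul (continuousOn_inv_sub_const hz)
  refine ⟨((h.intervalIntegrable_arc hfz).const_mul (varsigma L E k g)⁻¹).congr
    fun t _ => ?_, fun l hl => h.intervalIntegrable_curve hfz hl⟩
  simp only [integrandZero, traceDensity, div_eq_mul_inv, mul_inv]
  ring

theorem differentiableOn_deltaCauchy (h : IsSymmetricContour L E k g) {f : ℂ → ℂ}
    (hf : ContinuousOn f (deltaSet k g)) (σ : ℂ) :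
    DifferentiableOn ℂ (deltaCauchy σ k g f) (deltaSet k g)ᶜ := by
  refine DifferentiableOn.add (((differentiableOn_cauchyTransform h.contDiff_delta0.continuous
    zero_le_one (h.intervalIntegrable_arc hf)).mono fun z hz => h.notMem_arcSet hz).const_mul σ)
    (DifferentiableOn.fun_sum fun l hl => ?_)
  exact (differentiableOn_cauchyTransform (h.continuous_deltaCurve hl) zero_le_one
    (h.intervalIntegrable_curve hf hl)).mono fun z hz => h.notMem_image_curve hl hz

theorem tendsto_deltaCauchy_cocompact (h : IsSymmetricContour L E k g) {f : ℂ → ℂ}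
    (hf : ContinuousOn f (deltaSet k g)) (σ : ℂ) :
    Tendsto (deltaCauchy σ k g f) (cocompact ℂ) (𝓝 0) := by
  have h1 := (tendsto_cauchyTransform_cocompact h.contDiff_delta0.continuous
    zero_le_one (h.intervalIntegrable_arc hf)).const_mul σ
  have h2 := tendsto_finsetSum (Finset.Icc 1 k) fun l hl =>
    tendsto_cauchyTransform_cocompact (h.continuous_deltaCurve hl) zero_le_one
      (h.intervalIntegrable_curve hf hl)
  have := h1.add h2
  rw [mul_zero, Finset.sum_const_zero, add_zero] at this
  exact this

/-- Both densities, (q/v)ρ and ρ, are polynomial multiples of ρ/v, with factors q and v. In the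
combination v · (first) − q · (second) the transform of ρ/v cancels. -/
theorem exists_polynomial_deltaCauchy (h : IsSymmetricContour L E k g) {ρ : ℂ → ℂ}
    (hρ : ContinuousOn ρ (deltaSet k g)) {v : ℂ[X]} (hv : ∀ z ∈ deltaSet k g, v.eval z ≠ 0)
    (q : ℂ[X]) (σ : ℂ) :
    ∃ Q : ℂ[X], ∀ z ∉ deltaSet k g,
      v.eval z * deltaCauchy σ k g (fun s => q.eval s / v.eval s * ρ s) z =
        q.eval z * deltaCauchy σ k g ρ z + Q.eval z := by
  have hf : ContinuousOn (fun s => ρ s / v.eval s) (deltaSet k g) :=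
    hρ.div v.continuous.continuousOn hv
  obtain ⟨Q₁, h₁⟩ := exists_polynomial_cauchyTransform h.contDiff_delta0.continuous zero_le_one
    (h.intervalIntegrable_arc hf) q
  obtain ⟨Q₂, h₂⟩ := exists_polynomial_cauchyTransform h.contDiff_delta0.continuous zero_le_one
    (h.intervalIntegrable_arc hf) v
  have key : ∀ P : ℂ[X], ∀ l ∈ Finset.Icc 1 k, ∃ Q : ℂ[X], ∀ z ∉ deltaCurve g l '' Icc 0 1, _ :=
    fun P l hl => exists_polynomial_cauchyTransform (h.continuous_deltaCurve hl) zero_le_one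
      (h.intervalIntegrable_curve hf hl) P
  choose! Q hQ using key
  refine ⟨C σ * (v * Q₁ - q * Q₂) + ∑ l ∈ Finset.Icc 1 k, (v * Q q l - q * Q v l), fun z hz => ?_⟩
  have harc := h.notMem_arcSet hz
  have e₁ := h₁ z harc
  have e₂ := h₂ z harc
  simp only [deltaCauchy]
  have n1 : cauchyTransform (delta0 g) (fun t => q.eval (delta0 g t) / v.eval (delta0 g t) *
      ρ (delta0 g t) * traceDensity (delta0 g) t) 0 1 z = cauchyTransform (delta0 g) (fun t =>
      q.eval (delta0 g t) * (ρ (delta0 g t) / v.eval (delta0 g t) *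
        traceDensity (delta0 g) t)) 0 1 z := by
    congr 1
    ext t
    ring
  have n2 : cauchyTransform (delta0 g) (fun t => ρ (delta0 g t) * traceDensity (delta0 g) t) 0 1 z =
      cauchyTransform (delta0 g) (fun t =>
      v.eval (delta0 g t) * (ρ (delta0 g t) / v.eval (delta0 g t) *
        traceDensity (delta0 g) t)) 0 1 z := by
    refine intervalIntegral.integral_congr fun t ht => ?_
    rw [uIcc_of_le zero_le_one] at ht
    have := hv _ (h.arcSet_subset_deltaSet ⟨t, ht, rfl⟩)
    field_simp
  rw [n1, n2, e₁, e₂]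
  have hsum : ∀ l ∈ Finset.Icc 1 k, v.eval z * cauchyTransform (deltaCurve g l) (fun t =>
      q.eval (deltaCurve g l t) / v.eval (deltaCurve g l t) * ρ (deltaCurve g l t) /
        wBranch (delta0 g) (deltaCurve g l t) * deriv (deltaCurve g l) t) 0 1 z =
      q.eval z * cauchyTransform (deltaCurve g l) (fun t => ρ (deltaCurve g l t) /
        wBranch (delta0 g) (deltaCurve g l t) * deriv (deltaCurve g l) t) 0 1 z +
      (v * Q q l - q * Q v l).eval z := by
    intro l hl
    have hzl := h.notMem_image_curve hl hz
    have f₁ := hQ q l hl z hzl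
    have f₂ := hQ v l hl z hzl
    have m1 : cauchyTransform (deltaCurve g l) (fun t =>
        q.eval (deltaCurve g l t) / v.eval (deltaCurve g l t) * ρ (deltaCurve g l t) /
        wBranch (delta0 g) (deltaCurve g l t) * deriv (deltaCurve g l) t) 0 1 z =
        cauchyTransform (deltaCurve g l) (fun t => q.eval (deltaCurve g l t) *
          (ρ (deltaCurve g l t) / v.eval (deltaCurve g l t) /
        wBranch (delta0 g) (deltaCurve g l t) * deriv (deltaCurve g l) t)) 0 1 z := by
      congr 1
      ext t
      ring
    have m2 : cauchyTransform (deltaCurve g l) (fun t => ρ (deltaCurve g l t) /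
        wBranch (delta0 g) (deltaCurve g l t) * deriv (deltaCurve g l) t) 0 1 z =
        cauchyTransform (deltaCurve g l) (fun t => v.eval (deltaCurve g l t) *
          (ρ (deltaCurve g l t) / v.eval (deltaCurve g l t) /
        wBranch (delta0 g) (deltaCurve g l t) * deriv (deltaCurve g l) t)) 0 1 z := by
      refine intervalIntegral.integral_congr fun t ht => ?_
      have := hv _ (h.range_subset_deltaSet (Finset.mem_Icc.mp hl).1 (Finset.mem_Icc.mp hl).2
        (mem_range_self t))
      field_simp
    rw [m1, m2, f₁, f₂]
    simp only [eval_sub, eval_mul]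
    ring
  have hs := Finset.sum_congr rfl hsum
  rw [← Finset.mul_sum, Finset.sum_add_distrib, ← Finset.mul_sum] at hs
  simp only [eval_add, eval_finsetSum, eval_sub, eval_mul, eval_C] at hs ⊢
  linear_combination hs

end IsSymmetricContour

/-! ### Comparison of the Cauchy integrals over `L` and `Δ` -/

/-- The sum of the two branches is 2z + O(1). Hence U_b is bounded and U_u contains a neighbourhood
of infinity. -/
theorem eventually_wBranch_ne_neg {γ₁ γ₂ : ℝ → ℂ} (h₁ : IsRegularArc γ₁) (h₂ : IsRegularArc γ₂) :
    ∀ᶠ z in cocompact ℂ, wBranch γ₁ z ≠ -wBranch γ₂ z := by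
  obtain ⟨C₁, hC₁⟩ := (wBranch_isBigO h₁.contDiff).bound
  obtain ⟨C₂, hC₂⟩ := (wBranch_isBigO h₂.contDiff).bound
  filter_upwards [hC₁, hC₂, (tendsto_norm_cocompact_atTop (E := ℂ)).eventually_gt_atTop (C₁ + C₂)]
    with z h1 h2 h3 hw
  rw [norm_one, mul_one] at h1 h2
  have h4 := norm_add_le (wBranch γ₁ z - z) (wBranch γ₂ z - z)
  rw [show wBranch γ₁ z - z + (wBranch γ₂ z - z) = -(2 * z) by rw [hw]; ring, norm_neg,
    norm_mul, Complex.norm_ofNat] at h4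
  linarith [norm_nonneg (wBranch γ₁ z - z), norm_nonneg (wBranch γ₂ z - z)]

theorem wBranch_eq_or_eq_neg {γ₁ γ₂ : ℝ → ℂ} (h₁ : IsRegularArc γ₁) (h₂ : IsRegularArc γ₂) {z : ℂ}
    (hz₁ : z ∉ arcSet γ₁) (hz₂ : z ∉ arcSet γ₂) :
    wBranch γ₁ z = wBranch γ₂ z ∨ wBranch γ₁ z = -wBranch γ₂ z :=
  sq_eq_sq_iff_eq_or_eq_neg.mp ((h₁.wBranch_sq hz₁).trans (h₂.wBranch_sq hz₂).symm)

namespace IsSymmetricContour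

variable {L : ℝ → ℂ} {E : ℕ → Multiset (OnePoint ℂ)} {k : ℕ} {g : ℕ → ℝ → ℂ}

theorem closure_curveInterior_subset_compl (h : IsSymmetricContour L E k g) {l : ℕ} (hl : 1 ≤ l)
    (hl' : l ≤ k) :
    closure (curveInterior (range (deltaCurve g l))) ⊆ (arcSet (delta0 g))ᶜ := by
  intro z hz hz0
  rcases closure_curveInterior_subset
    (h.isSmoothJordanCurve_deltaCurve hl hl').isCompact_range.isClosed hz with h1 | ⟨t, rfl⟩
  · exact Set.disjoint_left.mp (h.exterior l hl hl') hz0 h1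
  · exact h.deltaCurve_notMem_arcSet hl hl' t hz0

/-- Cauchy's formula for ρ/w_{Δ_0} on each closed curve. The quotient is analytic on the closed
interiors because Δ_0 lies in the exteriors. -/
theorem deltaCauchy_eq (h : IsSymmetricContour L E k g) {ρ : ℂ → ℂ} {G : Set ℂ} (hG : IsOpen G)
    (hρ : DifferentiableOn ℂ ρ G)
    (hGl : ∀ l, 1 ≤ l → l ≤ k → closure (curveInterior (range (deltaCurve g l))) ⊆ G) (σ : ℂ)
    {z : ℂ} (hz : z ∉ deltaSet k g) :
    deltaCauchy σ k g ρ z =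
      σ * cauchyTransform (delta0 g) (fun t => ρ (delta0 g t) * traceDensity (delta0 g) t) 0 1 z +
        2 * Real.pi * Complex.I * ((∑ l ∈ Finset.Icc 1 k, windingNumber (deltaCurve g l) z) *
          (ρ z / wBranch (delta0 g) z)) := by
  have hr := h.isRegularArc_delta0
  unfold deltaCauchy
  rw [Finset.sum_mul, Finset.mul_sum]
  congr 1
  refine Finset.sum_congr rfl fun l hl => ?_
  have hl' := Finset.mem_Icc.mp hl
  refine (h.isSmoothJordanCurve_deltaCurve hl'.1 hl'.2).cauchyTransform_mul_deriv
    (hG.inter hr.isClosed.isOpen_compl) (subset_inter (hGl l hl'.1 hl'.2)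
      (h.closure_curveInterior_subset_compl hl'.1 hl'.2))
    (f := fun s => ρ s / wBranch (delta0 g) s) ?_
    fun h' => hz (h.range_subset_deltaSet hl'.1 hl'.2 h')
  exact (hρ.mono inter_subset_left).div (fun s hs => (hr.wBranch_differentiableAt
    hs.2).differentiableWithinAt) fun s hs => hr.wBranch_ne_zero hs.2

/-- For ς = 1 the arcs differ by ρ/w_{Δ_0} where w_L = −w_{Δ_0}, and off D_Δ^0 the winding sum −1
removes it. For ς = −1 they differ by −ρ/w_{Δ_0} where w_L = w_{Δ_0}, and on D_Δ^0 the winding sum 1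
removes it. In the two remaining cases both terms are zero. -/
theorem rhoHatDelta_eq_rhoHat (h : IsSymmetricContour L E k g) (hE : IsInterpolationScheme L E)
    (hL : IsSmoothArc L) {ρ : ℂ → ℂ} (hρ : IsAdmissibleDensity L E k g ρ) {z : ℂ}
    (hzL : z ∉ arcSet L) (hz : z ∉ deltaSet k g)
    (hw : wBranch L z = wBranch (delta0 g) z ∧ (z : OnePoint ℂ) ∈ domainZero L E k g ∨
      wBranch L z = -wBranch (delta0 g) z ∧ (z : OnePoint ℂ) ∉ domainZero L E k g) :
    rhoHatDelta L E k g ρ z = rhoHat L ρ z := by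
  obtain ⟨⟨G, hG, -, hd, hGL, hG0, hGl, hGm, hGp⟩, -⟩ := hρ
  have h₁ := hL.isRegularArc
  have h₂ := h.isRegularArc_delta0
  have hz0 := h.notMem_arcSet hz
  have hfar := eventually_wBranch_ne_neg h₁ h₂
  rw [rhoHatDelta_eq, rhoHat_eq, h.deltaCauchy_eq hG hd hGl _ hz, h.sum_windingNumber hE h₁ hz]
  congr 1
  have hclosed : ∀ A : Set ℂ, IsClosed (arcSet L ∪ arcSet (delta0 g) ∪ closure A) := fun A =>
    (h₁.isClosed.union h₂.isClosed).union isClosed_closure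
  have hw0 := h₂.wBranch_ne_zero hz0
  by_cases hinf : OnePoint.infty ∈ domainZero L E k g
  · have hσ : varsigma L E k g = 1 := if_pos hinf
    rw [hσ, if_pos hinf]
    have hb : Bornology.IsBounded (regionMinus L g) := by
      obtain ⟨t, ht, htz⟩ := mem_cocompact.mp hfar
      exact ht.isBounded.subset fun y hy => by
        by_contra hyt
        exact htz hyt hy.2.2
    obtain ⟨c1, c2⟩ := cauchyTransform_traceDensity_sub h₁ h₂ hL.intervalIntegrable_traceDensity
      h.intervalIntegrable_traceDensity (σ := 1) (one_mul 1) hG (hclosed (regionMinus L g))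
      (union_subset (union_subset hGL hG0) (hGm hinf)) hd
      (Or.inl ⟨((isCompact_arcSet h₁.contDiff).union (isCompact_arcSet h₂.contDiff)).union
        hb.isCompact_closure, rfl⟩) (fun y hy => Or.inl (Or.inl hy))
      (fun y hy => Or.inl (Or.inr hy))
      (fun y hy1 hy2 hyw => Or.inr (subset_closure ⟨hy1, hy2, by rw [hyw]; ring⟩)) hzL hz0
    rcases hw with ⟨hw, hcls⟩ | ⟨hw, hcls⟩
    · rw [c1 (by rw [hw]; ring), if_pos hcls]
      ring
    · rw [c2 (by rw [hw]; ring), if_neg hcls]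
      ring
  · have hσ : varsigma L E k g = -1 := if_neg hinf
    rw [hσ, if_neg hinf]
    -- Here K contains a neighbourhood of infinity, so the representation of ρ needs the constant c
    -- = ρ(∞).
    obtain ⟨hGp1, -, c, hc⟩ := hGp hinf
    obtain ⟨c1, c2⟩ := cauchyTransform_traceDensity_sub h₁ h₂ hL.intervalIntegrable_traceDensity
      h.intervalIntegrable_traceDensity (σ := -1) (by norm_num) hG (hclosed (regionPlus L g))
      (union_subset (union_subset hGL hG0) hGp1) hd
      (Or.inr ⟨by
        filter_upwards [hfar, (isCompact_arcSet h₁.contDiff).compl_mem_cocompact,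
          (isCompact_arcSet h₂.contDiff).compl_mem_cocompact] with y h1 h2 h3
        exact Or.inr (subset_closure ⟨h2, h3, (wBranch_eq_or_eq_neg h₁ h₂ h2 h3).resolve_right h1⟩),
        hc⟩) (fun y hy => Or.inl (Or.inl hy)) (fun y hy => Or.inl (Or.inr hy))
      (fun y hy1 hy2 hyw => Or.inr (subset_closure ⟨hy1, hy2, by rw [hyw]; ring⟩)) hzL hz0
    rcases hw with ⟨hw, hcls⟩ | ⟨hw, hcls⟩
    · rw [c2 (by rw [hw]; ring), if_pos hcls]
      ring
    · rw [c1 (by rw [hw]; ring), if_neg hcls]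
      ring

end IsSymmetricContour

/-! ### The polynomial of the finite nodes -/

theorem nodePoly_eval_eq_zero_iff {S : Multiset (OnePoint ℂ)} {z : ℂ} :
    (nodePoly S).eval z = 0 ↔ (z : OnePoint ℂ) ∈ S := by
  unfold nodePoly
  induction S using Multiset.induction_on with
  | empty => simp
  | cons e s ih =>
    rw [Multiset.map_cons, Multiset.prod_cons, eval_mul, mul_eq_zero, ih, Multiset.mem_cons]
    refine or_congr_left ?_
    induction e using OnePoint.rec with
    | infty => simp [OnePoint.elim_infty]
    | coe u => simp [OnePoint.elim_some, sub_eq_zero]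

theorem monic_nodePoly (S : Multiset (OnePoint ℂ)) : (nodePoly S).Monic := by
  unfold nodePoly
  refine monic_multiset_prod_of_monic _ _ fun e _ => ?_
  induction e using OnePoint.rec with
  | infty => exact monic_one
  | coe u => exact monic_X_sub_C u

theorem natDegree_nodePoly {S : Multiset (OnePoint ℂ)} (hS : OnePoint.infty ∉ S) :
    (nodePoly S).natDegree = Multiset.card S := by
  induction S using Multiset.induction_on with
  | empty => simp [nodePoly]
  | cons e s ih =>
    rw [Multiset.mem_cons, not_or] at hS
    have h1 := monic_nodePoly s
    have h2 := ih hS.2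
    unfold nodePoly at h1 h2 ⊢
    rw [Multiset.map_cons, Multiset.prod_cons, Multiset.card_cons]
    induction e using OnePoint.rec with
    | infty => exact absurd rfl hS.1
    | coe u =>
      rw [OnePoint.elim_some, (monic_X_sub_C u).natDegree_mul h1, natDegree_X_sub_C, h2, add_comm]

theorem tendsto_zero_of_isBigO_inv_pow {R : ℂ → ℂ} {d : ℕ}
    (hR : R =O[cocompact ℂ] fun z => (z ^ (d + 1))⁻¹) : Tendsto R (cocompact ℂ) (𝓝 0) := by
  refine hR.trans_tendsto ?_
  have h : Tendsto (fun z : ℂ => z⁻¹) (cocompact ℂ) (𝓝 0) := by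
    rw [← Metric.cobounded_eq_cocompact]
    exact tendsto_inv₀_cobounded
  have := h.pow (d + 1)
  rw [zero_pow d.succ_ne_zero] at this
  exact this.congr fun z => inv_pow z (d + 1)

/-- A rational function that is holomorphic in the plane and vanishes at infinity is zero. -/
theorem eq_zero_of_tendsto_div {P v : ℂ[X]} (hv : v ≠ 0)
    (hloc : ∀ z, v.eval z = 0 → ∃ f : ℂ → ℂ, (∀ᶠ y in 𝓝 z, DifferentiableAt ℂ f y) ∧
      ∀ᶠ y in 𝓝 z, v.eval y ≠ 0 → P.eval y / v.eval y = f y)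
    (hlim : Tendsto (fun z => P.eval z / v.eval z) (cocompact ℂ) (𝓝 0)) : P = 0 := by
  have hfin : {z | v.eval z = 0}.Finite := by
    refine (v.roots.toFinset.finite_toSet).subset fun z hz => ?_
    simpa [hv] using hz
  have hloc' : ∀ z, ∃ f : ℂ → ℂ, (∀ᶠ y in 𝓝 z, DifferentiableAt ℂ f y) ∧
      ∀ᶠ y in 𝓝 z, y ∉ {z | v.eval z = 0} → P.eval y / v.eval y = f y := by
    intro z
    by_cases hz : v.eval z = 0
    · exact hloc z hz
    · refine ⟨_, ?_, Eventually.of_forall fun _ _ => rfl⟩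
      filter_upwards [v.continuous.continuousAt.eventually_ne hz] with y hy
      exact P.differentiableAt.div v.differentiableAt hy
  choose f hf1 hf2 using hloc'
  obtain ⟨F, hF1, hF2⟩ := exists_glue (hfin.countable.dense_compl ℂ) isOpen_univ f
    (fun z _ => (hf1 z).mono fun y hy => hy.continuousAt) fun z _ => hf2 z
  have hF : Differentiable ℂ F := fun z =>
    (hf1 z).self_of_nhds.congr_of_eventuallyEq (hF1 z trivial)
  have hlim' : Tendsto F (cocompact ℂ) (𝓝 0) := by
    refine hlim.congr' ?_
    filter_upwards [hfin.isCompact.compl_mem_cocompact] with z hz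
    exact (hF2 z trivial hz).symm
  have hmul : P * v = 0 := Polynomial.funext fun z => by
    rw [eval_mul, eval_zero]
    by_cases hz : v.eval z = 0
    · rw [hz, mul_zero]
    · have h1 := hF2 z trivial hz
      rw [hF.apply_eq_of_tendsto_cocompact z hlim'] at h1
      rw [(div_eq_zero_iff.mp h1.symm).resolve_right hz, zero_mul]
  exact (mul_eq_zero.mp hmul).resolve_right hv

/-- The factor w₁ + σ w₂ of w₁² − w₂² = 0 is nonzero at z, hence also nearby. -/
theorem eventually_wBranch_eq {γ₁ γ₂ : ℝ → ℂ} (h₁ : IsRegularArc γ₁) (h₂ : IsRegularArc γ₂) {z : ℂ}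
    (hz₁ : z ∉ arcSet γ₁) (hz₂ : z ∉ arcSet γ₂) {σ : ℂ} (hσ : σ * σ = 1)
    (hw : wBranch γ₁ z = σ * wBranch γ₂ z) :
    ∀ᶠ y in 𝓝 z, wBranch γ₁ y = σ * wBranch γ₂ y := by
  have hσ0 : σ ≠ 0 := left_ne_zero_of_mul_eq_one hσ
  have hc : ContinuousAt (fun y => wBranch γ₁ y + σ * wBranch γ₂ y) z :=
    (h₁.wBranch_differentiableAt hz₁).continuousAt.add
      ((h₂.wBranch_differentiableAt hz₂).continuousAt.const_mul σ)
  have hne : wBranch γ₁ z + σ * wBranch γ₂ z ≠ 0 := by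
    rw [hw, ← two_mul]
    exact mul_ne_zero two_ne_zero (mul_ne_zero hσ0 (h₂.wBranch_ne_zero hz₂))
  filter_upwards [hc.eventually_ne hne, h₁.isClosed.isOpen_compl.mem_nhds hz₁,
    h₂.isClosed.isOpen_compl.mem_nhds hz₂] with y hy hy1 hy2
  have : (wBranch γ₁ y + σ * wBranch γ₂ y) * (wBranch γ₁ y - σ * wBranch γ₂ y) = 0 := by
    linear_combination h₁.wBranch_sq hy1 - h₂.wBranch_sq hy2 - wBranch γ₂ y ^ 2 * hσ
  exact sub_eq_zero.mp ((mul_eq_zero.mp this).resolve_left hy)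

/-! ### The integral formula multiplied by v -/

namespace IsSymmetricContour

variable {L : ℝ → ℂ} {E : ℕ → Multiset (OnePoint ℂ)} {k : ℕ} {g : ℕ → ℝ → ℂ} {ρ : ℂ → ℂ}

theorem continuousOn_density (h : IsSymmetricContour L E k g)
    (hρ : IsAdmissibleDensity L E k g ρ) : ContinuousOn ρ (deltaSet k g) := by
  obtain ⟨⟨G, -, -, hd, -, hG0, hGl, -⟩, -⟩ := hρ
  refine hd.continuousOn.mono fun z hz => ?_
  rcases h.mem_deltaSet_iff.mp hz with hz | ⟨l, hl, hl', hz⟩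
  · exact hG0 hz
  · exact hGl l hl hl' ((h.isSmoothJordanCurve_deltaCurve hl hl').range_subset_closure hz)

/-- Near the finite interpolation nodes the Cauchy integrals over `L` and `Δ` coincide. -/
theorem eventually_rhoHatDelta_eq_rhoHat (h : IsSymmetricContour L E k g)
    (hE : IsInterpolationScheme L E) (hL : IsSmoothArc L) (hρ : IsAdmissibleDensity L E k g ρ) :
    ∀ᶠ i in atTop, ∀ z : ℂ, (z : OnePoint ℂ) ∈ E i →
      ∀ᶠ y in 𝓝 z, rhoHatDelta L E k g ρ y = rhoHat L ρ y := by
  have h₁ := hL.isRegularArc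
  have h₂ := h.isRegularArc_delta0
  filter_upwards [h.eventually_node_mem_domainZero hE h₁] with i hi z hz
  have hzΔ := h.node_notMem_deltaSet hE h₁ hz
  have hz0 := h.notMem_arcSet hzΔ
  have hzL := hE.notMem i z hz
  have hoff : ∀ᶠ y in 𝓝 z, y ∉ arcSet L ∧ y ∉ deltaSet k g :=
    (h₁.isClosed.isOpen_compl.eventually_mem hzL).and
      (h.isClosed_deltaSet.isOpen_compl.eventually_mem hzΔ)
  have hcls := h.eventually_mem_domainZero_iff hE h₁ hzΔ
  rcases wBranch_eq_or_eq_neg h₁ h₂ hzL hz0 with hw | hw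
  · filter_upwards [hoff, hcls, eventually_wBranch_eq h₁ h₂ hzL hz0 (σ := 1) (one_mul 1)
      (by rw [hw, one_mul])] with y hy1 hy2 hy3
    exact h.rhoHatDelta_eq_rhoHat hE hL hρ hy1.1 hy1.2
      (Or.inl ⟨by rw [hy3, one_mul], hy2.mpr ((hi z hz).1 hw)⟩)
  · filter_upwards [hoff, hcls, eventually_wBranch_eq h₁ h₂ hzL hz0 (σ := -1) (by norm_num)
      (by rw [hw, neg_one_mul])] with y hy1 hy2 hy3
    exact h.rhoHatDelta_eq_rhoHat hE hL hρ hy1.1 hy1.2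
      (Or.inr ⟨by rw [hy3, neg_one_mul], mt hy2.mp ((hi z hz).2 hw)⟩)

theorem eventually_cocompact_rhoHatDelta_eq_rhoHat (h : IsSymmetricContour L E k g)
    (hE : IsInterpolationScheme L E) (hL : IsSmoothArc L) (hρ : IsAdmissibleDensity L E k g ρ)
    (hinf : OnePoint.infty ∈ domainZero L E k g) :
    ∀ᶠ z in cocompact ℂ, rhoHatDelta L E k g ρ z = rhoHat L ρ z := by
  have h₁ := hL.isRegularArc
  have h₂ := h.isRegularArc_delta0
  filter_upwards [h.eventually_cocompact_mem_domainZero_iff hE h₁, eventually_wBranch_ne_neg h₁ h₂,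
    (isCompact_arcSet h₁.contDiff).compl_mem_cocompact, h.isCompact_deltaSet.compl_mem_cocompact]
    with z hz1 hz2 hz3 hz4
  exact h.rhoHatDelta_eq_rhoHat hE hL hρ hz3 hz4 (Or.inl ⟨(wBranch_eq_or_eq_neg h₁ h₂ hz3
    (h.notMem_arcSet hz4)).resolve_right hz2, hz1.mpr hinf⟩)

theorem tendsto_rhoHatDelta (h : IsSymmetricContour L E k g) (hρ : IsAdmissibleDensity L E k g ρ) :
    Tendsto (rhoHatDelta L E k g ρ) (cocompact ℂ) (𝓝 0) := by
  have := (h.tendsto_deltaCauchy_cocompact (h.continuousOn_density hρ)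
    (varsigma L E k g)).const_mul (2 * Real.pi * Complex.I : ℂ)⁻¹
  rw [mul_zero] at this
  exact this.congr fun z => (rhoHatDelta_eq L E k g ρ z).symm

theorem tendsto_rhoHat (hL : IsSmoothArc L) (hρ : IsAdmissibleDensity L E k g ρ) :
    Tendsto (rhoHat L ρ) (cocompact ℂ) (𝓝 0) := by
  obtain ⟨⟨G, -, -, hd, hGL, -⟩, -⟩ := hρ
  have := (tendsto_cauchyTransform_cocompact hL.contDiff.continuous zero_le_one
    (intervalIntegrable_comp_mul hL.contDiff.continuous zero_le_one
      hL.intervalIntegrable_traceDensity (hd.continuousOn.mono hGL))).const_mul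
        (2 * Real.pi * Complex.I : ℂ)⁻¹
  rw [mul_zero] at this
  exact this.congr fun z => (rhoHat_eq L ρ z).symm

/-- The integral formula for the function of the second kind, multiplied by `v`. -/
theorem eventually_nodePoly_mul_deltaCauchy (h : IsSymmetricContour L E k g)
    (hE : IsInterpolationScheme L E) (hL : IsSmoothArc L) (hρ : IsAdmissibleDensity L E k g ρ) :
    ∀ᶠ i in atTop, ∀ m n : ℕ, m + n = i → ∀ p q : ℂ[X],
      IsInterpolationPair (arcSet L) (rhoHat L ρ) (E i) m n p q → ∀ z ∉ deltaSet k g,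
        (nodePoly (E i)).eval z * ((2 * Real.pi * Complex.I)⁻¹ * deltaCauchy (varsigma L E k g) k g
          (fun s => q.eval s / (nodePoly (E i)).eval s * ρ s) z) =
            q.eval z * rhoHatDelta L E k g ρ z - p.eval z := by
  have hinfty : ∀ᶠ i in atTop, OnePoint.infty ∉ domainZero L E k g → OnePoint.infty ∉ E i := by
    by_cases hinf : OnePoint.infty ∈ domainZero L E k g
    · exact Eventually.of_forall fun _ h' => absurd hinf h'
    · exact (h.eventually_infty_notMem hinf).mono fun _ h' _ => h'
  filter_upwards [h.eventually_rhoHatDelta_eq_rhoHat hE hL hρ, hinfty] with i hi hi' m n hmn p q hpq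
  have h₁ := hL.isRegularArc
  have hρc := h.continuousOn_density hρ
  set v := nodePoly (E i) with hv
  set σ := varsigma L E k g
  have hv0 : v ≠ 0 := (monic_nodePoly _).ne_zero
  have hvΔ : ∀ z ∈ deltaSet k g, v.eval z ≠ 0 := fun z hz hvz =>
    h.node_notMem_deltaSet hE h₁ (nodePoly_eval_eq_zero_iff.mp hvz) hz
  set F : ℂ → ℂ := fun z => (2 * Real.pi * Complex.I)⁻¹ *
    deltaCauchy σ k g (fun s => q.eval s / v.eval s * ρ s) z with hF
  have hfc : ContinuousOn (fun s => q.eval s / v.eval s * ρ s) (deltaSet k g) :=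
    (q.continuous.continuousOn.div v.continuous.continuousOn hvΔ).mul hρc
  have hFd : DifferentiableOn ℂ F (deltaSet k g)ᶜ :=
    (h.differentiableOn_deltaCauchy hfc σ).const_mul _
  have hF0 : Tendsto F (cocompact ℂ) (𝓝 0) := by
    have := (h.tendsto_deltaCauchy_cocompact hfc σ).const_mul (2 * Real.pi * Complex.I : ℂ)⁻¹
    rwa [mul_zero] at this
  obtain ⟨Q, hQ⟩ := h.exists_polynomial_deltaCauchy hρc hvΔ q σ
  obtain ⟨R, hRd, hR, hRO⟩ := hpq.remainder
  have hR0 := tendsto_zero_of_isBigO_inv_pow hRO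
  -- The defect v F − (q ρ̂_Δ − p), which is a polynomial. The rest of the proof shows that it is
  -- zero.
  set P : ℂ[X] := C (2 * Real.pi * Complex.I : ℂ)⁻¹ * Q + p with hP
  have hPF : ∀ z ∉ deltaSet k g,
      v.eval z * F z = q.eval z * rhoHatDelta L E k g ρ z - p.eval z + P.eval z := by
    intro z hz
    rw [hP, eval_add, eval_mul, eval_C, rhoHatDelta_eq]
    simp only [hF]
    linear_combination (2 * Real.pi * Complex.I : ℂ)⁻¹ * hQ z hz
  have hoffv : ∀ᶠ z in cocompact ℂ, v.eval z ≠ 0 := by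
    have : {z | v.eval z = 0}.Finite := by
      refine (v.roots.toFinset.finite_toSet).subset fun z hz => ?_
      simpa [hv0] using hz
    exact this.isCompact.compl_mem_cocompact
  have hPzero : P = 0 := by
    -- Near a node ρ̂_Δ = ρ̂_L, so q ρ̂_Δ − p = v R and P/v is the analytic function F − R.
    refine eq_zero_of_tendsto_div hv0 (fun z hz => ⟨fun y => F y - R y, ?_, ?_⟩) ?_
    · have hmem := nodePoly_eval_eq_zero_iff.mp hz
      filter_upwards [h₁.isClosed.isOpen_compl.mem_nhds (hE.notMem i z hmem),
        h.isClosed_deltaSet.isOpen_compl.mem_nhds (h.node_notMem_deltaSet hE h₁ hmem)] with y h1 h2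
      exact (hFd.differentiableAt (h.isClosed_deltaSet.isOpen_compl.mem_nhds h2)).sub
        (hRd.differentiableAt (h₁.isClosed.isOpen_compl.mem_nhds h1))
    · have hmem := nodePoly_eval_eq_zero_iff.mp hz
      filter_upwards [h₁.isClosed.isOpen_compl.mem_nhds (hE.notMem i z hmem),
        h.isClosed_deltaSet.isOpen_compl.mem_nhds (h.node_notMem_deltaSet hE h₁ hmem),
        hi z hmem] with y h1 h2 h3 hvy
      rw [div_eq_iff hvy]
      linear_combination hR y h1 - hPF y h2 - q.eval y * h3
    · have hS : Tendsto (fun z => q.eval z / v.eval z *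
          (rhoHatDelta L E k g ρ z - rhoHat L ρ z)) (cocompact ℂ) (𝓝 0) := by
        by_cases hinf : OnePoint.infty ∈ domainZero L E k g
        · refine tendsto_const_nhds.congr' ?_
          filter_upwards [h.eventually_cocompact_rhoHatDelta_eq_rhoHat hE hL hρ hinf] with z hz
          rw [hz, sub_self, mul_zero]
        -- All m + n nodes are finite here, so q/v is bounded near infinity and it is enough that
        -- both transforms tend to 0.
        · have hdeg : q.degree ≤ v.degree := by
            rw [degree_eq_natDegree hv0, hv, natDegree_nodePoly (hi' hinf), hE.card_eq]
            exact degree_le_natDegree.trans (by exact_mod_cast hpq.degree_den.trans (by omega))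
          have hO : (fun z => q.eval z / v.eval z) =O[cocompact ℂ] fun _ => (1 : ℝ) := by
            have := isBigO_cobounded_of_degree_le hdeg
            rw [Metric.cobounded_eq_cocompact] at this
            obtain ⟨B, hB⟩ := this.bound
            refine Asymptotics.IsBigO.of_bound B ?_
            filter_upwards [hB, hoffv] with z hz hvz
            rw [norm_div, norm_one, mul_one, div_le_iff₀ (norm_pos_iff.mpr hvz)]
            exact hz
          have hT := (h.tendsto_rhoHatDelta hρ).sub (tendsto_rhoHat hL hρ)
          rw [sub_zero] at hT
          have := hO.mul_isLittleO ((Asymptotics.isLittleO_one_iff ℝ).mpr hT)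
          simp only [mul_one] at this
          exact (Asymptotics.isLittleO_one_iff ℝ).mp this
      have hlim := (hF0.sub hR0).sub hS
      rw [sub_zero, sub_zero] at hlim
      refine hlim.congr' ?_
      filter_upwards [hoffv, h.isCompact_deltaSet.compl_mem_cocompact,
        (isCompact_arcSet h₁.contDiff).compl_mem_cocompact] with z h1 h2 h3
      rw [eq_div_iff h1]
      have e : q.eval z / v.eval z * (rhoHatDelta L E k g ρ z - rhoHat L ρ z) * v.eval z =
          q.eval z * (rhoHatDelta L E k g ρ z - rhoHat L ρ z) := by
        field_simp
      linear_combination hPF z h2 - hR z h3 - e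
  intro z hz
  have := hPF z hz
  rw [hPzero, eval_zero, add_zero] at this
  exact this

end IsSymmetricContour

/-! ### From the formula multiplied by v to the function of the second kind -/

/-- The zeros of v are isolated and F is continuous, so F(z) is the limit that defines the value at
such a zero. -/
theorem secondKind_eq {L : ℝ → ℂ} {E : ℕ → Multiset (OnePoint ℂ)} {k : ℕ} {g : ℕ → ℝ → ℂ}
    {ρ : ℂ → ℂ} {v p q : ℂ[X]} (hv : v ≠ 0) {F : ℂ → ℂ} {U : Set ℂ} (hU : IsOpen U)
    (hF : ContinuousOn F U)
    (hFv : ∀ z ∈ U, v.eval z * F z = q.eval z * rhoHatDelta L E k g ρ z - p.eval z) {z : ℂ}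
    (hz : z ∈ U) : secondKind L E k g ρ v p q z = F z := by
  unfold secondKind
  split_ifs with hvz
  · rw [← hFv z hz, mul_div_cancel_left₀ _ hvz]
  · have hfin : {z | v.eval z = 0}.Finite := by
      refine (v.roots.toFinset.finite_toSet).subset fun z hz => ?_
      simpa [hv] using hz
    refine Tendsto.limUnder_eq (((hF.continuousAt (hU.mem_nhds hz)).mono_left
      nhdsWithin_le_nhds).congr' ?_)
    have hne : ∀ᶠ y in 𝓝[≠] z, v.eval y ≠ 0 := by
      have h1 := (hfin.subset (sdiff_subset (t := {z}))).isClosed.isOpen_compl.mem_nhds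
        (show z ∈ ({z | v.eval z = 0} \ {z})ᶜ by simp)
      filter_upwards [mem_nhdsWithin_of_mem_nhds h1, self_mem_nhdsWithin] with y hy hyz hvy
      exact hy ⟨hvy, hyz⟩
    filter_upwards [hne, mem_nhdsWithin_of_mem_nhds (hU.mem_nhds hz)] with y hy hyU
    rw [← hFv y hyU, mul_div_cancel_left₀ _ hy]

end MultipointPade

end

theorem proposition2 (L : ℝ → ℂ) (hL : MultipointPade.IsSmoothArc L)
    (E : ℕ → Multiset (OnePoint ℂ)) (hE : MultipointPade.IsInterpolationScheme L E)
    (k : ℕ) (g : ℕ → ℝ → ℂ) (hg : MultipointPade.IsSymmetricContour L E k g)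
    (ρ : ℂ → ℂ) (hρ : MultipointPade.IsAdmissibleDensity L E k g ρ) :
    ∃ N : ℕ, ∀ m n : ℕ, N ≤ m + n → ∀ p q v : ℂ[X],
      MultipointPade.IsMultipointPade L ρ E m n p q →
      v = MultipointPade.nodePoly (E (m + n)) →
      DifferentiableOn ℂ (MultipointPade.secondKind L E k g ρ v p q)
          (MultipointPade.deltaSet k g)ᶜ ∧
        Tendsto (MultipointPade.secondKind L E k g ρ v p q) (cocompact ℂ) (𝓝 0) ∧
        ∀ z ∉ MultipointPade.deltaSet k g,
          MultipointPade.DeltaIntegrable L E k g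
              (fun s => q.eval s / v.eval s * ρ s / (s - z)) ∧
            MultipointPade.secondKind L E k g ρ v p q z =
              (2 * Real.pi * Complex.I)⁻¹ *
                MultipointPade.deltaIntegral L E k g
                  (fun s => q.eval s / v.eval s * ρ s / (s - z)) := by
  obtain ⟨N, hN⟩ := eventually_atTop.mp (hg.eventually_nodePoly_mul_deltaCauchy hE hL hρ)
  refine ⟨N, ?_⟩
  rintro m n hmn p q v hpade rfl
  have hkey := hN (m + n) hmn m n rfl p q hpade.pair
  have hv0 := (MultipointPade.monic_nodePoly (E (m + n))).ne_zero
  have hfc : ContinuousOn (fun s => q.eval s / (MultipointPade.nodePoly (E (m + n))).eval s * ρ s)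
      (MultipointPade.deltaSet k g) :=
    (q.continuous.continuousOn.div (Polynomial.continuous _).continuousOn fun z hz hvz =>
      hg.node_notMem_deltaSet hE hL.isRegularArc
        (MultipointPade.nodePoly_eval_eq_zero_iff.mp hvz) hz).mul (hg.continuousOn_density hρ)
  have hd := (hg.differentiableOn_deltaCauchy hfc
    (MultipointPade.varsigma L E k g)).const_mul (2 * Real.pi * Complex.I : ℂ)⁻¹
  have ht := (hg.tendsto_deltaCauchy_cocompact hfc
    (MultipointPade.varsigma L E k g)).const_mul (2 * Real.pi * Complex.I : ℂ)⁻¹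
  rw [mul_zero] at ht
  have heq : ∀ z ∈ (MultipointPade.deltaSet k g)ᶜ, _ = _ := fun z hz =>
    MultipointPade.secondKind_eq hv0 hg.isClosed_deltaSet.isOpen_compl hd.continuousOn hkey hz
  refine ⟨hd.congr heq, ht.congr' ?_, fun z hz => ⟨hg.deltaIntegrable hfc hz, ?_⟩⟩
  · filter_upwards [hg.isCompact_deltaSet.compl_mem_cocompact] with z hz
    exact (heq z hz).symm
  · rw [heq z hz, MultipointPade.deltaIntegral_eq_deltaCauchy L E k g
      (fun s => q.eval s / (MultipointPade.nodePoly (E (m + n))).eval s * ρ s) z]
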